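/- **Setting.** Let $V$ be a free $\mathbb Z$-module of rank $4$ with an isomorphism $\mathrm{vol}\colon\bigwedge^4V\to\mathbb Z$, and let $\iota\colon\bigwedge^2V^\vee\to\bigwedge^2V$ be the isomorphism defined by the unimodular form $(\alpha,\beta)=\mathrm{vol}(\alpha\wedge\beta)$. Let $\vartheta_1,\vartheta_2,\vartheta_3$ be nonzero integers and $m$ a positive rational number with $\vartheta_1\vartheta_2=2m\vartheta_3^2$. Put $\zeta=(0,1)\in\bigwedge^2V\oplus\mathbb Z$, let $(\alpha+x\zeta,\beta+y\zeta)=\mathrm{vol}(\alpha\wedge\beta)-mxy$ on $\bigwedge^2V_{\mathbb C}\oplus\mathbb C$, denote the induced form on the dual space also by $(\,,)$, and let $\Phi_\vartheta\colon\bigwedge^2(V\oplus V^\vee)\to\bigwedge^2V\oplus\mathbb Z$ be given by $\Phi_\vartheta((v,g)\wedge(w,k))=(\vartheta_1\,v\wedge w+\vartheta_2\,\iota(g\wedge k),\ \vartheta_3(g(w)-k(v)))$. For $[\sigma]\in\mathbb P(\bigwedge^2V_{\mathbb C}\oplus\mathbb C)$ with $(\sigma,\sigma)=0$ and $(\sigma,\bar\sigma)>0$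 define $H^{1,0}_{[\sigma]}\subset V_{\mathbb C}\oplus V_{\mathbb C}^\vee$ as follows. If $\sigma\notin\zeta^\perp$, rescale so that $\sigma=\vartheta_2\alpha-2\vartheta_3\zeta$; then $H^{1,0}_{[\sigma]}$ is the graph of the antisymmetric map $f\colon V_{\mathbb C}\to V_{\mathbb C}^\vee$ with $\langle f(w),v\rangle=(\alpha,v\wedge w)$ for all $v,w$. If $\sigma\in\zeta^\perp$, then $[\sigma]=\bigwedge^2U$ for a plane $U\subset V_{\mathbb C}$, and $H^{1,0}_{[\sigma]}=U\oplus U^\perp$, with $U^\perp\subset V_{\mathbb C}^\vee$ the annihilator of $U$. Let $J_{[\sigma]}(\vartheta)=(V_{\mathbb C}\oplus V_{\mathbb C}^\vee)/(H^{1,0}_{[\sigma]}+(V\oplus V^\vee))$. Let $h\in(\bigwedge^2V\oplus\mathbb Z)^\vee$ with $(h,h)>0$, and let $\mathscr D_h$ be the set of $[\sigma]$ as above with $\langle h,\sigma\rangle=0$. For $[\sigma]\in\mathscr D_h$ let $\Theta_{[\sigma]}(\vartheta)$ be the rational class on $J_{[\sigma]}(\vartheta)$ defined by the alternating form $\langle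 h,\Phi_\vartheta(x\wedge y)\rangle$ on $H_1(J_{[\sigma]}(\vartheta),\mathbb Z)=V\oplus V^\vee$. **Weil type.** A polarized abelian variety of Weil type $(A,\varphi,\Theta)$ of dimension $2g$, with associated field $\mathbb K=\mathbb Q(\sqrt{-D})$, is a complex torus $A$ of dimension $2g$ with a rational polarization (ample class) $\Theta$ and $\varphi\in\mathrm{End}(A)$ such that $\varphi^2=-D$ for an integer $D>0$, the $\pm\sqrt{-D}$-eigenspaces of $\varphi^*$ on $H^{1,0}(A)$ both have dimension $g$, and $\varphi^*\Theta=D\,\Theta$. If $E$ is the alternating form of $\Theta$ on $H_1(A,\mathbb Q)$, then $\mathrm{Det}\,\Theta\in\mathbb Q^*/\mathrm{Nm}(\mathbb K^*)$ is the class of the determinant of the $\mathbb K$-Hermitian form $H(x,y)=E(x,\varphi_*y)+\sqrt{-D}\,E(x,y)$ on $H_1(A,\mathbb Q)$, where $\sqrt{-D}$ acts as $\varphi_*$. **Theorem.** There is exactly one connected component $\mathscr D_h^+$ of $\mathscr D_h$ such that $\Theta_{[\sigma]}(\vartheta)$ is ample for all $[\sigma]\in\mathscr D_h^+$. There are an endomorphism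 $\varphi$ of $V\oplus V^\vee$ and a positive integer $D$ with $\mathbb Q(\sqrt{-D})=\mathbb Q(\sqrt{-m(h,h)})=:\mathbb K$ such that: 1. for every $[\sigma]\in\mathscr D_h^+$, $\varphi$ induces an endomorphism of $J_{[\sigma]}(\vartheta)$, and $(J_{[\sigma]}(\vartheta),\varphi,\Theta_{[\sigma]}(\vartheta))$ is a polarized abelian variety of Weil type, of dimension $4$, with associated field $\mathbb K$; 2. for every $[\sigma]\in\mathscr D_h^+$, $\mathrm{Det}\,\Theta_{[\sigma]}(\vartheta)=1$ in $\mathbb Q^*/\mathrm{Nm}(\mathbb K^*)$; 3. the family is complete up to isogeny: for every polarized abelian fourfold of Weil type $(A,\psi,\Theta)$ with associated field $\mathbb K$ and $\mathrm{Det}\,\Theta=1$ there are $[\sigma]\in\mathscr D_h^+$ and an isogeny $f\colon A\to J_{[\sigma]}(\vartheta)$ that commutes with the actions of $\mathbb K$ (where, if $\psi^2=-D'$, $\sqrt{-D'}$ and $\sqrt{-D}$, the square roots in $\mathbb C$ with positive imaginary part, act as $\psi$ and $\varphi$) and satisfies $f^*\Theta_{[\sigma]}(\vartheta)=n^2\,\Theta$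 for some integer $n\ge1$; that is, $\tfrac1nf$ carries one polarization to the other in the category of abelian varieties up to isogeny. -/

import Mathlib

open scoped TensorProduct LinearAlgebra.Projectivization IntermediateField

noncomputable section

namespace WeilTori

/-! ### Compact complex tori, polarizations, Weil type -/

section Tori

variable {Λ W : Type*} [AddCommGroup Λ] [AddCommGroup W] [Module ℂ W]

/-- `j : Λ → W` embeds `Λ` as a full lattice in the complex vector space `W` of dimension `n`
(a `ℤ`-basis of `Λ`, of cardinality `2 n`, is sent to an `ℝ`-basis of `W`), i.e. `T = W / j(Λ)` is
a compact complex torus of dimension `n`. One has `H₁(T, ℤ) = Λ`, the tangent space at the origin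
is `W`, and `H^{1,0}(T)` is the complex dual of `W`. Homomorphisms `W/j(Λ) → W'/j'(Λ')` are
`ℂ`-linear maps `W → W'` compatible with a homomorphism `Λ → Λ'`. -/
def IsComplexTorus (n : ℕ) (j : Λ →ₗ[ℤ] W) : Prop :=
  ∃ (b : Module.Basis (Fin (2 * n)) ℤ Λ) (B : Module.Basis (Fin (2 * n)) ℝ W),
    ∀ i, B i = j (b i)

/-- The rational alternating form `E` on `Λ = H₁(T, ℤ)` is (the class in `H²(T, ℚ)` of) a
polarization of `T = W / j(Λ)`: its real extension `ER` is an alternating form of type `(1,1)`, and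
the associated Hermitian form, with real part `ER (i v) w`, is positive definite. In other words,
the rational class of `E` is an ample class in `H^{1,1}`. -/
def IsPolarization (j : Λ →ₗ[ℤ] W) (E : Λ →ₗ[ℤ] Λ →ₗ[ℤ] ℚ) : Prop :=
  ∃ ER : W →ₗ[ℝ] W →ₗ[ℝ] ℝ,
    (∀ x y : Λ, ER (j x) (j y) = (E x y : ℝ)) ∧
    (∀ v : W, ER v v = 0) ∧
    (∀ v w : W, ER (Complex.I • v) (Complex.I • w) = ER v w) ∧
    (∀ v : W, v ≠ 0 → 0 < ER (Complex.I • v) v)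

/-- `√(-d)` for a real number `d ≥ 0`, as a complex number. -/
def sqrtNeg (d : ℝ) : ℂ := Complex.I * (Real.sqrt d : ℂ)

/-- The field `ℚ(√(-d)) ⊆ ℂ`, for a real number `d ≥ 0`. -/
def quadField (d : ℝ) : IntermediateField ℚ ℂ := ℚ⟮sqrtNeg d⟯

/-- `(T, φ, E)`, with `T = W / j(Λ)`, is a polarized abelian variety of Weil type, of dimension
`2 g`, with `φ² = -D`: here `φ` is (the action on `H₁(T, ℤ)` of) an endomorphism of `T`, the
linear map `A` is its differential, and the transpose `A.dualMap` is the action of `φ` on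
`H^{1,0}(T)`. -/
structure IsPolarizedWeil (g : ℕ) (j : Λ →ₗ[ℤ] W) (E : Λ →ₗ[ℤ] Λ →ₗ[ℤ] ℚ)
    (φ : Module.End ℤ Λ) (D : ℕ) : Prop where
  torus : IsComplexTorus (2 * g) j
  polarization : IsPolarization j E
  pos : 0 < D
  sq : ∀ x, φ (φ x) = -((D : ℤ) • x)
  eigenspaces : ∃ A : Module.End ℂ W, (∀ x, A (j x) = j (φ x)) ∧
    Module.finrank ℂ (Module.End.eigenspace A.dualMap (sqrtNeg D)) = g ∧
    Module.finrank ℂ (Module.End.eigenspace A.dualMap (-sqrtNeg D)) = g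
  preserves : ∀ x y, E (φ x) (φ y) = (D : ℚ) * E x y

/-- The Hermitian form `H(x, y) = E(x, φ y) + √(-D) E(x, y)`, with values in `ℚ(√(-D)) ⊆ ℂ`. -/
def hermForm (E : Λ →ₗ[ℤ] Λ →ₗ[ℤ] ℚ) (φ : Module.End ℤ Λ) (D : ℕ) (x y : Λ) : ℂ :=
  (E x (φ y) : ℂ) + sqrtNeg D * (E x y : ℂ)

/-- The determinant of the polarization `E` of a Weil type variety of dimension `2 g` is the class
of `δ` in `ℚ* / Nm(K*)`, where `K = ℚ(√(-D))` acts on `H₁(T, ℚ) = Λ ⊗ ℚ` through `√(-D) ↦ φ`: the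
Gram matrix of the Hermitian form in some `K`-basis of `H₁(T, ℚ)` has determinant `δ` times a norm.
The rank of `Λ` being `4 g`, a family `e` of `2 g` elements of `Λ` is a `K`-basis iff the `4 g`
elements `e i`, `φ (e i)` are linearly independent; the class does not depend on the basis, and a
basis contained in `Λ` is obtained from any other one by clearing denominators. -/
def HasDet (g : ℕ) (E : Λ →ₗ[ℤ] Λ →ₗ[ℤ] ℚ) (φ : Module.End ℤ Λ) (D : ℕ) (δ : ℚ) : Prop :=
  ∃ e : Fin (2 * g) → Λ, LinearIndependent ℤ (Sum.elim e (fun i => φ (e i))) ∧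
    ∃ z : quadField D, z ≠ 0 ∧
      (Matrix.of fun i k => hermForm E φ D (e i) (e k)).det =
        ((δ * Algebra.norm ℚ z : ℚ) : ℂ)

variable {Λ' W' : Type*} [AddCommGroup Λ'] [AddCommGroup W'] [Module ℂ W']

/-- `(T, φ, E)` and `(T', φ', E')` are isogenous, by an isogeny that matches the endomorphisms and
the polarizations. The isogeny is `f` on `H₁` and the linear isomorphism `B` on tangent spaces. It
is linear over the common field `ℚ(√(-D)) = ℚ(√(-D'))`, acting by `√(-D) ↦ φ`, `√(-D') ↦ φ'`: if
`a √D = b √D'` then `a φ` corresponds to `b φ'`. As a morphism in the category of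
abelian varieties up to isogeny it is, after division by the integer `n`, an isometry. -/
def WeilIsogenous (j : Λ →ₗ[ℤ] W) (E : Λ →ₗ[ℤ] Λ →ₗ[ℤ] ℚ) (φ : Module.End ℤ Λ) (D : ℕ)
    (j' : Λ' →ₗ[ℤ] W') (E' : Λ' →ₗ[ℤ] Λ' →ₗ[ℤ] ℚ) (φ' : Module.End ℤ Λ') (D' : ℕ) : Prop :=
  ∃ (f : Λ →ₗ[ℤ] Λ') (B : W ≃ₗ[ℂ] W'),
    (∀ x, B (j x) = j' (f x)) ∧
    (∃ a b : ℕ, 0 < a ∧ 0 < b ∧ a ^ 2 * D = b ^ 2 * D' ∧ ∀ x, a • f (φ x) = b • φ' (f x)) ∧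
    (∃ n : ℕ, 0 < n ∧ ∀ x y, E' (f x) (f y) = (n : ℚ) ^ 2 * E x y)

end Tori

/-! ### Linear algebra of a free module of rank four with a volume form -/

section Integral

variable {V : Type*} [AddCommGroup V]

/-- `(v, w) ↦ v ∧ w`. -/
def wedge (V : Type*) [AddCommGroup V] : V →ₗ[ℤ] V →ₗ[ℤ] ⋀[ℤ]^2 V :=
  LinearMap.mk₂ ℤ (fun v w => exteriorPower.ιMulti ℤ 2 ![v, w])
    (fun a b c => by ext; simp [ExteriorAlgebra.ιMulti_apply, add_mul])
    (fun r a b => by ext; simp [ExteriorAlgebra.ιMulti_apply, mul_assoc])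
    (fun a b c => by ext; simp [ExteriorAlgebra.ιMulti_apply, mul_add])
    (fun r a b => by
      ext; simp [ExteriorAlgebra.ιMulti_apply, ← mul_assoc, (Int.cast_commute r _).eq])

theorem mul_mem_four (α β : ⋀[ℤ]^2 V) :
    (α : ExteriorAlgebra ℤ V) * (β : ExteriorAlgebra ℤ V) ∈ ⋀[ℤ]^4 V := by
  have h := Submodule.mul_mem_mul α.2 β.2
  rwa [← pow_add] at h

/-- The symmetric bilinear form `(α, β) = vol (α ∧ β)` on `⋀² V`. -/
def volForm (vol : ⋀[ℤ]^4 V ≃ₗ[ℤ] ℤ) : LinearMap.BilinForm ℤ (⋀[ℤ]^2 V) :=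
  LinearMap.mk₂ ℤ (fun α β => vol ⟨α * β, mul_mem_four α β⟩)
    (fun a b c => by rw [← map_add]; congr 1; ext; simp [add_mul])
    (fun r a b => by rw [← map_smul]; congr 1; ext; simp [mul_assoc])
    (fun a b c => by rw [← map_add]; congr 1; ext; simp [mul_add])
    (fun r a b => by
      rw [← map_smul]; congr 1; ext; simp [← mul_assoc, (Int.cast_commute r _).eq])

theorem volForm_wedge (vol : ⋀[ℤ]^4 V ≃ₗ[ℤ] ℤ) (a b c d : V) :
    volForm vol (wedge V a b) (wedge V c d) = vol (exteriorPower.ιMulti ℤ 4 ![a, b, c, d]) := by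
  simp only [volForm, wedge, LinearMap.mk₂_apply]
  congr 1
  ext
  simp [ExteriorAlgebra.ιMulti_apply, mul_assoc]

variable [Module.Free ℤ V] [Module.Finite ℤ V]

theorem finrank_eq_four (vol : ⋀[ℤ]^4 V ≃ₗ[ℤ] ℤ) : Module.finrank ℤ V = 4 := by
  have h := vol.finrank_eq
  rw [exteriorPower.finrank_eq, Module.finrank_self] at h
  have h4 : 4 ≤ Module.finrank ℤ V := by
    by_contra hlt
    rw [Nat.choose_eq_zero_of_lt (by omega)] at h
    omega
  rcases Nat.lt_or_ge 4 (Module.finrank ℤ V) with h5 | h5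
  · have := Nat.choose_le_choose 4 (show 5 ≤ Module.finrank ℤ V by omega)
    rw [h] at this
    norm_num [Nat.choose] at this
  · omega

theorem volForm_surjective (vol : ⋀[ℤ]^4 V ≃ₗ[ℤ] ℤ) :
    Function.Surjective (volForm vol : ⋀[ℤ]^2 V →ₗ[ℤ] Module.Dual ℤ (⋀[ℤ]^2 V)) := by
  classical
  let b : Module.Basis (Fin 4) ℤ V := Module.finBasisOfFinrankEq ℤ V (finrank_eq_four vol)
  let volA : V [⋀^Fin 4]→ₗ[ℤ] ℤ :=
    exteriorPower.alternatingMapLinearEquiv.symm (vol : ⋀[ℤ]^4 V →ₗ[ℤ] ℤ)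
  have hvolA : ∀ x, vol (exteriorPower.ιMulti ℤ 4 x) = volA x := fun x => rfl
  set u : ℤ := volA b with hu
  have hvol : volA = u • b.det := volA.eq_smul_basis_det b
  have huu : u * u = 1 := by
    have hdvd : ∀ y, u ∣ vol y := by
      intro y
      have : (vol : ⋀[ℤ]^4 V →ₗ[ℤ] ℤ)
          = u • exteriorPower.alternatingMapLinearEquiv b.det := by
        apply exteriorPower.linearMap_ext
        ext x
        have := congrArg (fun F => F x) hvol
        simpa [hvolA] using this
      exact ⟨exteriorPower.alternatingMapLinearEquiv b.det y, by
        simpa using congrArg (fun F => F y) this⟩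
    have h1 : u ∣ 1 := by simpa using hdvd (vol.symm 1)
    rcases Int.isUnit_iff.1 (isUnit_of_dvd_one h1) with h | h <;> rw [h] <;> norm_num
  have key : ∀ i k p q, volForm vol (wedge V (b i) (b k)) (wedge V (b p) (b q))
      = u * (Matrix.of fun r c => if ![i, k, p, q] r = c then (1 : ℤ) else 0).det := by
    intro i k p q
    rw [volForm_wedge, hvolA, hvol, AlternatingMap.smul_apply, smul_eq_mul,
      Module.Basis.det_apply, ← Matrix.det_transpose]
    congr 2
    ext r c
    have : (![b i, b k, b p, b q] : Fin 4 → V) r = b (![i, k, p, q] r) := by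
      fin_cases r <;> rfl
    simp [Module.Basis.toMatrix_apply, this, Finsupp.single_apply]
  have hsw : ∀ x y : V, wedge V x y = - wedge V y x := by
    intro x y
    ext
    simp only [wedge, LinearMap.mk₂_apply]
    simp [ExteriorAlgebra.ιMulti_apply]
    exact eq_neg_of_add_eq_zero_left (ExteriorAlgebra.ι_add_mul_swap x y)
  have hd : ∀ p q r s : Fin 4, (Matrix.of fun r' c => if ![p, q, r, s] r' = c then (1 : ℤ)
      else 0).det * 12 = ((q : ℤ) - p) * (r - p) * (s - p) * (r - q) * (s - q) * (s - r) := by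
    decide +kernel
  intro ψ
  obtain ⟨X, hX⟩ : ∃ X : ⋀[ℤ]^2 V, ∀ i k : Fin 4, i < k →
      volForm vol X (wedge V (b i) (b k)) = ψ (wedge V (b i) (b k)) := by
    refine ⟨u • (ψ (wedge V (b 2) (b 3)) • wedge V (b 0) (b 1)
      - ψ (wedge V (b 1) (b 3)) • wedge V (b 0) (b 2)
      + ψ (wedge V (b 1) (b 2)) • wedge V (b 0) (b 3)
      + ψ (wedge V (b 0) (b 3)) • wedge V (b 1) (b 2)
      - ψ (wedge V (b 0) (b 2)) • wedge V (b 1) (b 3)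
      + ψ (wedge V (b 0) (b 1)) • wedge V (b 2) (b 3)), fun i k hik => ?_⟩
    simp only [map_smul, map_add, map_sub, LinearMap.smul_apply, LinearMap.add_apply,
      LinearMap.sub_apply, key, smul_eq_mul]
    have h01 := hd 0 1 i k
    have h02 := hd 0 2 i k
    have h03 := hd 0 3 i k
    have h12 := hd 1 2 i k
    have h13 := hd 1 3 i k
    have h23 := hd 2 3 i k
    clear hd
    generalize (Matrix.of fun r' c => if ![0, 1, i, k] r' = c then (1 : ℤ) else 0).det = d1 at *
    generalize (Matrix.of fun r' c => if ![0, 2, i, k] r' = c then (1 : ℤ) else 0).det = d2 at *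
    generalize (Matrix.of fun r' c => if ![0, 3, i, k] r' = c then (1 : ℤ) else 0).det = d3 at *
    generalize (Matrix.of fun r' c => if ![1, 2, i, k] r' = c then (1 : ℤ) else 0).det = d4 at *
    generalize (Matrix.of fun r' c => if ![1, 3, i, k] r' = c then (1 : ℤ) else 0).det = d5 at *
    generalize (Matrix.of fun r' c => if ![2, 3, i, k] r' = c then (1 : ℤ) else 0).det = d6 at *
    suffices h : ψ (wedge V (b 2) (b 3)) * d1 - ψ (wedge V (b 1) (b 3)) * d2
        + ψ (wedge V (b 1) (b 2)) * d3 + ψ (wedge V (b 0) (b 3)) * d4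
        - ψ (wedge V (b 0) (b 2)) * d5 + ψ (wedge V (b 0) (b 1)) * d6
        = ψ (wedge V (b i) (b k)) by
      rw [← h]
      linear_combination (ψ (wedge V (b 2) (b 3)) * d1 - ψ (wedge V (b 1) (b 3)) * d2
        + ψ (wedge V (b 1) (b 2)) * d3 + ψ (wedge V (b 0) (b 3)) * d4
        - ψ (wedge V (b 0) (b 2)) * d5 + ψ (wedge V (b 0) (b 1)) * d6) * huu
    fin_cases i <;> fin_cases k <;> simp at hik <;> norm_num at h01 h02 h03 h12 h13 h23 <;>
      (try replace h13 : d5 = -1 := by omega) <;> (try replace h02 : d2 = -1 := by omega) <;>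
      simp [h01, h02, h03, h12, h13, h23]
  refine ⟨X, ?_⟩
  apply exteriorPower.linearMap_ext
  apply b.ext_alternating
  intro v hv
  have hw : exteriorPower.ιMulti ℤ 2 (fun i => b (v i)) = wedge V (b (v 0)) (b (v 1)) := by
    simp only [wedge, LinearMap.mk₂_apply]
    congr 1
    ext i
    fin_cases i <;> rfl
  have hne : v 0 ≠ v 1 := fun h => by simpa using hv h
  have hfin : volForm vol X (wedge V (b (v 0)) (b (v 1))) = ψ (wedge V (b (v 0)) (b (v 1))) := by
    rcases lt_or_gt_of_ne hne with h | h
    · exact hX _ _ h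
    · rw [hsw, map_neg, map_neg, hX _ _ h]
  rw [← hw] at hfin
  exact hfin

theorem volForm_bijective (vol : ⋀[ℤ]^4 V ≃ₗ[ℤ] ℤ) :
    Function.Bijective (volForm vol : ⋀[ℤ]^2 V →ₗ[ℤ] Module.Dual ℤ (⋀[ℤ]^2 V)) := by
  refine ⟨?_, volForm_surjective vol⟩
  let e := (Module.Free.chooseBasis ℤ (⋀[ℤ]^2 V)).toDualEquiv
  have h : Function.Injective ((e.symm : _ →ₗ[ℤ] ⋀[ℤ]^2 V) ∘ₗ volForm vol) :=
    OrzechProperty.injective_of_surjective_endomorphism _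
      (e.symm.surjective.comp (volForm_surjective vol))
  exact Function.Injective.of_comp h

/-- The isomorphism `ι : (⋀² V)^∨ ≃ ⋀² V` defined by the (unimodular) form `(,)`, i.e.
`(ι ψ, β) = ψ β`. -/
def iotaEquiv (vol : ⋀[ℤ]^4 V ≃ₗ[ℤ] ℤ) : Module.Dual ℤ (⋀[ℤ]^2 V) ≃ₗ[ℤ] ⋀[ℤ]^2 V :=
  (LinearEquiv.ofBijective _ (volForm_bijective vol)).symm

theorem volForm_iotaEquiv (vol : ⋀[ℤ]^4 V ≃ₗ[ℤ] ℤ) (ψ : Module.Dual ℤ (⋀[ℤ]^2 V))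
    (β : ⋀[ℤ]^2 V) : volForm vol (iotaEquiv vol ψ) β = ψ β := by
  have := (LinearEquiv.ofBijective _ (volForm_bijective vol)).apply_symm_apply ψ
  exact congrArg (fun F => F β) this

/-- `(g, k) ↦ ι (g ∧ k)` for `g, k ∈ V^∨`, where `g ∧ k ∈ ⋀² V^∨ = (⋀² V)^∨` is the functional
`v ∧ w ↦ g v * k w - g w * k v`. -/
def iotaWedge (vol : ⋀[ℤ]^4 V ≃ₗ[ℤ] ℤ) :
    Module.Dual ℤ V →ₗ[ℤ] Module.Dual ℤ V →ₗ[ℤ] ⋀[ℤ]^2 V :=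
  (wedge (Module.Dual ℤ V)).compr₂
    ((iotaEquiv vol : _ →ₗ[ℤ] ⋀[ℤ]^2 V) ∘ₗ exteriorPower.pairingDual ℤ V 2)

set_option linter.unusedSimpArgs false in
/-- The bilinear antisymmetric map `Φ_ϑ` on `V ⊕ V^∨`, with values in `⋀² V ⊕ ℤ`:
`Φ_ϑ ((v, g) ∧ (w, k)) = (ϑ₁ v ∧ w + ϑ₂ ι (g ∧ k), ϑ₃ (g w - k v))`. -/
def Phi (vol : ⋀[ℤ]^4 V ≃ₗ[ℤ] ℤ) (ϑ₁ ϑ₂ ϑ₃ : ℤ) :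
    (V × Module.Dual ℤ V) →ₗ[ℤ] (V × Module.Dual ℤ V) →ₗ[ℤ] (⋀[ℤ]^2 V × ℤ) :=
  LinearMap.mk₂ ℤ
    (fun x y => (ϑ₁ • wedge V x.1 y.1 + ϑ₂ • iotaWedge vol x.2 y.2, ϑ₃ * (x.2 y.1 - y.2 x.1)))
    (fun a b c => by
      refine Prod.ext ?_ ?_
      · simp only [Prod.fst_add, Prod.snd_add, Prod.smul_fst, Prod.smul_snd, map_add, map_smul,
          LinearMap.add_apply, LinearMap.smul_apply]
        module
      · simp
        ring)
    (fun r a b => by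
      refine Prod.ext ?_ ?_
      · simp only [Prod.fst_add, Prod.snd_add, Prod.smul_fst, Prod.smul_snd, map_add, map_smul,
          LinearMap.add_apply, LinearMap.smul_apply]
        module
      · simp
        ring)
    (fun a b c => by
      refine Prod.ext ?_ ?_
      · simp only [Prod.fst_add, Prod.snd_add, Prod.smul_fst, Prod.smul_snd, map_add, map_smul,
          LinearMap.add_apply, LinearMap.smul_apply]
        module
      · simp
        ring)
    (fun r a b => by
      refine Prod.ext ?_ ?_
      · simp only [Prod.fst_add, Prod.snd_add, Prod.smul_fst, Prod.smul_snd, map_add, map_smul,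
          LinearMap.add_apply, LinearMap.smul_apply]
        module
      · simp
        ring)

/-- The alternating form `⟨x, y⟩_{ϑ,h} = ⟨h, Φ_ϑ (x ∧ y)⟩` on `V ⊕ V^∨`, for
`h ∈ (⋀² V ⊕ ℤ)^∨`. -/
def polForm (vol : ⋀[ℤ]^4 V ≃ₗ[ℤ] ℤ) (ϑ₁ ϑ₂ ϑ₃ : ℤ) (h : Module.Dual ℤ (⋀[ℤ]^2 V × ℤ)) :
    (V × Module.Dual ℤ V) →ₗ[ℤ] (V × Module.Dual ℤ V) →ₗ[ℤ] ℚ :=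
  (Phi vol ϑ₁ ϑ₂ ϑ₃).compr₂ ((Int.castAddHom ℚ).toIntLinearMap ∘ₗ h)

/-- The square `(h, h)^∨` of `h = (h₀, s) ∈ (⋀² V ⊕ ℤ)^∨` for the dual of the form
`(α + x ζ, β + y ζ) = vol (α ∧ β) - m x y`: the functional `h` is the pairing with
`ℓ = ι h₀ - (s / m) ζ`, and `(h, h)^∨ = (ℓ, ℓ)`. -/
def dualSq (vol : ⋀[ℤ]^4 V ≃ₗ[ℤ] ℤ) (m : ℚ) (h : Module.Dual ℤ (⋀[ℤ]^2 V × ℤ)) : ℚ :=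
  let l := iotaEquiv vol (h ∘ₗ LinearMap.inl ℤ _ _)
  let y : ℚ := -(h (0, 1) : ℚ) / m
  (volForm vol l l : ℚ) - m * y * y

end Integral

/-! ### The period domain and the associated complex tori -/

section Complex

open scoped ComplexConjugate

variable {V : Type*} [AddCommGroup V]

/-- The complex vector space `⋀² V_ℂ ⊕ ℂ = (⋀² V ⊗ ℂ) ⊕ ℂ`. -/
abbrev K3Space (V : Type*) [AddCommGroup V] : Type _ := (ℂ ⊗[ℤ] ⋀[ℤ]^2 V) × ℂ

/-- Complex conjugation on `⋀² V_ℂ ⊕ ℂ`. -/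
def K3Space.conj (σ : K3Space V) : K3Space V :=
  (LinearMap.rTensor (⋀[ℤ]^2 V) ((starRingEnd ℂ).toAddMonoidHom.toIntLinearMap) σ.1,
    (starRingEnd ℂ) σ.2)

/-- The complex bilinear extension of `(α, β) = vol (α ∧ β)`. -/
def volFormC (vol : ⋀[ℤ]^4 V ≃ₗ[ℤ] ℤ) : LinearMap.BilinForm ℂ (ℂ ⊗[ℤ] ⋀[ℤ]^2 V) :=
  LinearMap.BilinForm.baseChange ℂ (volForm vol)

/-- The wedge product `V_ℂ × V_ℂ → ⋀² V_ℂ`. -/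
def wedgeC (V : Type*) [AddCommGroup V] :
    (ℂ ⊗[ℤ] V) →ₗ[ℂ] (ℂ ⊗[ℤ] V) →ₗ[ℂ] (ℂ ⊗[ℤ] ⋀[ℤ]^2 V) :=
  LinearMap.BilinMap.baseChange ℂ (wedge V)

/-- The bilinear form `(α + x ζ, β + y ζ) = vol (α ∧ β) - m x y` on `⋀² V_ℂ ⊕ ℂ`. -/
def K3Space.form (vol : ⋀[ℤ]^4 V ≃ₗ[ℤ] ℤ) (m : ℚ) (σ τ : K3Space V) : ℂ :=
  volFormC vol σ.1 τ.1 - (m : ℂ) * σ.2 * τ.2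

/-- The duality pairing `⟨h, σ⟩` between `(⋀² V ⊕ ℤ)^∨` and `⋀² V_ℂ ⊕ ℂ`. -/
def K3Space.pair (h : Module.Dual ℤ (⋀[ℤ]^2 V × ℤ)) (σ : K3Space V) : ℂ :=
  Module.Dual.baseChange ℂ (h ∘ₗ LinearMap.inl ℤ _ _) σ.1 + (h (0, 1) : ℂ) * σ.2

/-- The period domain `𝒟_h = {[σ] | (σ, σ) = 0, (σ, σ̄) > 0, ⟨h, σ⟩ = 0}`. These conditions do not
depend on the representative, and `(σ, σ̄)` is always real. -/
def periodDomain (vol : ⋀[ℤ]^4 V ≃ₗ[ℤ] ℤ) (m : ℚ) (h : Module.Dual ℤ (⋀[ℤ]^2 V × ℤ)) :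
    Set (ℙ ℂ (K3Space V)) :=
  {p | K3Space.form vol m p.rep p.rep = 0 ∧
    0 < (K3Space.form vol m p.rep (K3Space.conj p.rep)).re ∧
    K3Space.pair h p.rep = 0}

/-- The usual topology of the projective space of a finite dimensional complex vector space: the
quotient topology of the usual topology on the set of nonzero vectors. -/
@[reducible]
def projTopology (U : Type*) [AddCommGroup U] [Module ℂ U] : TopologicalSpace (ℙ ℂ U) :=
  letI : TopologicalSpace U := moduleTopology ℂ U
  TopologicalSpace.coinduced
    (fun v : {v : U // v ≠ 0} => Projectivization.mk ℂ v.1 v.2) inferInstance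

/-- The antisymmetric map `f : V_ℂ → V_ℂ^∨` such that `ι (ω_f) = α`. Here
`ω_f (v, w) = ⟨f w, v⟩` for antisymmetric `f`, so that the condition is
`⟨f w, v⟩ = (α, v ∧ w)` for all `v, w`. -/
def antisymMap (vol : ⋀[ℤ]^4 V ≃ₗ[ℤ] ℤ) (α : ℂ ⊗[ℤ] ⋀[ℤ]^2 V) :
    (ℂ ⊗[ℤ] V) →ₗ[ℂ] Module.Dual ℂ (ℂ ⊗[ℤ] V) :=
  ((wedgeC V).compr₂ (volFormC vol α)).flip

open Classical in
/-- The subspace `H^{1,0}_{[σ]}(ϑ)` of `V_ℂ ⊕ V_ℂ^∨`, for `σ = α + x ζ`. If `x ≠ 0` (that is,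
`σ ∉ ζ^⊥`), rescale `σ` to be `ϑ₂ α' - 2 ϑ₃ ζ`; then `H^{1,0}` is the graph of the antisymmetric
map `f` with `ι (ω_f) = α'`. If `x = 0`, then `σ = α` is decomposable, `⋀² U = [σ]` for the
subspace `U = {v | v ∧ α = 0} = {v | (α, w ∧ v) = 0 for all w}`, and `H^{1,0} = U ⊕ U^⊥`. -/
def hodge10 (vol : ⋀[ℤ]^4 V ≃ₗ[ℤ] ℤ) (ϑ₂ ϑ₃ : ℤ) (σ : K3Space V) :
    Submodule ℂ ((ℂ ⊗[ℤ] V) × Module.Dual ℂ (ℂ ⊗[ℤ] V)) :=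
  if σ.2 ≠ 0 then
    (antisymMap vol ((-2 * (ϑ₃ : ℂ) / ((ϑ₂ : ℂ) * σ.2)) • σ.1)).graph
  else
    (LinearMap.ker (antisymMap vol σ.1)).prod (LinearMap.ker (antisymMap vol σ.1)).dualAnnihilator

/-- The tangent space `(V_ℂ ⊕ V_ℂ^∨) / H^{1,0}_{[σ]}(ϑ)` of the torus `J_{[σ]}(ϑ)`
(the subspace `H^{1,0}` is the same for all representatives of `[σ]`). -/
abbrev JTangent (vol : ⋀[ℤ]^4 V ≃ₗ[ℤ] ℤ) (ϑ₂ ϑ₃ : ℤ) (p : ℙ ℂ (K3Space V)) : Type _ :=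
  ((ℂ ⊗[ℤ] V) × Module.Dual ℂ (ℂ ⊗[ℤ] V)) ⧸ hodge10 vol ϑ₂ ϑ₃ p.rep

/-- The map `V ⊕ V^∨ → (V_ℂ ⊕ V_ℂ^∨) / H^{1,0}_{[σ]}(ϑ)`. The quotient of the target by the
image is the torus `J_{[σ]}(ϑ) = (V_ℂ ⊕ V_ℂ^∨) / (H^{1,0}_{[σ]}(ϑ) + (V ⊕ V^∨))`. -/
def JLattice (vol : ⋀[ℤ]^4 V ≃ₗ[ℤ] ℤ) (ϑ₂ ϑ₃ : ℤ) (p : ℙ ℂ (K3Space V)) :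
    (V × Module.Dual ℤ V) →ₗ[ℤ] JTangent vol ϑ₂ ϑ₃ p :=
  ((hodge10 vol ϑ₂ ϑ₃ p.rep).mkQ.restrictScalars ℤ) ∘ₗ
    LinearMap.prodMap (TensorProduct.mk ℤ ℂ V 1) (Module.Dual.baseChange ℂ)

/-- `C` is a connected component of `𝒟_h` on which the class `Θ_{[σ]}(ϑ)` of the form
`⟨,⟩_{ϑ,h}` on `H₁(J_{[σ]}(ϑ), ℤ) = V ⊕ V^∨` is ample, i.e. `C = 𝒟_h⁺`. -/
def IsPlusComponent [Module.Free ℤ V] [Module.Finite ℤ V]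
    (vol : ⋀[ℤ]^4 V ≃ₗ[ℤ] ℤ) (ϑ₁ ϑ₂ ϑ₃ : ℤ) (m : ℚ)
    (h : Module.Dual ℤ (⋀[ℤ]^2 V × ℤ)) (C : Set (ℙ ℂ (K3Space V))) : Prop :=
  (∃ p ∈ periodDomain vol m h,
    C = @connectedComponentIn _ (projTopology (K3Space V)) (periodDomain vol m h) p) ∧
  ∀ p ∈ C, IsPolarization (JLattice vol ϑ₂ ϑ₃ p) (polForm vol ϑ₁ ϑ₂ ϑ₃ h)

end Complex

end WeilTori

end

/-! The form on `⋀² V ⊕ ℤ` has rank 7 and signature (3,4), and `V ⊕ V^∨` is its 8-dimensional spin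
representation. The relation ϑ₁ϑ₂ = 2mϑ₃² is exactly what makes the action `Model.clifford` satisfy
the Clifford identity σ·σ = -mϑ₃²(σ,σ). In these terms the data of the theorem become simple.

For isotropic σ ≠ 0 the kernel of Clifford multiplication by σ has dimension four, and it is H^{1,0}
(`Datum.hodge10_eq`). The functional h is the pairing with a vector ℓ (`Model.ell`); Clifford
multiplication by ℓ is integral on the lattice. It is the endomorphism φ, with φ² = -D and D =
mϑ₃²(h,h), and ⟨h, Φ(x ∧ y)⟩ is the natural pairing of x with φy. If σ ⊥ ℓ, then σ and φ
anticommute, so φ preserves H^{1,0}. A nonisotropic τ orthogonal to ℓ and σ also preserves H^{1,0}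
and exchanges the eigenspaces of φ, which gives Weil type.

The kernel of σ is isotropic for the natural pairing; this is the first Riemann relation. For the
second, ℓ^⊥ has signature (2,4), so the period domain consists of two copies of a tube domain, and
completing squares shows that the Hermitian form is definite, of opposite signs on the two copies
(`Model.posForm_sign`). The determinant is computed on a basis of V, which is isotropic for the
natural pairing: the Gram matrix is √(-D) times a rational skew matrix, and its determinant is the
square of a rational number (`Datum.hasDet`).

Completeness has two halves. Arithmetic: an indefinite Hermitian space of dimension four and
determinant one over an imaginary quadratic field is hyperbolic
(`IsHermSpace.exists_hyperbolic_basis`), so the polarized rational lattices with their endomorphisms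
are isometric. After diagonalization this requires that a binary form ⟨a₀, a₁⟩ represent a given
number of the right sign, that is, that the norm of a definite quaternion algebra over ℚ take all
positive values (`exists_quaternion_norm_eq`). That instance of Hasse–Minkowski is proved from
Dirichlet's theorem, reciprocity for Jacobi symbols and a pigeonhole argument.

Geometric: a transported Hodge structure H of Weil type is the kernel of some σ
(`Model.exists_ker_eq`). An eigenspace T of φ has dimension four, and ℓ^⊥ acts as the space of skew
forms on T; the plane H ∩ T then determines σ up to a scalar, as in the Klein correspondence.
Positivity of the polarization forces (σ, σ̄) > 0. -/

noncomputable section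

namespace WeilTori

/-! ### Legendre's theorem by pigeonhole, and weak approximation for quaternion norms -/

section QuaternionNorms

theorem Nat.exists_sqrt_ceil {N : ℕ} (hN : 0 < N) : ∃ k : ℕ, 0 < k ∧ (k - 1) ^ 2 < N ∧ N ≤ k ^ 2 := by
  refine ⟨Nat.sqrt (N - 1) + 1, Nat.succ_pos _, ?_, ?_⟩
  · have := Nat.sqrt_le' (N - 1)
    rw [Nat.add_sub_cancel]; omega
  · have := Nat.lt_succ_sqrt' (N - 1)
    rw [Nat.succ_eq_add_one] at this; omega

/-- The congruences make X² + nY² - rZ² a multiple of nr, and the size bounds leave only the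
multiples 0 and nr. -/
theorem exists_sq_add_mul_sq_eq_of_small {n r s t X Y Z : ℤ} (hn' : 0 < n) (hr' : 0 < r)
    (hnr : IsCoprime n r) (hs : r ∣ s ^ 2 + n) (ht : n ∣ t ^ 2 - r)
    (hX : X ^ 2 < n * r) (hY : Y ^ 2 < r) (hZ : Z ^ 2 < n) (h1 : r ∣ X - s * Y) (h2 : n ∣ X - t * Z)
    (hne : ¬ (X = 0 ∧ Y = 0 ∧ Z = 0)) :
    ∃ X Y Z : ℤ, Z ≠ 0 ∧ X ^ 2 + n * Y ^ 2 = r * Z ^ 2 := by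
  have hd : (n * r) ∣ X ^ 2 + n * Y ^ 2 - r * Z ^ 2 := by
    apply IsCoprime.mul_dvd hnr
    · have e : X ^ 2 + n * Y ^ 2 - r * Z ^ 2 = (X - t * Z) * (X + t * Z) + (t ^ 2 - r) * Z ^ 2 + n * Y ^ 2 := by
        ring
      rw [e]
      exact dvd_add (dvd_add (h2.mul_right _) (ht.mul_right _)) (dvd_mul_right _ _)
    · have e : X ^ 2 + n * Y ^ 2 - r * Z ^ 2 = (X - s * Y) * (X + s * Y) + (s ^ 2 + n) * Y ^ 2 - r * Z ^ 2 := by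
        ring
      rw [e]
      exact dvd_sub (dvd_add (h1.mul_right _) (hs.mul_right _)) (dvd_mul_right _ _)
  obtain ⟨k, hk⟩ := hd
  have hnr' : (0 : ℤ) < n * r := by positivity
  have k1 : -1 < k := by
    by_contra hc
    have h3 : n * r * k ≤ n * r * (-1) := mul_le_mul_of_nonneg_left (by omega) hnr'.le
    have h4 : r * Z ^ 2 < r * n := mul_lt_mul_of_pos_left hZ hr'
    linarith [sq_nonneg X, mul_nonneg hn'.le (sq_nonneg Y)]
  have k2 : k < 2 := by
    by_contra hc
    have h3 : n * r * 2 ≤ n * r * k := mul_le_mul_of_nonneg_left (by omega) hnr'.le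
    have h4 : n * Y ^ 2 < n * r := mul_lt_mul_of_pos_left hY hn'
    linarith [mul_nonneg hr'.le (sq_nonneg Z)]
  obtain rfl | rfl : k = 0 ∨ k = 1 := by omega
  · refine ⟨X, Y, Z, fun hz => hne ?_, by linarith⟩
    subst hz
    have hy : n * Y ^ 2 = 0 := by linarith [sq_nonneg X, mul_nonneg hn'.le (sq_nonneg Y)]
    have hx : X ^ 2 = 0 := by linarith
    exact ⟨by simpa using hx, by simpa [hn'.ne'] using hy, rfl⟩
  -- Here X² + nY² = r(Z² + n). The witness is the product (X + Y√(-n))(Z + √(-n)), whose norm is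
  -- r(Z² + n)².
  · refine ⟨X * Z - n * Y, X + Y * Z, Z ^ 2 + n, by positivity, ?_⟩
    linear_combination (Z ^ 2 + n) * hk

/-- Legendre's theorem for the form `X² + n Y² - r Z²`, with `n, r > 0` coprime. -/
theorem exists_sq_add_mul_sq_eq {n r : ℕ} (hn : 0 < n) (hr : 0 < r) (hnr : n.Coprime r)
    (hsq : ¬ IsSquare r) {s t : ℤ} (hs : (r : ℤ) ∣ s ^ 2 + n) (ht : (n : ℤ) ∣ t ^ 2 - r) :
    ∃ X Y Z : ℤ, Z ≠ 0 ∧ X ^ 2 + n * Y ^ 2 = r * Z ^ 2 := by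
  classical
  obtain ⟨A, hA0, hA1, hA2⟩ := Nat.exists_sqrt_ceil (Nat.mul_pos hn hr)
  obtain ⟨B, hB0, hB1, hB2⟩ := Nat.exists_sqrt_ceil hr
  obtain ⟨C, hC0, hC1, hC2⟩ := Nat.exists_sqrt_ceil hn
  have hB3 : r < B ^ 2 := lt_of_le_of_ne hB2 fun h => hsq ⟨B, by rw [h, sq]⟩
  -- The box of sides A, B, C has more points than ℤ/r × ℤ/n has elements. The strict inequality
  -- comes from r not being a square.
  have hcard : r * n < A * (B * C) := by
    have h1 : n * r * (r * n) < A ^ 2 * (B ^ 2 * C ^ 2) :=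
      Nat.mul_lt_mul_of_le_of_lt hA2 (Nat.mul_lt_mul_of_lt_of_le hB3 hC2 (by positivity))
        (by positivity)
    by_contra hle
    have h2 := Nat.mul_le_mul (not_lt.1 hle) (not_lt.1 hle)
    nlinarith
  have : NeZero r := ⟨hr.ne'⟩
  have : NeZero n := ⟨hn.ne'⟩
  let S : Finset (ℕ × ℕ × ℕ) := Finset.range A ×ˢ (Finset.range B ×ˢ Finset.range C)
  let F : ℕ × ℕ × ℕ → ZMod r × ZMod n := fun v =>
    ((v.1 : ZMod r) - (s : ZMod r) * v.2.1, (v.1 : ZMod n) - (t : ZMod n) * v.2.2)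
  obtain ⟨v, hv, w, hw, hvw, hF⟩ := Finset.exists_ne_map_eq_of_card_lt_of_maps_to
    (s := S) (t := (Finset.univ : Finset (ZMod r × ZMod n))) (f := F)
    (by simpa [S, Finset.card_product, ZMod.card] using hcard) (by intro x _; simp)
  obtain ⟨x1, y1, z1⟩ := v
  obtain ⟨x2, y2, z2⟩ := w
  simp only [S, Finset.mem_range, Finset.mem_product] at hv hw
  have bound : ∀ {k N a b : ℕ}, a < k → b < k → (k - 1) ^ 2 < N → ((a : ℤ) - b) ^ 2 < N := by
    intro k N a b ha hb hk
    have h1 : |(a : ℤ) - b| ≤ ((k - 1 : ℕ) : ℤ) := by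
      rw [abs_le]; constructor <;> omega
    have h2 := sq_le_sq' (by linarith [abs_nonneg ((a : ℤ) - b)]) h1
    rw [sq_abs] at h2
    exact lt_of_le_of_lt h2 (by exact_mod_cast hk)
  have hX := bound hv.1 hw.1 hA1
  have hY := bound hv.2.1 hw.2.1 hB1
  have hZ := bound hv.2.2 hw.2.2 hC1
  have h1 : (r : ℤ) ∣ ((x1 : ℤ) - x2) - s * ((y1 : ℤ) - y2) := by
    rw [← ZMod.intCast_zmod_eq_zero_iff_dvd]
    have := congrArg Prod.fst hF
    simp only [F] at this
    push_cast
    linear_combination this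
  have h2 : (n : ℤ) ∣ ((x1 : ℤ) - x2) - t * ((z1 : ℤ) - z2) := by
    rw [← ZMod.intCast_zmod_eq_zero_iff_dvd]
    have := congrArg Prod.snd hF
    simp only [F] at this
    push_cast
    linear_combination this
  have hne : ¬ ((x1 : ℤ) - x2 = 0 ∧ (y1 : ℤ) - y2 = 0 ∧ (z1 : ℤ) - z2 = 0) := by
    rintro ⟨h1, h2, h3⟩
    apply hvw
    simp only [Prod.mk.injEq]
    omega
  push_cast at hX
  generalize (x1 : ℤ) - x2 = X at *
  generalize (y1 : ℤ) - y2 = Y at *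
  generalize (z1 : ℤ) - z2 = Z at *
  exact exists_sq_add_mul_sq_eq_of_small (by exact_mod_cast hn) (by exact_mod_cast hr)
    (Nat.isCoprime_iff_coprime.2 hnr) hs ht hX hY hZ h1 h2 hne

/-- `r` is a value, over `ℚ`, of the norm form of the quaternion algebra `(-A, -B)`. -/
def IsQuatNorm (A B : ℕ) (r : ℚ) : Prop :=
  ∃ x y z w : ℚ, r = x ^ 2 + A * y ^ 2 + B * z ^ 2 + A * B * w ^ 2

namespace IsQuatNorm

variable {A B : ℕ} {r s : ℚ}

theorem mul (hr : IsQuatNorm A B r) (hs : IsQuatNorm A B s) : IsQuatNorm A B (r * s) := by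
  obtain ⟨x, y, z, w, rfl⟩ := hr
  obtain ⟨x', y', z', w', rfl⟩ := hs
  exact ⟨x * x' - A * y * y' - B * z * z' - A * B * w * w',
    x * y' + y * x' + B * (z * w' - w * z'), x * z' + z * x' + A * (w * y' - y * w'),
    x * w' + w * x' + y * z' - z * y', by ring⟩

theorem sq (t : ℚ) : IsQuatNorm A B (t ^ 2) := ⟨t, 0, 0, 0, by ring⟩

theorem of_mul_sq {t : ℚ} (ht : t ≠ 0) (h : IsQuatNorm A B (r * t ^ 2)) : IsQuatNorm A B r := by
  have := h.mul (sq (A := A) (B := B) t⁻¹)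
  rwa [mul_assoc, ← mul_pow, mul_inv_cancel₀ ht, one_pow, mul_one] at this

theorem of_mul (hs : IsQuatNorm A B s) (hs0 : s ≠ 0) (h : IsQuatNorm A B (r * s)) :
    IsQuatNorm A B r :=
  of_mul_sq hs0 (by rw [_root_.sq, ← mul_assoc]; exact h.mul hs)

end IsQuatNorm

/-- The modulus is p² rather than p because the local conditions imposed later involve classes
modulo 4 and divisibility by a prime exactly once. -/
theorem exists_nat_modEq_sq_of_dvd {k : ℕ} (hk : k ≠ 0) (f : ℕ → ℕ) :
    ∃ x : ℕ, ∀ p, p.Prime → p ∣ k → x ≡ f p [MOD p ^ 2] := by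
  obtain ⟨x, hx⟩ := Nat.chineseRemainderOfFinset f (fun p => p ^ 2) k.primeFactors
    (fun p hp => pow_ne_zero _ (Nat.prime_of_mem_primeFactors hp).ne_zero)
    (fun p hp q hq hpq => Nat.Coprime.pow _ _ ((Nat.coprime_primes
      (Nat.prime_of_mem_primeFactors hp) (Nat.prime_of_mem_primeFactors hq)).2 hpq))
  exact ⟨x, fun p hp hpk => hx p (Nat.mem_primeFactors.2 ⟨hp, hpk, hk⟩)⟩

/-- A common generalisation of the norm form and of its pure part; `c = 1` or `c = 0`. -/
def quatForm (c g d e x y z w : ℕ) : ℕ :=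
  c * x ^ 2 + g * d * y ^ 2 + g * e * z ^ 2 + d * e * w ^ 2

theorem quatForm_modEq {N c g d e x y z w x' y' z' w' : ℕ} (hx : x ≡ x' [MOD N])
    (hy : y ≡ y' [MOD N]) (hz : z ≡ z' [MOD N]) (hw : w ≡ w' [MOD N]) :
    quatForm c g d e x y z w ≡ quatForm c g d e x' y' z' w' [MOD N] :=
  (((((hx.pow 2).mul_left _).add ((hy.pow 2).mul_left _)).add ((hz.pow 2).mul_left _)).add
    ((hw.pow 2).mul_left _))

/-- Weak approximation for the values of the form. -/
theorem exists_quatForm_modEq {k : ℕ} (hk : k ≠ 0) (c g d e : ℕ) {P : ℕ → ℕ → Prop}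
    (hP : ∀ p, p.Prime → p ∣ k → ∃ x y z w, P p (quatForm c g d e x y z w))
    (hmod : ∀ p a b, a ≡ b [MOD p ^ 2] → P p b → P p a) :
    ∃ x y z w, ∀ p, p.Prime → p ∣ k → P p (quatForm c g d e x y z w) := by
  have h : ∀ p, ∃ x y z w, p.Prime → p ∣ k → P p (quatForm c g d e x y z w) := by
    intro p
    by_cases hp : p.Prime ∧ p ∣ k
    · obtain ⟨x, y, z, w, h⟩ := hP p hp.1 hp.2
      exact ⟨x, y, z, w, fun _ _ => h⟩
    · exact ⟨0, 0, 0, 0, fun h1 h2 => absurd ⟨h1, h2⟩ hp⟩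
  choose x y z w h using h
  obtain ⟨X, hX⟩ := exists_nat_modEq_sq_of_dvd hk x
  obtain ⟨Y, hY⟩ := exists_nat_modEq_sq_of_dvd hk y
  obtain ⟨Z, hZ⟩ := exists_nat_modEq_sq_of_dvd hk z
  obtain ⟨W, hW⟩ := exists_nat_modEq_sq_of_dvd hk w
  exact ⟨X, Y, Z, W, fun p hp hpk => hmod p _ _
    (quatForm_modEq (hX p hp hpk) (hY p hp hpk) (hZ p hp hpk) (hW p hp hpk)) (h p hp hpk)⟩

/-- Counting values of the two quadratics gd y² + 1 and ge z² over the field with p elements. A pure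
norm n ≡ -1 is wanted because -n is then visibly a square modulo p. -/
theorem exists_quatForm_zero_add_one {p g d e : ℕ} (hp : p.Prime) (hp2 : p ≠ 2) (hg : ¬ p ∣ g)
    (hd : ¬ p ∣ d) (he : ¬ p ∣ e) : ∃ y z, p ∣ quatForm 0 g d e 0 y z 0 + 1 := by
  have := Fact.mk hp
  have hg' : (g : ZMod p) ≠ 0 := by rwa [Ne, ZMod.natCast_eq_zero_iff]
  have hd' : (d : ZMod p) ≠ 0 := by rwa [Ne, ZMod.natCast_eq_zero_iff]
  have he' : (e : ZMod p) ≠ 0 := by rwa [Ne, ZMod.natCast_eq_zero_iff]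
  open Polynomial in
  obtain ⟨a, b, hab⟩ := FiniteField.exists_root_sum_quadratic (R := ZMod p)
    (f := C ((g : ZMod p) * d) * X ^ 2 + C 0 * X + C 1) (g := C ((g : ZMod p) * e) * X ^ 2 + C 0 * X + C 0)
    (degree_quadratic (mul_ne_zero hg' hd')) (degree_quadratic (mul_ne_zero hg' he'))
    (by rw [ZMod.card]; exact Nat.odd_iff.1 (hp.odd_of_ne_two hp2))
  refine ⟨a.val, b.val, ?_⟩
  rw [← ZMod.natCast_eq_zero_iff]
  simp [quatForm] at hab ⊢
  linear_combination hab

end QuaternionNorms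


/-! ### Norms from auxiliary primes: Dirichlet's theorem and reciprocity -/

section QuaternionNorms

/-- Two squarefree numbers are A = gd and B = ge with g their gcd. Since AB = g²de, rescaling the
last coordinate by g gives the norm form the coefficients 1, gd, ge, de, symmetric in g, d, e. -/
theorem isQuatNorm_quatForm {g d e : ℕ} (hg : g ≠ 0) (x y z w : ℕ) :
    IsQuatNorm (g * d) (g * e) (quatForm 1 g d e x y z w) := by
  have : (g : ℚ) ≠ 0 := by exact_mod_cast hg
  refine ⟨x, y, z, w / g, ?_⟩
  simp only [quatForm]
  push_cast
  field_simp

/-- If n is the norm of a pure quaternion π, then X² + nY² is the norm of X + Yπ. -/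
theorem isQuatNorm_of_pure {g d e x y z w r : ℕ} (hg : g ≠ 0) {X Y Z : ℤ} (hZ : Z ≠ 0)
    (h : X ^ 2 + (quatForm 0 g d e x y z w : ℕ) * Y ^ 2 = r * Z ^ 2) :
    IsQuatNorm (g * d) (g * e) r := by
  have hg' : (g : ℚ) ≠ 0 := by exact_mod_cast hg
  have hZ' : (Z : ℚ) ≠ 0 := by exact_mod_cast hZ
  have h' : (X : ℚ) ^ 2 + (g * d * y ^ 2 + g * e * z ^ 2 + d * e * w ^ 2) * Y ^ 2 = r * Z ^ 2 := by
    have := congrArg (Int.cast : ℤ → ℚ) h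
    simp only [quatForm] at this
    push_cast at this
    linear_combination this
  refine IsQuatNorm.of_mul_sq hZ' ⟨X, y * Y, z * Y, w * Y / g, ?_⟩
  rw [← h']
  push_cast
  field_simp
  ring

theorem Nat.dvd_of_squarefree_of_primes {m n : ℕ} (hm : Squarefree m)
    (h : ∀ p, p.Prime → p ∣ m → p ∣ n) : m ∣ n := by
  rw [← Nat.prod_primeFactors_of_squarefree hm]
  exact Finset.prod_primes_dvd n (fun p hp => (Nat.prime_of_mem_primeFactors hp).prime)
    fun p hp => h p (Nat.prime_of_mem_primeFactors hp) (Nat.dvd_of_mem_primeFactors hp)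

theorem not_dvd_of_prime_coprime {p a b : ℕ} (hp : p.Prime) (h : a.Coprime b) (ha : p ∣ a) :
    ¬ p ∣ b := fun hb => Nat.not_coprime_of_dvd_of_dvd hp.one_lt ha hb h

theorem exists_quatForm_zero_not_dvd {p g d e : ℕ} (hp : p.Prime) (hgd : g.Coprime d)
    (hge : g.Coprime e) (hde : d.Coprime e) : ∃ y z w, ¬ p ∣ quatForm 0 g d e 0 y z w := by
  by_cases hd : p ∣ d
  · refine ⟨0, 1, 0, ?_⟩
    simpa [quatForm, hp.dvd_mul] using ⟨not_dvd_of_prime_coprime hp hgd.symm hd,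
      not_dvd_of_prime_coprime hp hde hd⟩
  · by_cases he : p ∣ e
    · refine ⟨1, 0, 0, ?_⟩
      simpa [quatForm, hp.dvd_mul] using ⟨not_dvd_of_prime_coprime hp hge.symm he, hd⟩
    · exact ⟨0, 0, 1, by simpa [quatForm, hp.dvd_mul] using ⟨hd, he⟩⟩

variable {g d e : ℕ}

/-- The local solutions are glued by weak approximation. Being prime to 2k allows two such norms to
be chosen odd and coprime to each other, so that congruences modulo both can be imposed on one
prime. -/
theorem exists_pure_norm (hgd : g.Coprime d) (hge : g.Coprime e) (hde : d.Coprime e) {m k : ℕ}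
    (hm : Squarefree m) (hk : k ≠ 0) (hm2 : Odd m) (hmc : m.Coprime (g * d * e)) :
    ∃ x y z w, 0 < quatForm 0 g d e x y z w ∧ m ∣ quatForm 0 g d e x y z w + 1 ∧
      (quatForm 0 g d e x y z w).Coprime (2 * k) := by
  have key : ∃ x y z w, ∀ p, p.Prime → p ∣ 2 * k * m →
      (p ∣ m → p ∣ quatForm 0 g d e x y z w + 1) ∧ ¬ p ∣ quatForm 0 g d e x y z w := by
    refine exists_quatForm_modEq (k := 2 * k * m) (by have := hm.ne_zero; positivity) 0 g d e
      (P := fun p v => (p ∣ m → p ∣ v + 1) ∧ ¬ p ∣ v) (fun p hp _ => ?_) (fun p a b hab hb => ?_)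
    · by_cases hpm : p ∣ m
      · have h1 := not_dvd_of_prime_coprime hp hmc hpm
        simp only [hp.dvd_mul, not_or] at h1
        obtain ⟨y, z, h2⟩ := exists_quatForm_zero_add_one hp
          (fun h => by rw [h] at hpm; exact (Nat.not_even_iff_odd.2 hm2) (even_iff_two_dvd.2 hpm))
          h1.1.1 h1.1.2 h1.2
        exact ⟨0, y, z, 0, fun _ => h2, fun h3 => hp.one_lt.ne' (Nat.dvd_one.1 ((Nat.dvd_add_right h3).1 h2))⟩
      · obtain ⟨y, z, w, h⟩ := exists_quatForm_zero_not_dvd hp hgd hge hde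
        exact ⟨0, y, z, w, fun h => absurd h hpm, h⟩
    · have hab' : a ≡ b [MOD p] := hab.of_dvd (dvd_pow_self p two_ne_zero)
      exact ⟨fun hpm => ((hab'.add_right 1).dvd_iff dvd_rfl).2 (hb.1 hpm),
        fun h => hb.2 ((hab'.dvd_iff dvd_rfl).1 h)⟩
  obtain ⟨x, y, z, w, h⟩ := key
  · have hpos : 0 < quatForm 0 g d e x y z w := by
      refine Nat.pos_of_ne_zero fun h0 => (h 2 Nat.prime_two ⟨k * m, by ring⟩).2 ?_
      rw [h0]; exact dvd_zero _
    refine ⟨x, y, z, w, hpos, Nat.dvd_of_squarefree_of_primes hm fun p hp hpm =>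
      (h p hp (hpm.mul_left _)).1 hpm, Nat.Coprime.symm (Nat.coprime_of_dvd fun p hp hpk => ?_)⟩
    exact (h p hp (hpk.mul_right _)).2

/-- A prime `q ≡ m` modulo `4 n`, where `n` is the norm of a pure quaternion and `-n ≡ 1` modulo
`m`, differs from `m` by a norm. -/
theorem isQuatNorm_prime_mul (hg : g ≠ 0) {m q x y z w : ℕ} (hm2 : Odd m)
    (hn : 0 < quatForm 0 g d e x y z w) (hmn : m ∣ quatForm 0 g d e x y z w + 1)
    (hq : q.Prime) (hqm : m < q) (hqn : quatForm 0 g d e x y z w < q)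
    (hmod : q ≡ m [MOD 4 * quatForm 0 g d e x y z w]) :
    IsQuatNorm (g * d) (g * e) ((q * m : ℕ) : ℚ) := by
  generalize hN : quatForm 0 g d e x y z w = n at *
  have := Fact.mk hq
  have hm0 : 0 < m := hm2.pos
  have hq2 : Odd q := by
    have h2 : q ≡ m [MOD 2] := hmod.of_dvd ⟨2 * n, by ring⟩
    rw [Nat.odd_iff] at hm2 ⊢
    rw [← hm2]; exact h2
  -- By reciprocity the symbol (-n / ·) depends only on the class modulo 4n, so (-n / q) = (-n / m)
  -- = (1 / m) = 1.
  have hJ : jacobiSym (-(n : ℤ)) q = 1 := by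
    rw [jacobiSym.mod_right _ hq2, Int.natAbs_neg, Int.natAbs_natCast, show q % (4 * n) = m % (4 * n) from hmod]
    have h2 := jacobiSym.mod_right (-(n : ℤ)) hm2
    rw [Int.natAbs_neg, Int.natAbs_natCast] at h2
    rw [← h2, ← jacobiSym.one_left m]
    apply jacobiSym.mod_left'
    refine Int.ModEq.symm (Int.modEq_iff_dvd.2 ?_)
    obtain ⟨c, hc⟩ := hmn
    refine ⟨-c, ?_⟩
    have : (n : ℤ) + 1 = m * c := by exact_mod_cast hc
    linear_combination -this
  obtain ⟨u, hu⟩ := ZMod.isSquare_of_jacobiSym_eq_one hJ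
  have hcop : IsCoprime (m : ℤ) q :=
    Nat.isCoprime_iff_coprime.2 (((Nat.Prime.coprime_iff_not_dvd hq).2 (Nat.not_dvd_of_pos_of_lt hm0 hqm)).symm)
  have hnq : n.Coprime q := ((Nat.Prime.coprime_iff_not_dvd hq).2 (Nat.not_dvd_of_pos_of_lt hn hqn)).symm
  have hnm : n.Coprime m := Nat.coprime_of_dvd fun p hp hpn hpm =>
    hp.one_lt.ne' (Nat.dvd_one.1 ((Nat.dvd_add_right hpn).1 (hpm.trans hmn)))
  obtain ⟨s, hs1, hs2⟩ : ∃ s : ℤ, (m : ℤ) ∣ s - 1 ∧ (q : ℤ) ∣ s - (u.val : ℤ) := by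
    obtain ⟨a, b, hab⟩ := hcop
    refine ⟨1 * (b * q) + u.val * (a * m), ⟨(u.val - 1) * a, ?_⟩, ⟨(1 - u.val) * b, ?_⟩⟩
    · linear_combination hab
    · linear_combination (u.val : ℤ) * hab
  -- Legendre's theorem for r = qm: it is not a square because q > m; s is a square root of -n
  -- modulo r; and r ≡ m² modulo n, which is why t = m.
  obtain ⟨X, Y, Z, hZ, h⟩ := exists_sq_add_mul_sq_eq (n := n) (r := q * m) (s := s) (t := m) hn
    (Nat.mul_pos hq.pos hm0) (Nat.Coprime.mul_right hnq hnm) (fun ⟨c, hc⟩ => by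
      have h1 : q ∣ c := by
        have : q ∣ c * c := ⟨m, hc.symm⟩
        exact (hq.dvd_mul.1 this).elim id id
      obtain ⟨c', rfl⟩ := h1
      have h2 : m = q * (c' * c') := Nat.eq_of_mul_eq_mul_left hq.pos (by rw [hc]; ring)
      exact absurd (Nat.le_of_dvd hm0 ⟨_, h2⟩) (by omega)) (by
      push_cast
      refine IsCoprime.mul_dvd hcop.symm ?_ ?_
      · have h1 : (q : ℤ) ∣ (u.val : ℤ) ^ 2 + n := by
          rw [← ZMod.intCast_zmod_eq_zero_iff_dvd]
          push_cast at hu ⊢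
          rw [ZMod.natCast_zmod_val]
          linear_combination -hu
        have e1 : s ^ 2 + n = (s - u.val) * (s + u.val) + ((u.val : ℤ) ^ 2 + n) := by ring
        rw [e1]
        exact dvd_add (hs2.mul_right _) h1
      · have h1 : (m : ℤ) ∣ n + 1 := by exact_mod_cast hmn
        have e1 : s ^ 2 + n = (s - 1) * (s + 1) + (n + 1) := by ring
        rw [e1]
        exact dvd_add (hs1.mul_right _) h1) (by
      have h1 : (n : ℤ) ∣ m - q := (Nat.modEq_iff_dvd.1 (hmod.of_dvd ⟨4, by ring⟩))
      push_cast
      have e1 : (m : ℤ) ^ 2 - q * m = (m - q) * m := by ring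
      rw [e1]
      exact h1.mul_right _)
  subst hN
  exact isQuatNorm_of_pure hg hZ h

/-- One prime q with q ≡ m modulo 4n and q ≡ m' modulo 4n' makes both qm and qm' norms, hence also
mm' after division by q². The congruence of m and m' modulo 4 makes the two conditions at the prime
2 compatible. -/
theorem isQuatNorm_mul_of_modEq_four (hg : g ≠ 0) (hgd : g.Coprime d) (hge : g.Coprime e)
    (hde : d.Coprime e) {m m' : ℕ}
    (hm : Squarefree m) (hm2 : Odd m) (hmc : m.Coprime (g * d * e))
    (hm' : Squarefree m') (hm2' : Odd m') (hmc' : m'.Coprime (g * d * e))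
    (hmod : m ≡ m' [MOD 4]) :
    IsQuatNorm (g * d) (g * e) ((m * m' : ℕ) : ℚ) := by
  obtain ⟨x, y, z, w, hn, hmn, hnc⟩ := exists_pure_norm hgd hge hde hm one_ne_zero hm2 hmc
  obtain ⟨x', y', z', w', hn', hmn', hnc'⟩ := exists_pure_norm hgd hge hde hm' hn.ne' hm2' hmc'
  set n := quatForm 0 g d e x y z w with hndef
  set n' := quatForm 0 g d e x' y' z' w' with hndef'
  have hn2' : n'.Coprime 2 := hnc'.of_dvd_right ⟨n, rfl⟩
  have hcop : (4 * n).Coprime n' := by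
    refine (Nat.Coprime.mul_left ?_ (hnc'.of_dvd_right ⟨2, by ring⟩).symm)
    exact (Nat.Coprime.pow_right 2 hn2').symm
  have aux : ∀ {a b : ℕ}, a ∣ b + 1 → a.Coprime b := fun {a b} hab =>
    Nat.coprime_of_dvd fun p hp hpa hpb =>
      hp.one_lt.ne' (Nat.dvd_one.1 ((Nat.dvd_add_right hpb).1 (hpa.trans hab)))
  obtain ⟨a, ha, ha'⟩ := Nat.chineseRemainder hcop m m'
  have hac : a.Coprime (4 * n * n') := by
    refine Nat.Coprime.mul_right ?_ ?_
    · have h1 : m.Coprime (4 * n) :=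
        Nat.Coprime.mul_right (Nat.Coprime.pow_right 2 (Nat.coprime_two_right.2 hm2)) (aux hmn)
      unfold Nat.Coprime at h1 ⊢
      rw [ha.gcd_eq, h1]
    · have h1 : m'.Coprime n' := aux hmn'
      unfold Nat.Coprime at h1 ⊢
      rw [ha'.gcd_eq, h1]
  obtain ⟨q, hqb, hq, hqa⟩ := Nat.forall_exists_prime_gt_and_modEq (m + m' + n + n')
    (by positivity) hac
  have h1 : q ≡ m [MOD 4 * n] := (hqa.of_dvd ⟨n', rfl⟩).trans ha
  have h2 : q ≡ m' [MOD 4 * n'] := by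
    refine (Nat.modEq_and_modEq_iff_modEq_mul (Nat.Coprime.pow_left 2 hn2'.symm)).1 ⟨?_, ?_⟩
    · exact (h1.of_dvd ⟨n, by norm_num⟩).trans hmod
    · exact (hqa.of_dvd ⟨4 * n, by ring⟩).trans ha'
  have h3 := isQuatNorm_prime_mul hg hm2 hn hmn hq (by omega) (by omega) h1
  have h4 := isQuatNorm_prime_mul hg hm2' hn' hmn' hq (by omega) (by omega) h2
  have hq0 : (q : ℚ) ≠ 0 := by exact_mod_cast hq.ne_zero
  refine IsQuatNorm.of_mul_sq hq0 ?_
  have := h3.mul h4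
  push_cast at this ⊢
  convert this using 1
  ring

end QuaternionNorms


/-! ### The norm of a definite quaternion algebra takes all positive rational values -/

section QuaternionNorms

/-- In ℤ/4 the equation 2g = 0 means that g is even. The hypotheses hold for pairwise coprime
squarefree numbers: none is divisible by 4 and at most one is even. -/
theorem quatForm_zmod_four_eq_three : ∀ g d e : ZMod 4, g ≠ 0 → d ≠ 0 → e ≠ 0 →
    ¬ (2 * g = 0 ∧ 2 * d = 0) → ¬ (2 * g = 0 ∧ 2 * e = 0) → ¬ (2 * d = 0 ∧ 2 * e = 0) →
    ∃ x y z w : Fin 2, (x.val : ZMod 4) ^ 2 + g * d * (y.val : ZMod 4) ^ 2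
      + g * e * (z.val : ZMod 4) ^ 2 + d * e * (w.val : ZMod 4) ^ 2 = 3 := by
  decide +kernel

theorem quatForm_zmod_four_eq_two : ∀ g d e : ZMod 4, 2 * g ≠ 0 → 2 * d ≠ 0 → 2 * e ≠ 0 →
    ∃ x y z w : Fin 2, (x.val : ZMod 4) ^ 2 + g * d * (y.val : ZMod 4) ^ 2
      + g * e * (z.val : ZMod 4) ^ 2 + d * e * (w.val : ZMod 4) ^ 2 = 2 := by
  decide +kernel

theorem two_mul_zmod_four_eq_zero_iff (n : ℕ) : (2 * (n : ZMod 4) = 0) ↔ 2 ∣ n := by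
  have : (2 * (n : ZMod 4)) = ((2 * n : ℕ) : ZMod 4) := by push_cast; rfl
  rw [this, ZMod.natCast_eq_zero_iff]
  omega

variable {g d e : ℕ}

theorem Nat.odd_sq_mod_four {c : ℕ} (hc : Odd c) : c ^ 2 % 4 = 1 := by
  obtain ⟨k, rfl⟩ := hc
  have : (2 * k + 1) ^ 2 = 4 * (k ^ 2 + k) + 1 := by ring
  omega

/-- Numbers congruent to 1 modulo 4 can be compared with the norm 1; this provides a norm with which
the other odd class can be compared. -/
theorem exists_quatForm_mod_four_eq_three (hg : Squarefree g) (hd : Squarefree d)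
    (he : Squarefree e) (hgd : g.Coprime d) (hge : g.Coprime e) (hde : d.Coprime e) :
    ∃ x y z w, quatForm 1 g d e x y z w % 4 = 3 ∧
      (quatForm 1 g d e x y z w).Coprime (g * d * e) := by
  have key : ∃ x y z w, ∀ p, p.Prime → p ∣ 2 * (g * d * e) →
      (p = 2 → quatForm 1 g d e x y z w % 4 = 3) ∧ ¬ p ∣ quatForm 1 g d e x y z w := by
    refine exists_quatForm_modEq
      (by have := hg.ne_zero; have := hd.ne_zero; have := he.ne_zero; positivity) 1 g d e
      (P := fun p v => (p = 2 → v % 4 = 3) ∧ ¬ p ∣ v) (fun p hp _ => ?_) (fun p a b hab hb => ?_)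
    · by_cases hp2 : p = 2
      · have ne0 : ∀ {n : ℕ}, Squarefree n → (n : ZMod 4) ≠ 0 := by
          intro n hn h0
          rw [ZMod.natCast_eq_zero_iff] at h0
          have := hn 2 h0
          exact absurd this (by decide)
        have ev : ∀ {a b : ℕ}, a.Coprime b → ¬ (2 * (a : ZMod 4) = 0 ∧ 2 * (b : ZMod 4) = 0) := by
          intro a b hab h0
          rw [two_mul_zmod_four_eq_zero_iff, two_mul_zmod_four_eq_zero_iff] at h0
          exact Nat.not_coprime_of_dvd_of_dvd one_lt_two h0.1 h0.2 hab
        obtain ⟨x, y, z, w, h⟩ := quatForm_zmod_four_eq_three g d e (ne0 hg) (ne0 hd) (ne0 he)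
          (ev hgd) (ev hge) (ev hde)
        have h3 : quatForm 1 g d e x y z w % 4 = 3 := by
          refine (ZMod.natCast_eq_natCast_iff' _ 3 4).1 ?_
          simp only [quatForm]
          push_cast
          rw [one_mul]
          exact h
        exact ⟨x, y, z, w, fun _ => h3, by rw [hp2]; omega⟩
      · exact ⟨1, 0, 0, 0, fun h => absurd h hp2, by simpa [quatForm] using hp.one_lt.ne'⟩
    · have hab' : a ≡ b [MOD p] := hab.of_dvd (dvd_pow_self p two_ne_zero)
      refine ⟨fun h2 => ?_, fun h => hb.2 ((hab'.dvd_iff dvd_rfl).1 h)⟩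
      rw [← hb.1 h2]
      subst h2
      exact hab
  obtain ⟨x, y, z, w, h⟩ := key
  refine ⟨x, y, z, w, (h 2 Nat.prime_two ⟨_, rfl⟩).1 rfl,
    Nat.Coprime.symm (Nat.coprime_of_dvd fun p hp hpk => (h p hp (hpk.mul_left _)).2)⟩

/-- A prime dividing 2gde is out of reach of the reciprocity argument. It is split off from a norm
that it divides exactly once, and the cofactor u is then prime to 2gde. -/
theorem exists_prime_mul_quatForm (hg : Squarefree g) (hd : Squarefree d)
    (he : Squarefree e) (hgd : g.Coprime d) (hge : g.Coprime e) {l : ℕ}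
    (hl : l.Prime) (hlk : l ∣ 2 * (g * d * e)) :
    ∃ x y z w u, quatForm 1 g d e x y z w = l * u ∧ u.Coprime (2 * (g * d * e)) := by
  have hk0 : 2 * (g * d * e) ≠ 0 := by
    have := hg.ne_zero; have := hd.ne_zero; have := he.ne_zero; positivity
  have key : ∃ x y z w, ∀ p, p.Prime → p ∣ 2 * (g * d * e) →
      (p = l → l ∣ quatForm 1 g d e x y z w ∧ ¬ l ^ 2 ∣ quatForm 1 g d e x y z w) ∧
        (p ≠ l → ¬ p ∣ quatForm 1 g d e x y z w) := by
    refine exists_quatForm_modEq hk0 1 g d e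
      (P := fun p v => (p = l → l ∣ v ∧ ¬ l ^ 2 ∣ v) ∧ (p ≠ l → ¬ p ∣ v))
      (fun p hp _ => ?_) (fun p a b hab hb => ?_)
    · by_cases hpl : p = l
      · subst hpl
        have exact_dvd : ∀ {a b : ℕ}, Squarefree a → a.Coprime b → p ∣ a → ¬ p ^ 2 ∣ a * b := by
          intro a b ha hab hpa h2
          have h3 : p ^ 2 ∣ a := Nat.Coprime.dvd_of_dvd_mul_right
            (Nat.Coprime.pow_left 2 ((Nat.Prime.coprime_iff_not_dvd hp).2
              (not_dvd_of_prime_coprime hp hab hpa))) h2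
          exact hp.one_lt.ne' (Nat.isUnit_iff.1 (ha p (by rwa [← sq])))
        by_cases h1 : p ∣ g
        · exact ⟨0, 1, 0, 0, fun _ => by simpa [quatForm] using
            ⟨h1.mul_right d, exact_dvd hg hgd h1⟩, fun h => absurd rfl h⟩
        by_cases h2 : p ∣ d
        · refine ⟨0, 1, 0, 0, fun _ => ?_, fun h => absurd rfl h⟩
          have := exact_dvd hd hgd.symm h2
          rw [mul_comm] at this
          simpa [quatForm] using ⟨h2.mul_left g, this⟩
        by_cases h3 : p ∣ e
        · refine ⟨0, 0, 1, 0, fun _ => ?_, fun h => absurd rfl h⟩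
          have := exact_dvd he hge.symm h3
          rw [mul_comm] at this
          simpa [quatForm] using ⟨h3.mul_left g, this⟩
        have hp2 : p = 2 := by
          simp only [hp.dvd_mul, h1, h2, h3, or_false] at hlk
          exact (Nat.prime_dvd_prime_iff_eq hp Nat.prime_two).1 hlk
        subst hp2
        obtain ⟨x, y, z, w, h⟩ := quatForm_zmod_four_eq_two g d e
          (by rwa [Ne, two_mul_zmod_four_eq_zero_iff]) (by rwa [Ne, two_mul_zmod_four_eq_zero_iff])
          (by rwa [Ne, two_mul_zmod_four_eq_zero_iff])
        have h3 : quatForm 1 g d e x y z w % 4 = 2 := by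
          refine (ZMod.natCast_eq_natCast_iff' _ 2 4).1 ?_
          simp only [quatForm]
          push_cast
          rw [one_mul]
          exact h
        exact ⟨x, y, z, w, fun _ => by omega, fun h => absurd rfl h⟩
      · exact ⟨1, 0, 0, 0, fun h => absurd h hpl, fun _ => by
          simpa [quatForm] using hp.one_lt.ne'⟩
    · have hab' : a ≡ b [MOD p] := hab.of_dvd (dvd_pow_self p two_ne_zero)
      refine ⟨fun h2 => ?_, fun h1 h => hb.2 h1 ((hab'.dvd_iff dvd_rfl).1 h)⟩
      subst h2
      exact ⟨(hab'.dvd_iff dvd_rfl).2 (hb.1 rfl).1, fun h => (hb.1 rfl).2 ((hab.dvd_iff dvd_rfl).1 h)⟩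
  obtain ⟨x, y, z, w, h⟩ := key
  obtain ⟨⟨u, hu⟩, hu2⟩ := (h l hl hlk).1 rfl
  refine ⟨x, y, z, w, u, hu, Nat.Coprime.symm (Nat.coprime_of_dvd fun p hp hpk hpu => ?_)⟩
  by_cases hpl : p = l
  · subst hpl
    exact hu2 (by rw [hu, sq]; exact mul_dvd_mul_left _ hpu)
  · exact (h p hp hpk).2 hpl (by rw [hu]; exact hpu.mul_left _)

/-- Squares are norms, so only the squarefree part s matters. It is compared with 1 or with the
squarefree part of a norm congruent to 3, according to its class modulo 4. -/
theorem isQuatNorm_of_coprime (hg : Squarefree g) (hd : Squarefree d)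
    (he : Squarefree e) (hgd : g.Coprime d) (hge : g.Coprime e) (hde : d.Coprime e) {m : ℕ}
    (hm : m.Coprime (2 * (g * d * e))) : IsQuatNorm (g * d) (g * e) m := by
  have odd_of : ∀ {c : ℕ}, c.Coprime (2 * (g * d * e)) → Odd c := fun {c} hc =>
    Nat.coprime_two_right.1 (hc.of_dvd_right ⟨_, rfl⟩)
  have cop_of : ∀ {c : ℕ}, c.Coprime (2 * (g * d * e)) → c.Coprime (g * d * e) := fun {c} hc =>
    hc.of_dvd_right ⟨2, by ring⟩
  have sqf : ∀ {s : ℕ}, Squarefree s → s.Coprime (2 * (g * d * e)) →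
      IsQuatNorm (g * d) (g * e) s := by
    intro s hs hsc
    have hs2 := odd_of hsc
    by_cases h4 : s % 4 = 1
    · have := isQuatNorm_mul_of_modEq_four hg.ne_zero hgd hge hde hs hs2 (cop_of hsc)
        squarefree_one odd_one (Nat.coprime_one_left _) h4
      simpa using this
    · have h4' : s % 4 = 3 := by
        have := Nat.odd_iff.1 hs2
        omega
      obtain ⟨x, y, z, w, hv4, hvc⟩ := exists_quatForm_mod_four_eq_three hg hd he hgd hge hde
      have hv := isQuatNorm_quatForm (d := d) (e := e) hg.ne_zero x y z w
      generalize quatForm 1 g d e x y z w = v at *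
      obtain ⟨a, b, hab, ha⟩ := Nat.sq_mul_squarefree v
      have hb0 : b ≠ 0 := by rintro rfl; simp at hab; omega
      have hbo : Odd b := by
        by_contra hne
        obtain ⟨c, hc⟩ := even_iff_two_dvd.1 (Nat.not_odd_iff_even.1 hne)
        subst hc
        have : v = 4 * (c ^ 2 * a) := by rw [← hab]; ring
        omega
      have ha4 : a % 4 = 3 := by
        have h1 := Nat.odd_sq_mod_four hbo
        have h2 : v % 4 = (b ^ 2 % 4) * (a % 4) % 4 := by rw [← hab, Nat.mul_mod]
        rw [h1, one_mul, Nat.mod_mod] at h2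
        omega
      have haN : IsQuatNorm (g * d) (g * e) a := by
        refine IsQuatNorm.of_mul_sq (t := b) (by exact_mod_cast hb0) ?_
        convert hv using 1
        rw [← hab]; push_cast; ring
      have hac : a.Coprime (g * d * e) := hvc.of_dvd_left ⟨b ^ 2, by rw [← hab]; ring⟩
      have h5 := isQuatNorm_mul_of_modEq_four hg.ne_zero hgd hge hde hs hs2 (cop_of hsc)
        ha (Nat.odd_iff.2 (by omega)) hac (h4'.trans ha4.symm)
      refine IsQuatNorm.of_mul haN (by exact_mod_cast ha.ne_zero) ?_
      exact_mod_cast h5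
  obtain ⟨a, b, hab, ha⟩ := Nat.sq_mul_squarefree m
  have := (IsQuatNorm.sq (A := g * d) (B := g * e) (b : ℚ)).mul
    (sqf ha (hm.of_dvd_left ⟨b ^ 2, by rw [← hab]; ring⟩))
  rw [← hab]
  exact_mod_cast this

theorem isQuatNorm_natCast (hg : Squarefree g) (hd : Squarefree d)
    (he : Squarefree e) (hgd : g.Coprime d) (hge : g.Coprime e) (hde : d.Coprime e) {m : ℕ}
    (hm : m ≠ 0) : IsQuatNorm (g * d) (g * e) m := by
  induction m using Nat.recOnMul with
  | zero => exact absurd rfl hm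
  | one => simpa using IsQuatNorm.sq (A := g * d) (B := g * e) 1
  | prime l hl =>
    by_cases hlk : l ∣ 2 * (g * d * e)
    · obtain ⟨x, y, z, w, u, hu, huc⟩ := exists_prime_mul_quatForm hg hd he hgd hge hl hlk
      have h1 := isQuatNorm_quatForm (d := d) (e := e) hg.ne_zero x y z w
      have hu0 : u ≠ 0 := by
        rintro rfl
        rw [Nat.coprime_zero_left] at huc
        omega
      refine IsQuatNorm.of_mul (isQuatNorm_of_coprime hg hd he hgd hge hde huc)
        (by exact_mod_cast hu0) ?_
      rw [hu] at h1
      exact_mod_cast h1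
    · exact isQuatNorm_of_coprime hg hd he hgd hge hde
        ((Nat.Prime.coprime_iff_not_dvd hl).2 hlk)
  | mul a b iha ihb =>
    have h0 := Nat.mul_ne_zero_iff.1 hm
    have := (iha h0.1).mul (ihb h0.2)
    exact_mod_cast this

/-- The reduced norm of a definite quaternion algebra over `ℚ` takes all positive values. -/
theorem exists_quaternion_norm_eq {D : ℕ} (hD : 0 < D) {a r : ℚ} (ha : 0 < a) (hr : 0 < r) :
    ∃ x y z w : ℚ, r = (x ^ 2 + D * y ^ 2) + a * (z ^ 2 + D * w ^ 2) := by
  have key : ∀ {D a : ℕ}, 0 < D → 0 < a → ∀ {r : ℕ}, r ≠ 0 → IsQuatNorm D a r := by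
    intro D a hD ha r hr
    obtain ⟨D0, c, hDc, hD0⟩ := Nat.sq_mul_squarefree D
    obtain ⟨a0, c', hac, ha0⟩ := Nat.sq_mul_squarefree a
    have hc : (c : ℚ) ≠ 0 := by
      rintro h; rw [Nat.cast_eq_zero] at h; subst h; simp at hDc; omega
    have hc' : (c' : ℚ) ≠ 0 := by
      rintro h; rw [Nat.cast_eq_zero] at h; subst h; simp at hac; omega
    -- Squares having been removed, D0 = gd and a0 = ge with g the gcd; then g, d, e are squarefree
    -- and pairwise coprime.
    obtain ⟨d, hd⟩ := Nat.gcd_dvd_left D0 a0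
    obtain ⟨e, he⟩ := Nat.gcd_dvd_right D0 a0
    have hg0 : 0 < D0.gcd a0 := Nat.gcd_pos_of_pos_left _ (Nat.pos_of_ne_zero hD0.ne_zero)
    have hde : d.Coprime e := by
      have h1 : D0.gcd a0 * 1 = D0.gcd a0 * d.gcd e := by
        rw [← Nat.gcd_mul_left, ← hd, ← he, mul_one]
      exact (Nat.eq_of_mul_eq_mul_left hg0 h1).symm
    generalize D0.gcd a0 = g at *
    subst hd he
    have h1 := (Nat.squarefree_mul_iff).1 hD0
    have h2 := (Nat.squarefree_mul_iff).1 ha0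
    obtain ⟨x, y, z, w, h⟩ := isQuatNorm_natCast h1.2.1 h1.2.2 h2.2.2 h1.1 h2.1 hde hr
    refine ⟨x, y / c, z / c', w / (c * c'), ?_⟩
    rw [h, ← hDc, ← hac]
    push_cast
    field_simp
  have hdr : (r.den : ℚ) ≠ 0 := by exact_mod_cast r.den_ne_zero
  have hda : (a.den : ℚ) ≠ 0 := by exact_mod_cast a.den_ne_zero
  have hnr : 0 < r.num := Rat.num_pos.2 hr
  have hna : 0 < a.num := Rat.num_pos.2 ha
  have er : r * r.den = r.num.toNat := by
    rw [Rat.mul_den_eq_num]; exact_mod_cast (Int.toNat_of_nonneg hnr.le).symm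
  have ea : a * a.den = a.num.toNat := by
    rw [Rat.mul_den_eq_num]; exact_mod_cast (Int.toNat_of_nonneg hna.le).symm
  obtain ⟨x, y, z, w, h⟩ := key (a := a.num.toNat * a.den) hD
    (Nat.mul_pos (by omega) a.den_pos) (r := r.num.toNat * r.den)
    (Nat.mul_ne_zero (by omega) r.den_ne_zero)
  push_cast at h
  rw [← er, ← ea] at h
  refine ⟨x / r.den, y / r.den, z * a.den / r.den, w * a.den / r.den, ?_⟩
  have h' : r * r.den ^ 2 = x ^ 2 + D * y ^ 2 + a * a.den ^ 2 * z ^ 2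
      + D * (a * a.den ^ 2) * w ^ 2 := by linear_combination h
  field_simp
  linear_combination h'

end QuaternionNorms


/-! ### Imaginary quadratic subfields of ℂ and their norms -/

section QuadField

theorem sqrtNeg_mul_self {d : ℝ} (hd : 0 ≤ d) : sqrtNeg d * sqrtNeg d = -(d : ℂ) := by
  have : ((Real.sqrt d : ℝ) : ℂ) * (Real.sqrt d : ℝ) = (d : ℂ) := by
    rw [← Complex.ofReal_mul, Real.mul_self_sqrt hd]
  unfold sqrtNeg
  linear_combination (Complex.I * Complex.I) * this + (d : ℂ) * Complex.I_mul_I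

@[simp] theorem conj_sqrtNeg (d : ℝ) : (starRingEnd ℂ) (sqrtNeg d) = -sqrtNeg d := by
  simp [sqrtNeg]

theorem sqrtNeg_ne_zero {d : ℝ} (hd : 0 < d) : sqrtNeg d ≠ 0 := by
  simp [sqrtNeg, Real.sqrt_ne_zero'.2 hd]

theorem rat_add_mul_sqrtNeg_eq_zero {d : ℝ} (hd : 0 < d) {p q : ℚ}
    (h : (p : ℂ) + q * sqrtNeg d = 0) : p = 0 ∧ q = 0 := by
  have h1 := congrArg Complex.re h
  have h2 := congrArg Complex.im h
  simp [sqrtNeg, Real.sqrt_ne_zero'.2 hd] at h1 h2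
  exact ⟨h1, h2⟩

theorem mem_quadField_iff {d : ℚ} (hd : 0 < d) {z : ℂ} :
    z ∈ quadField d ↔ ∃ p q : ℚ, z = p + q * sqrtNeg d := by
  have hd' : (0 : ℝ) < d := by exact_mod_cast hd
  have hs := sqrtNeg_mul_self hd'.le
  rw [Complex.ofReal_ratCast] at hs
  constructor
  · intro hz
    let S : Subalgebra ℚ ℂ :=
      { carrier := {z | ∃ p q : ℚ, z = p + q * sqrtNeg d}
        mul_mem' := by
          rintro _ _ ⟨p, q, rfl⟩ ⟨p', q', rfl⟩
          refine ⟨p * p' - d * q * q', p * q' + q * p', ?_⟩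
          push_cast
          linear_combination (q * q' : ℂ) * hs
        add_mem' := by
          rintro _ _ ⟨p, q, rfl⟩ ⟨p', q', rfl⟩
          exact ⟨p + p', q + q', by push_cast; ring⟩
        algebraMap_mem' := fun r => ⟨r, 0, by simp⟩ }
    let F : IntermediateField ℚ ℂ := S.toIntermediateField (by
      rintro _ ⟨p, q, rfl⟩
      by_cases h0 : (p : ℂ) + q * sqrtNeg d = 0
      · exact ⟨0, 0, by simp [h0]⟩
      · have hN : p ^ 2 + d * q ^ 2 ≠ 0 := by
          intro h
          have hp : p = 0 := by
            have := mul_nonneg hd.le (sq_nonneg q)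
            exact pow_eq_zero_iff (two_ne_zero) |>.1 (by nlinarith [sq_nonneg p])
          have hq : q = 0 := by
            subst hp
            simpa [hd.ne'] using h
          exact h0 (by simp [hp, hq])
        have hN' : ((p : ℂ) ^ 2 + d * q ^ 2) ≠ 0 := by exact_mod_cast hN
        refine ⟨p / (p ^ 2 + d * q ^ 2), -q / (p ^ 2 + d * q ^ 2), ?_⟩
        push_cast
        refine inv_eq_of_mul_eq_one_right ?_
        have hM := mul_inv_cancel₀ hN'
        rw [div_eq_mul_inv, div_eq_mul_inv]
        generalize ((p : ℂ) ^ 2 + d * q ^ 2)⁻¹ = M at *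
        linear_combination (-q ^ 2 * M : ℂ) * hs + hM)
    have : quadField d ≤ F := IntermediateField.adjoin_simple_le_iff.2 ⟨0, 1, by simp⟩
    exact this hz
  · rintro ⟨p, q, rfl⟩
    have hp : ∀ r : ℚ, (r : ℂ) ∈ quadField d := fun r =>
      (quadField (d : ℝ)).algebraMap_mem r
    exact add_mem (hp p) (mul_mem (hp q) (IntermediateField.mem_adjoin_simple_self ℚ _))

theorem norm_quadField {d : ℚ} (hd : 0 < d) (z : quadField d) {p q : ℚ}
    (hz : (z : ℂ) = p + q * sqrtNeg d) : Algebra.norm ℚ z = p ^ 2 + d * q ^ 2 := by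
  have hd' : (0 : ℝ) < d := by exact_mod_cast hd
  have hs := sqrtNeg_mul_self hd'.le
  rw [Complex.ofReal_ratCast] at hs
  let α : quadField (d : ℝ) := ⟨sqrtNeg d, IntermediateField.mem_adjoin_simple_self ℚ _⟩
  let b : Module.Basis (Fin 2) ℚ (quadField (d : ℝ)) := Module.Basis.mk (v := ![1, α]) (by
      rw [LinearIndependent.pair_iff]
      intro s t h
      have := congrArg (Subtype.val) h
      refine rat_add_mul_sqrtNeg_eq_zero hd' ?_
      simpa [α, Algebra.smul_def] using this) (by
      rintro x -
      obtain ⟨p, q, h⟩ := (mem_quadField_iff hd).1 x.2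
      rw [Matrix.range_cons, Matrix.range_cons, Matrix.range_empty, Set.union_empty,
        Set.singleton_union, Submodule.mem_span_pair]
      refine ⟨p, q, ?_⟩
      ext
      simp [α, h, Algebra.smul_def])
  have hb0 : b 0 = 1 := by simp [b]
  have hb1 : b 1 = α := by simp [b]
  have h0 : z * b 0 = p • b 0 + q • b 1 := by
    rw [hb0, hb1]
    ext
    simp [α, hz, Algebra.smul_def]
  have h1 : z * b 1 = (-(d * q)) • b 0 + p • b 1 := by
    rw [hb0, hb1]
    ext
    simp [α, hz, Algebra.smul_def]
    linear_combination (q : ℂ) * hs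
  rw [Algebra.norm_eq_matrix_det b, Matrix.det_fin_two]
  simp only [Algebra.leftMulMatrix_eq_repr_mul, h0, h1, map_add, map_smul, Module.Basis.repr_self,
    Finsupp.add_apply, Finsupp.smul_apply, Finsupp.single_apply]
  simp
  ring

/-- Equality of imaginary quadratic fields, in terms of the discriminants. -/
theorem exists_sq_mul_eq_of_quadField_eq {d d' : ℚ} (hd : 0 < d) (hd' : 0 < d')
    (h : quadField d' = quadField d) : ∃ q : ℚ, 0 < q ∧ d' = q ^ 2 * d := by
  have h1 : sqrtNeg d' ∈ quadField (d : ℝ) := by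
    rw [← h]
    exact IntermediateField.mem_adjoin_simple_self ℚ _
  obtain ⟨p, q, hpq⟩ := (mem_quadField_iff hd).1 h1
  have hd1 : (0 : ℝ) < d := by exact_mod_cast hd
  have hd2 : (0 : ℝ) < d' := by exact_mod_cast hd'
  have him := congrArg Complex.im hpq
  have h3 : Real.sqrt d' = q * Real.sqrt d := by simpa [sqrtNeg] using him
  have hq : 0 < q := by
    have : (0 : ℝ) < q := by
      refine pos_of_mul_pos_left ?_ (Real.sqrt_nonneg (d : ℝ))
      rw [← h3]
      exact Real.sqrt_pos.2 hd2
    exact_mod_cast this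
  refine ⟨q, hq, ?_⟩
  have h4 : (d' : ℝ) = q ^ 2 * d := by
    rw [← Real.sq_sqrt hd2.le, h3, mul_pow, Real.sq_sqrt hd1.le]
  exact_mod_cast h4

theorem quadField_sq_mul {d r : ℚ} (hr : r ≠ 0) :
    quadField ((r ^ 2 * d : ℚ) : ℝ) = quadField d := by
  have h : sqrtNeg ((r ^ 2 * d : ℚ) : ℝ) = (|r| : ℚ) * sqrtNeg d := by
    have h1 : ((|r| : ℚ) : ℂ) = ((|(r : ℝ)| : ℝ) : ℂ) := by
      rw [← Rat.cast_abs, Complex.ofReal_ratCast]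
    unfold sqrtNeg
    push_cast
    rw [Real.sqrt_mul (sq_nonneg _), Real.sqrt_sq_eq_abs, h1, Complex.ofReal_mul]
    ring
  have hr' : ((|r| : ℚ) : ℂ) ≠ 0 := by simpa using hr
  have hm : ∀ (F : IntermediateField ℚ ℂ), ((|r| : ℚ) : ℂ) ∈ F := fun F => F.algebraMap_mem |r|
  apply le_antisymm
  · refine IntermediateField.adjoin_simple_le_iff.2 ?_
    rw [h]
    exact mul_mem (hm _) (IntermediateField.mem_adjoin_simple_self ℚ _)
  · refine IntermediateField.adjoin_simple_le_iff.2 ?_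
    have : sqrtNeg d = ((|r| : ℚ) : ℂ)⁻¹ * sqrtNeg ((r ^ 2 * d : ℚ) : ℝ) := by
      rw [h, inv_mul_cancel_left₀ hr']
    rw [this]
    exact mul_mem (inv_mem (hm _)) (IntermediateField.mem_adjoin_simple_self ℚ _)

end QuadField


/-! ### Hermitian spaces over imaginary quadratic fields: diagonalization and determinants -/

section HermSpace

variable {X : Type*} [AddCommGroup X] [Module ℚ X]

/-- A rational vector space with an action of `√(-D)` by a similitude `J` of an alternating form:
the same as a Hermitian space over `ℚ(√(-D))`. -/
structure IsHermSpace (E : X →ₗ[ℚ] X →ₗ[ℚ] ℚ) (J : X →ₗ[ℚ] X) (D : ℕ) : Prop where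
  pos : 0 < D
  alt : ∀ x, E x x = 0
  sq : ∀ x, J (J x) = -((D : ℚ) • x)
  preserves : ∀ x y, E (J x) (J y) = (D : ℚ) * E x y

/-- The Hermitian form `E(x, J y) + √(-D) E(x, y)`. -/
def herm (E : X →ₗ[ℚ] X →ₗ[ℚ] ℚ) (J : X →ₗ[ℚ] X) (D : ℕ) (x y : X) : ℂ :=
  (E x (J y) : ℂ) + sqrtNeg D * (E x y : ℂ)

namespace IsHermSpace

variable {E : X →ₗ[ℚ] X →ₗ[ℚ] ℚ} {J : X →ₗ[ℚ] X} {D : ℕ} (hE : IsHermSpace E J D)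

include hE

theorem pos_real : (0 : ℝ) < D := by exact_mod_cast hE.pos

theorem pos_rat : (0 : ℚ) < D := by exact_mod_cast hE.pos

theorem sqrt_mul : sqrtNeg D * sqrtNeg D = -(D : ℂ) := by
  have := sqrtNeg_mul_self hE.pos_real.le
  simpa using this

theorem skew (x y : X) : E x y = -E y x := by
  have h := hE.alt (x + y)
  simp only [map_add, LinearMap.add_apply, hE.alt] at h
  linear_combination h

theorem apply_J (x y : X) : E (J x) y = -E x (J y) := by
  have h := hE.preserves x (J y)
  rw [hE.sq, map_neg, map_smul, smul_eq_mul] at h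
  have hD := hE.pos_rat.ne'
  have h2 : (D : ℚ) * (E (J x) y + E x (J y)) = 0 := by linear_combination -h
  rcases mul_eq_zero.1 h2 with h3 | h3
  · exact absurd h3 hD
  · linear_combination h3

theorem symm (x y : X) : E x (J y) = E y (J x) := by
  rw [hE.skew, hE.apply_J, neg_neg]

theorem conj_herm (x y : X) : (starRingEnd ℂ) (herm E J D x y) = herm E J D y x := by
  simp only [herm, map_add, map_mul, conj_sqrtNeg, map_ratCast]
  rw [hE.symm x y, hE.skew x y]
  push_cast
  ring

theorem herm_J (x y : X) : herm E J D x (J y) = sqrtNeg D * herm E J D x y := by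
  simp only [herm, hE.sq, map_neg, map_smul, smul_eq_mul]
  push_cast
  linear_combination -(E x y : ℂ) * hE.sqrt_mul

theorem herm_self (x : X) : herm E J D x x = (E x (J x) : ℂ) := by
  simp [herm, hE.alt]

omit hE in
theorem herm_add_right (x y z : X) : herm E J D x (y + z) = herm E J D x y + herm E J D x z := by
  simp only [herm, map_add]
  push_cast
  ring

omit hE in
theorem herm_smul_right (x y : X) (c : ℚ) : herm E J D x (c • y) = c * herm E J D x y := by
  simp only [herm, map_smul, smul_eq_mul]
  push_cast
  ring

omit hE in
theorem herm_sub_right (x y z : X) : herm E J D x (y - z) = herm E J D x y - herm E J D x z := by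
  simp only [herm, map_sub]
  push_cast
  ring

omit hE in
theorem herm_sum_right {ι : Type*} (s : Finset ι) (x : X) (f : ι → X) :
    herm E J D x (∑ i ∈ s, f i) = ∑ i ∈ s, herm E J D x (f i) := by
  simp only [herm, map_sum]
  push_cast
  rw [Finset.mul_sum, Finset.sum_add_distrib]

theorem herm_eq_zero_iff {x y : X} : herm E J D x y = 0 ↔ E x (J y) = 0 ∧ E x y = 0 := by
  constructor
  · intro h
    refine rat_add_mul_sqrtNeg_eq_zero hE.pos_real ?_
    rw [← h, herm, mul_comm]
  · rintro ⟨h1, h2⟩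
    simp [herm, h1, h2]

/-- An orthogonal family of anisotropic vectors. -/
def _root_.WeilTori.IsOrthFamily (E : X →ₗ[ℚ] X →ₗ[ℚ] ℚ) (J : X →ₗ[ℚ] X) (D : ℕ) {k : ℕ}
    (v : Fin k → X) : Prop :=
  (∀ i l, i ≠ l → herm E J D (v i) (v l) = 0) ∧ ∀ i, E (v i) (J (v i)) ≠ 0

variable {k : ℕ} {v : Fin k → X}

/-- The component of `x` orthogonal to an orthogonal family. -/
theorem exists_proj (hv : IsOrthFamily E J D v) (x : X) :
    ∃ y, (∀ i, herm E J D (v i) y = 0) ∧ ∀ z, herm E J D z y = herm E J D z x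
      - ∑ i, herm E J D z (v i) * herm E J D (v i) x / (E (v i) (J (v i)) : ℂ) := by
  have key : ∀ z, herm E J D z (x - ∑ i, ((E (v i) (J x) / E (v i) (J (v i))) • v i
      + (E (v i) x / E (v i) (J (v i))) • J (v i))) = herm E J D z x
      - ∑ i, herm E J D z (v i) * herm E J D (v i) x / (E (v i) (J (v i)) : ℂ) := by
    intro z
    rw [herm_sub_right, herm_sum_right]
    congr 1
    refine Finset.sum_congr rfl fun i _ => ?_
    rw [herm_add_right, herm_smul_right, herm_smul_right, hE.herm_J]
    have : herm E J D (v i) x = (E (v i) (J x) : ℂ) + sqrtNeg D * (E (v i) x : ℂ) := rfl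
    rw [this]
    push_cast
    ring
  refine ⟨_, fun l => ?_, key⟩
  rw [key, Finset.sum_eq_single l, hE.herm_self, mul_div_cancel_left₀, sub_self]
  · exact_mod_cast hv.2 l
  · intro i _ hi
    rw [hv.1 l i hi.symm, zero_mul, zero_div]
  · simp

/-- If all vectors orthogonal to an orthogonal family are isotropic, then the Hermitian form is
determined by the family. -/
theorem herm_eq_sum (hv : IsOrthFamily E J D v)
    (h : ∀ y, (∀ i, herm E J D (v i) y = 0) → E y (J y) = 0) (x y : X) :
    herm E J D x y
      = ∑ i, herm E J D x (v i) * herm E J D (v i) y / (E (v i) (J (v i)) : ℂ) := by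
  obtain ⟨x', hx1, hx2⟩ := hE.exists_proj hv x
  obtain ⟨y', hy1, hy2⟩ := hE.exists_proj hv y
  -- The form E(a, Jb) is symmetric, so it vanishes on the orthogonal complement as soon as its
  -- quadratic form does.
  have pol : ∀ a b, (∀ i, herm E J D (v i) a = 0) → (∀ i, herm E J D (v i) b = 0) →
      E a (J b) = 0 := by
    intro a b ha hb
    have h1 := h (a + b) fun i => by rw [herm_add_right, ha, hb, add_zero]
    simp only [map_add, LinearMap.add_apply, h a ha, h b hb] at h1
    have := hE.symm a b
    linarith
  have h1 := pol x' y' hx1 hy1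
  have h2 := pol x' (J y') hx1 fun i => by rw [hE.herm_J, hy1, mul_zero]
  rw [hE.sq, map_neg, map_smul, smul_eq_mul, neg_eq_zero, mul_eq_zero] at h2
  have h3 : herm E J D x' y' = 0 := hE.herm_eq_zero_iff.2 ⟨h1, h2.resolve_left hE.pos_rat.ne'⟩
  have h5 : herm E J D x' y = 0 := by
    rw [hy2 x'] at h3
    rw [Finset.sum_eq_zero] at h3
    · simpa using h3
    · intro i _
      rw [← hE.conj_herm (v i) x', hx1 i, map_zero, zero_mul, zero_div]
  have h6 := hx2 y
  rw [← hE.conj_herm x' y, h5, map_zero] at h6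
  rw [eq_comm, sub_eq_zero] at h6
  have h7 := congrArg (starRingEnd ℂ) h6
  rw [hE.conj_herm, map_sum] at h7
  rw [h7]
  refine Finset.sum_congr rfl fun i _ => ?_
  rw [map_div₀, map_mul, hE.conj_herm, hE.conj_herm, map_ratCast]
  ring

theorem linearIndependent_of_isOrthFamily (hv : IsOrthFamily E J D v) :
    LinearIndependent ℚ (Sum.elim v fun i => J (v i)) := by
  rw [Fintype.linearIndependent_iff]
  intro c hc
  rw [Fintype.sum_sum_type] at hc
  simp only [Sum.elim_inl, Sum.elim_inr] at hc
  have key : ∀ l, (c (Sum.inl l) : ℂ) + c (Sum.inr l) * sqrtNeg D = 0 := by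
    intro l
    have h := congrArg (herm E J D (v l)) hc
    rw [herm_add_right, herm_sum_right, herm_sum_right, Finset.sum_eq_single l,
      Finset.sum_eq_single l, herm_smul_right, herm_smul_right, hE.herm_J, hE.herm_self] at h
    · have h0 : herm E J D (v l) 0 = 0 := by simp [herm]
      rw [h0] at h
      have hne : (E (v l) (J (v l)) : ℂ) ≠ 0 := by exact_mod_cast hv.2 l
      refine mul_right_cancel₀ hne ?_
      linear_combination h
    · intro i _ hi
      rw [herm_smul_right, hE.herm_J, hv.1 l i hi.symm, mul_zero, mul_zero]
    · simp
    · intro i _ hi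
      rw [herm_smul_right, hv.1 l i hi.symm, mul_zero]
    · simp
  rintro (l | l)
  · exact (rat_add_mul_sqrtNeg_eq_zero hE.pos_real (key l)).1
  · exact (rat_add_mul_sqrtNeg_eq_zero hE.pos_real (key l)).2

/-- If the complement of a family of length k were isotropic, every Gram matrix would factor through
a space of dimension k, and a nondegenerate one of size n > k could not exist. -/
theorem exists_extend {n : ℕ} (hv : IsOrthFamily E J D v) {e : Fin n → X}
    (he : (Matrix.of fun i l => herm E J D (e i) (e l)).det ≠ 0) (hk : k < n) :
    ∃ y, (∀ i, herm E J D (v i) y = 0) ∧ E y (J y) ≠ 0 := by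
  by_contra hcon
  push Not at hcon
  have hsum := hE.herm_eq_sum hv hcon
  have hfac : (Matrix.of fun i l => herm E J D (e i) (e l))
      = (Matrix.of fun (a : Fin n) (i : Fin k) => herm E J D (e a) (v i)) *
        (Matrix.of fun (i : Fin k) (b : Fin n) =>
          herm E J D (v i) (e b) / (E (v i) (J (v i)) : ℂ)) := by
    ext a b
    simp only [Matrix.mul_apply, Matrix.of_apply]
    rw [hsum]
    simp only [mul_div_assoc]
  have h1 := Matrix.rank_mul_le_left
    (Matrix.of fun (a : Fin n) (i : Fin k) => herm E J D (e a) (v i))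
    (Matrix.of fun (i : Fin k) (b : Fin n) => herm E J D (v i) (e b) / (E (v i) (J (v i)) : ℂ))
  rw [← hfac, Matrix.rank_of_isUnit _ ((Matrix.isUnit_iff_isUnit_det _).2 he.isUnit),
    Fintype.card_fin] at h1
  have h2 := Matrix.rank_le_width (Matrix.of fun (a : Fin n) (i : Fin k) => herm E J D (e a) (v i))
  omega

theorem isOrthFamily_cons (hv : IsOrthFamily E J D v) {y : X}
    (hy : ∀ i, herm E J D (v i) y = 0) (hy0 : E y (J y) ≠ 0) :
    IsOrthFamily E J D (Fin.cons y v : Fin (k + 1) → X) := by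
  constructor
  · intro i l
    refine Fin.cases ?_ (fun i => ?_) i <;> refine Fin.cases ?_ (fun l => ?_) l
    · exact fun h => absurd rfl h
    · intro _
      rw [Fin.cons_zero, Fin.cons_succ, ← hE.conj_herm, hy, map_zero]
    · intro _
      rw [Fin.cons_zero, Fin.cons_succ, hy]
    · intro h
      rw [Fin.cons_succ, Fin.cons_succ]
      exact hv.1 i l fun h' => h (by rw [h'])
  · intro i
    refine Fin.cases ?_ (fun i => ?_) i
    · exact hy0
    · rw [Fin.cons_succ]; exact hv.2 i

theorem exists_isOrthFamily {n : ℕ} {e : Fin n → X}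
    (he : (Matrix.of fun i l => herm E J D (e i) (e l)).det ≠ 0) :
    ∀ k ≤ n, ∃ v : Fin k → X, IsOrthFamily E J D v := by
  intro k
  induction k with
  | zero => exact fun _ => ⟨Fin.elim0, fun i => i.elim0, fun i => i.elim0⟩
  | succ k ih =>
    intro hk
    obtain ⟨v, hv⟩ := ih (by omega)
    obtain ⟨y, hy, hy0⟩ := hE.exists_extend hv he hk
    exact ⟨_, hE.isOrthFamily_cons hv hy hy0⟩

/-- A further anisotropic orthogonal vector would produce 2k + 2 independent vectors over ℚ. -/
theorem isotropic_of_finrank [Module.Finite ℚ X] (hfin : Module.finrank ℚ X = 2 * k)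
    (hv : IsOrthFamily E J D v) (y : X) (hy : ∀ i, herm E J D (v i) y = 0) : E y (J y) = 0 := by
  by_contra hy0
  have h := (hE.linearIndependent_of_isOrthFamily (hE.isOrthFamily_cons hv hy hy0)).fintype_card_le_finrank
  simp at h
  omega

omit hE in
theorem exists_rat_eq_herm (x y : X) : ∃ p q : ℚ, herm E J D x y = p + q * sqrtNeg D :=
  ⟨E x (J y), E x y, by rw [herm, mul_comm (sqrtNeg _)]⟩

/-- The determinants of the form in two bases differ by a norm. -/
theorem det_mul_prod_eq_norm (hv : IsOrthFamily E J D v) {e : Fin k → X}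
    (hiso : ∀ y, (∀ i, herm E J D (v i) y = 0) → E y (J y) = 0) :
    ∃ p q : ℚ, (Matrix.of fun i l => herm E J D (e i) (e l)).det
      * ((∏ i, E (v i) (J (v i)) : ℚ) : ℂ) = ((p ^ 2 + D * q ^ 2 : ℚ) : ℂ) := by
  let C : Matrix (Fin k) (Fin k) ℂ := Matrix.of fun a i => herm E J D (e a) (v i)
  let A : Matrix (Fin k) (Fin k) ℂ := Matrix.diagonal fun i => ((E (v i) (J (v i)) : ℂ))⁻¹
  -- Base change between e and the orthogonal family: the product of the determinant with the
  -- diagonal entries is the norm of det C.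
  have hfac : (Matrix.of fun i l => herm E J D (e i) (e l)) = C * A * C.conjTranspose := by
    ext a b
    rw [Matrix.mul_apply]
    simp only [A, Matrix.mul_diagonal, C, Matrix.of_apply, Matrix.conjTranspose_apply]
    rw [hE.herm_eq_sum hv hiso]
    refine Finset.sum_congr rfl fun i _ => ?_
    rw [← hE.conj_herm (e b) (v i)]
    simp only [starRingEnd_apply]
    ring
  have hdet : C.det ∈ quadField ((D : ℚ) : ℝ) := by
    rw [Matrix.det_apply]
    refine sum_mem fun σ _ => ?_
    rw [Units.smul_def, zsmul_eq_mul]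
    refine mul_mem (intCast_mem _ _) (prod_mem fun i _ => ?_)
    rw [mem_quadField_iff hE.pos_rat]
    obtain ⟨p, q, h⟩ := exists_rat_eq_herm (E := E) (J := J) (D := D) (e (σ i)) (v i)
    exact ⟨p, q, by rw [Rat.cast_natCast]; exact h⟩
  obtain ⟨p, q, hpq⟩ := (mem_quadField_iff hE.pos_rat).1 hdet
  rw [Rat.cast_natCast] at hpq
  refine ⟨p, q, ?_⟩
  rw [hfac, Matrix.det_mul, Matrix.det_mul, Matrix.det_conjTranspose, Matrix.det_diagonal, hpq]
  have hne : ∏ i, (E (v i) (J (v i)) : ℂ) ≠ 0 :=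
    Finset.prod_ne_zero_iff.2 fun i _ => by exact_mod_cast hv.2 i
  have hstar : star ((p : ℂ) + q * sqrtNeg D) = p - q * sqrtNeg D := by
    change (starRingEnd ℂ) _ = _
    simp
    ring
  rw [hstar, Finset.prod_inv_distrib]
  push_cast
  rw [mul_right_comm, mul_assoc ((p : ℂ) + _), inv_mul_cancel₀ hne]
  linear_combination (-q ^ 2 : ℂ) * hE.sqrt_mul

end IsHermSpace

end HermSpace


/-! ### Indefinite Hermitian spaces of dimension four and determinant one -/

section Hyperbolic

theorem exists_perm_sign : ∀ s : Fin 4 → SignType, (∀ i, s i ≠ 0) → s 0 * s 1 * s 2 * s 3 = 1 →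
    (∃ i, s i = 1) → (∃ i, s i = -1) →
    ∃ e : Equiv.Perm (Fin 4), s (e 0) = 1 ∧ s (e 1) = 1 ∧ s (e 2) = -1 ∧ s (e 3) = -1 := by
  decide +kernel

variable {X : Type*} [AddCommGroup X] [Module ℚ X]

namespace IsHermSpace

variable {E : X →ₗ[ℚ] X →ₗ[ℚ] ℚ} {J : X →ₗ[ℚ] X} {D : ℕ} (hE : IsHermSpace E J D)

include hE

/-- The plane ⟨a₀, a₁⟩ is rewritten as ⟨-a₂, -a₃⟩. The vector w₀ represents -a₂ by `hz`; w' is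
orthogonal to it in the plane and has value -a₀a₁a₂; the scalar p + qJ, of the norm prescribed by
`ht`, turns this value into -a₃. -/
theorem exists_pair {v₀ v₁ : X} (h1 : E v₀ v₁ = 0) (h2 : E v₀ (J v₁) = 0) {a₂ a₃ x y z w p q : ℚ}
    (hz : E v₀ (J v₀) * (x ^ 2 + D * y ^ 2) + E v₁ (J v₁) * (z ^ 2 + D * w ^ 2) = -a₂)
    (ht : (p ^ 2 + D * q ^ 2) * (E v₀ (J v₀) * E v₁ (J v₁) * a₂) = a₃) :
    ∃ w₀ w₁ : X, E w₀ w₁ = 0 ∧ E w₀ (J w₁) = 0 ∧ E w₀ (J w₀) = -a₂ ∧ E w₁ (J w₁) = -a₃ ∧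
      ∀ u, E v₀ u = 0 → E v₁ u = 0 → E v₀ (J u) = 0 → E v₁ (J u) = 0 →
        E w₀ u = 0 ∧ E w₁ u = 0 ∧ E w₀ (J u) = 0 ∧ E w₁ (J u) = 0 := by
  have h3 : E v₁ v₀ = 0 := by rw [hE.skew, h1, neg_zero]
  have h4 : E v₁ (J v₀) = 0 := by rw [hE.symm, h2]
  generalize ha₀ : E v₀ (J v₀) = a₀ at *
  generalize ha₁ : E v₁ (J v₁) = a₁ at *
  let w₀ := x • v₀ + y • J v₀ + z • v₁ + w • J v₁
  let w' := (-a₁ * z) • v₀ + (a₁ * w) • J v₀ + (a₀ * x) • v₁ + (-a₀ * y) • J v₁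
  have e1 : E w₀ w' = 0 := by
    simp only [w₀, w', map_add, map_smul, LinearMap.add_apply, LinearMap.smul_apply, smul_eq_mul,
      hE.apply_J, hE.sq, map_neg, hE.alt, h1, h2, h3, h4, ha₀, ha₁]
    ring
  have e2 : E w₀ (J w') = 0 := by
    simp only [w₀, w', map_add, map_smul, LinearMap.add_apply, LinearMap.smul_apply, smul_eq_mul,
      hE.apply_J, hE.sq, map_neg, hE.alt, h1, h2, h3, h4, ha₀, ha₁]
    ring
  have e3 : E w₀ (J w₀) = -a₂ := by
    simp only [w₀, map_add, map_smul, LinearMap.add_apply, LinearMap.smul_apply, smul_eq_mul,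
      hE.apply_J, hE.sq, map_neg, hE.alt, h1, h2, h3, h4, ha₀, ha₁]
    linear_combination hz
  have e4 : E w' (J w') = -(a₀ * a₁ * a₂) := by
    simp only [w', map_add, map_smul, LinearMap.add_apply, LinearMap.smul_apply, smul_eq_mul,
      hE.apply_J, hE.sq, map_neg, hE.alt, h1, h2, h3, h4, ha₀, ha₁]
    linear_combination a₀ * a₁ * hz
  have e5 : ∀ u, E v₀ u = 0 → E v₁ u = 0 → E v₀ (J u) = 0 → E v₁ (J u) = 0 →
      E w₀ u = 0 ∧ E w' u = 0 ∧ E w₀ (J u) = 0 ∧ E w' (J u) = 0 := by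
    intro u u1 u2 u3 u4
    simp [w₀, w', hE.apply_J, hE.sq, u1, u2, u3, u4]
  refine ⟨w₀, p • w' + q • J w', ?_, ?_, e3, ?_, fun u u1 u2 u3 u4 => ?_⟩
  · simp [e1, e2]
  · simp [e1, e2, hE.sq]
  · simp only [map_add, map_smul, LinearMap.add_apply, LinearMap.smul_apply, smul_eq_mul,
      hE.apply_J, hE.sq, map_neg, hE.alt, e4]
    linear_combination -ht
  · obtain ⟨u5, u6, u7, u8⟩ := e5 u u1 u2 u3 u4
    refine ⟨u5, ?_, u7, ?_⟩ <;> simp [hE.apply_J, hE.sq, u6, u8]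

/-- A hyperbolic plane `⟨c, -c⟩` has an orthogonal basis with values `ρ⁻¹, -ρ⁻¹`. -/
theorem exists_unit_pair {w v : X} (h1 : E w v = 0) (h2 : E w (J v) = 0) {c ρ : ℚ} (hc : c ≠ 0)
    (hρ : ρ ≠ 0) (hw : E w (J w) = c) (hv : E v (J v) = -c) :
    ∃ α β : ℚ, ρ * E (α • w + β • v) (J (α • w + β • v)) = 1 ∧
      ρ * E (β • w + α • v) (J (β • w + α • v)) = -1 ∧
      E (α • w + β • v) (β • w + α • v) = 0 ∧ E (α • w + β • v) (J (β • w + α • v)) = 0 := by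
  have h3 : E v w = 0 := by rw [hE.skew, h1, neg_zero]
  have h4 : E v (J w) = 0 := by rw [hE.symm, h2]
  -- The coefficients are chosen so that α + β = 1/(ρc) and α - β = 1, whence α² - β² = 1/(ρc).
  have key : ρ * (c * (((1 / (ρ * c) + 1) / 2) ^ 2 - ((1 / (ρ * c) - 1) / 2) ^ 2)) = 1 := by
    field_simp
    ring
  refine ⟨(1 / (ρ * c) + 1) / 2, (1 / (ρ * c) - 1) / 2, ?_⟩
  generalize (1 / (ρ * c) + 1) / 2 = α at *
  generalize (1 / (ρ * c) - 1) / 2 = β at *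
  simp only [map_add, map_smul, LinearMap.add_apply, LinearMap.smul_apply, smul_eq_mul,
      hE.alt, h1, h2, h3, h4, hw, hv]
  refine ⟨?_, ?_, ?_, ?_⟩
  · linear_combination key
  · linear_combination -key
  · ring
  · ring

/-- An indefinite Hermitian space of dimension four over `ℚ(√(-D))`, of determinant one, is
hyperbolic. -/
theorem exists_hyperbolic_basis [Module.Finite ℚ X] (hfin : Module.finrank ℚ X = 8) {e : Fin 4 → X}
    {p q : ℚ} (hdet : (Matrix.of fun i l => herm E J D (e i) (e l)).det
      = ((p ^ 2 + D * q ^ 2 : ℚ) : ℂ)) (hpq : p ^ 2 + D * q ^ 2 ≠ 0)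
    (hneg : ∃ x, E x (J x) < 0) (hpos : ∃ x, 0 < E x (J x)) {ρ : ℚ} (hρ : ρ ≠ 0) :
    ∃ u : Fin 4 → X, (∀ i l, E (u i) (u l) = 0) ∧
      ∀ i l, ρ * E (u i) (J (u l)) = if i = l then (![1, 1, -1, -1] : Fin 4 → ℚ) i else 0 := by
  have hD := hE.pos_rat
  obtain ⟨v, hv⟩ := hE.exists_isOrthFamily (e := e) (by rw [hdet]; exact_mod_cast hpq) 4 le_rfl
  have hiso := hE.isotropic_of_finrank hfin hv
  obtain ⟨p', q', h⟩ := hE.det_mul_prod_eq_norm hv (e := e) hiso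
  rw [hdet] at h
  have h' : (p ^ 2 + D * q ^ 2) * ∏ i, E (v i) (J (v i)) = p' ^ 2 + D * q' ^ 2 := by exact_mod_cast h
  rw [Fin.prod_univ_four] at h'
  have hE0 : ∀ i l, E (v i) (v l) = 0 := fun i l => by
    by_cases hil : i = l
    · rw [hil, hE.alt]
    · exact (hE.herm_eq_zero_iff.1 (hv.1 i l hil)).2
  have hEJ : ∀ i l, i ≠ l → E (v i) (J (v l)) = 0 := fun i l hil =>
    (hE.herm_eq_zero_iff.1 (hv.1 i l hil)).1
  have hsum : ∀ x, E x (J x) = ∑ i, (E x (J (v i)) ^ 2 + D * E x (v i) ^ 2) / E (v i) (J (v i)) := by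
    intro x
    have h1 := hE.herm_eq_sum hv hiso x x
    rw [hE.herm_self] at h1
    have h2 : (E x (J x) : ℂ) = ((∑ i, (E x (J (v i)) ^ 2 + D * E x (v i) ^ 2)
        / E (v i) (J (v i)) : ℚ) : ℂ) := by
      rw [h1]
      push_cast
      refine Finset.sum_congr rfl fun i _ => ?_
      rw [← hE.conj_herm x (v i)]
      congr 1
      simp only [herm, map_add, map_mul, conj_sqrtNeg, map_ratCast]
      linear_combination (-(E x (v i)) ^ 2 : ℂ) * hE.sqrt_mul
    exact_mod_cast h2
  have hnn : ∀ a b : ℚ, 0 ≤ a ^ 2 + D * b ^ 2 := fun a b => by positivity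
  -- The determinant is a norm, so the product of the four diagonal entries is positive and an even
  -- number of them is negative. Indefiniteness excludes zero and four.
  have hsign := exists_perm_sign (fun i => SignType.sign (E (v i) (J (v i))))
    (fun i => by simpa using hv.2 i) (by
      have hP : 0 < E (v 0) (J (v 0)) * E (v 1) (J (v 1)) * E (v 2) (J (v 2)) * E (v 3) (J (v 3)) := by
        have h1 : 0 < p ^ 2 + D * q ^ 2 := lt_of_le_of_ne (hnn p q) hpq.symm
        refine lt_of_le_of_ne ?_ ?_
        · by_contra hlt
          have := mul_neg_of_pos_of_neg h1 (not_le.1 hlt)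
          rw [h'] at this
          exact absurd (hnn p' q') (not_le.2 this)
        · exact (mul_ne_zero (mul_ne_zero (mul_ne_zero (hv.2 0) (hv.2 1)) (hv.2 2)) (hv.2 3)).symm
      rw [← sign_mul, ← sign_mul, ← sign_mul, sign_pos hP]) (by
      by_contra hcon
      push Not at hcon
      obtain ⟨x, hx⟩ := hpos
      refine absurd hx (not_lt.2 ?_)
      rw [hsum x]
      refine Finset.sum_nonpos fun i _ => div_nonpos_of_nonneg_of_nonpos (hnn _ _) ?_
      by_contra hlt
      exact hcon i (sign_pos (not_le.1 hlt))) (by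
      by_contra hcon
      push Not at hcon
      obtain ⟨x, hx⟩ := hneg
      refine absurd hx (not_lt.2 ?_)
      rw [hsum x]
      refine Finset.sum_nonneg fun i _ => div_nonneg (hnn _ _) ?_
      by_contra hlt
      exact hcon i (sign_neg (not_le.1 hlt)))
  obtain ⟨σ, h0, h1, h2, h3⟩ := hsign
  rw [sign_eq_one_iff] at h0 h1
  rw [sign_eq_neg_one_iff] at h2 h3
  have hne : ∀ i l, i ≠ l → σ i ≠ σ l := fun i l hil h => hil (σ.injective h)
  have hprod : (p ^ 2 + D * q ^ 2) * (E (v (σ 0)) (J (v (σ 0))) * E (v (σ 1)) (J (v (σ 1)))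
      * E (v (σ 2)) (J (v (σ 2))) * E (v (σ 3)) (J (v (σ 3)))) = p' ^ 2 + D * q' ^ 2 := by
    rw [← h']
    congr 1
    have := Equiv.prod_comp σ fun i => E (v i) (J (v i))
    rw [Fin.prod_univ_four, Fin.prod_univ_four] at this
    exact this
  have key0 := hEJ _ _ (hne 0 1 (by decide))
  have key2 : ∀ l, l ≠ 0 → l ≠ 1 → E (v (σ 0)) (J (v (σ l))) = 0 ∧ E (v (σ 1)) (J (v (σ l))) = 0 :=
    fun l hl hl' => ⟨hEJ _ _ (hne 0 l hl.symm), hEJ _ _ (hne 1 l hl'.symm)⟩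
  have key23 := hEJ _ _ (hne 2 3 (by decide))
  generalize ha₀ : E (v (σ 0)) (J (v (σ 0))) = a₀ at *
  generalize ha₁ : E (v (σ 1)) (J (v (σ 1))) = a₁ at *
  generalize ha₂ : E (v (σ 2)) (J (v (σ 2))) = a₂ at *
  generalize ha₃ : E (v (σ 3)) (J (v (σ 3))) = a₃ at *
  -- That ⟨a₀, a₁⟩ represents -a₂ means, after multiplication by a₀, that -a₀a₂ > 0 is a norm from
  -- the quaternion algebra (-D, -a₀a₁).
  obtain ⟨x, y, z, w, hxyzw⟩ := exists_quaternion_norm_eq hE.pos (a := a₀ * a₁) (r := -(a₂ * a₀))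
    (mul_pos h0 h1) (by have := mul_neg_of_neg_of_pos h2 h0; linarith)
  have hN' : p' ^ 2 + D * q' ^ 2 ≠ 0 := by
    rw [← hprod]
    exact mul_ne_zero hpq (mul_ne_zero (mul_ne_zero (mul_ne_zero h0.ne' h1.ne') h2.ne) h3.ne)
  have hN'' : a₀ * a₁ * a₂ * a₃ = (p' ^ 2 + D * q' ^ 2) / (p ^ 2 + D * q ^ 2) := by
    rw [eq_div_iff hpq, ← hprod]; ring
  -- Since a₀a₁a₂a₃ is the quotient of the norms of p' + q'√(-D) and p + q√(-D), the ratio a₃ /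
  -- (a₀a₁a₂) is the norm of a₃(p + q√(-D)) / (p' + q'√(-D)). The arguments p and q are its
  -- coordinates.
  obtain ⟨w₀, w₁, hw1, hw2, hw3, hw4, hw5⟩ := hE.exists_pair (hE0 (σ 0) (σ 1)) key0 (a₂ := a₂)
    (a₃ := a₃) (x := x / a₀) (y := y / a₀) (z := z) (w := w)
    (p := a₃ * (p * p' + D * q * q') / (p' ^ 2 + D * q' ^ 2))
    (q := a₃ * (p' * q - p * q') / (p' ^ 2 + D * q' ^ 2))
    (by
      rw [ha₀, ha₁]
      have h0' := h0.ne'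
      field_simp
      linear_combination -hxyzw) (by
      rw [ha₀, ha₁]
      have h4 : a₀ * a₁ * a₂ = (p' ^ 2 + D * q' ^ 2) / (p ^ 2 + D * q ^ 2) / a₃ := by
        rw [← hN'', mul_div_cancel_right₀ _ h3.ne]
      rw [h4]
      have h3' := h3.ne
      generalize hM : p' ^ 2 + (D : ℚ) * q' ^ 2 = M at *
      generalize hM' : p ^ 2 + (D : ℚ) * q ^ 2 = M' at *
      field_simp
      rw [← hM, ← hM']
      ring)
  obtain ⟨b1, b2, b3, b4⟩ := hw5 (v (σ 2)) (hE0 _ _) (hE0 _ _) (key2 2 (by decide) (by decide)).1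
    (key2 2 (by decide) (by decide)).2
  obtain ⟨c1, c2, c3, c4⟩ := hw5 (v (σ 3)) (hE0 _ _) (hE0 _ _) (key2 3 (by decide) (by decide)).1
    (key2 3 (by decide) (by decide)).2
  -- The space is now ⟨-a₂, a₂⟩ ⊕ ⟨-a₃, a₃⟩, and each summand is a hyperbolic plane that can be
  -- normalized separately.
  obtain ⟨α, β, m1, m2, m3, m4⟩ := hE.exists_unit_pair (c := -a₂) (ρ := ρ) b1 b3 (by linarith [h2]) hρ hw3
    (by rw [ha₂, neg_neg])
  obtain ⟨α', β', n1, n2, n3, n4⟩ := hE.exists_unit_pair (c := -a₃) (ρ := ρ) c2 c4 (by linarith [h3]) hρ hw4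
    (by rw [ha₃, neg_neg])
  have g1 : ∀ x y x' y' : ℚ, E (x • w₀ + y • v (σ 2)) (x' • w₁ + y' • v (σ 3)) = 0 ∧
      E (x • w₀ + y • v (σ 2)) (J (x' • w₁ + y' • v (σ 3))) = 0 := by
    intro x y x' y'
    have t1 : E (v (σ 2)) w₁ = 0 := by rw [hE.skew, b2, neg_zero]
    have t2 : E (v (σ 2)) (J w₁) = 0 := by rw [hE.symm, b4]
    constructor <;>
    simp only [map_add, map_smul, LinearMap.add_apply, LinearMap.smul_apply, smul_eq_mul, hw1, hw2,
      c1, c3, t1, t2, hE0, key23] <;> ring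
  obtain ⟨f1, f2⟩ := g1 α β α' β'
  obtain ⟨f3, f4⟩ := g1 α β β' α'
  obtain ⟨f5, f6⟩ := g1 β α α' β'
  obtain ⟨f7, f8⟩ := g1 β α β' α'
  generalize α • w₀ + β • v (σ 2) = u₀ at *
  generalize β • w₀ + α • v (σ 2) = u₂ at *
  generalize α' • w₁ + β' • v (σ 3) = u₁ at *
  generalize β' • w₁ + α' • v (σ 3) = u₃ at *
  have key : ∀ (i l : Fin 4), i ≤ l → E (![u₀, u₁, u₂, u₃] i) (![u₀, u₁, u₂, u₃] l) = 0 ∧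
      ρ * E (![u₀, u₁, u₂, u₃] i) (J (![u₀, u₁, u₂, u₃] l))
        = if i = l then (![1, 1, -1, -1] : Fin 4 → ℚ) i else 0 := by
    have s1 : E u₁ u₂ = 0 := by rw [hE.skew, f5, neg_zero]
    have s2 : E u₁ (J u₂) = 0 := by rw [hE.symm, f6]
    intro i l hil
    fin_cases i <;> fin_cases l <;> simp at hil <;>
      simp [hE.alt, m1, m2, m3, m4, n1, n2, n3, n4, f1, f2, f3, f4, f7, f8, s1, s2]
  refine ⟨![u₀, u₁, u₂, u₃], fun i l => ?_, fun i l => ?_⟩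
  · rcases le_total i l with hil | hil
    · exact (key i l hil).1
    · rw [hE.skew, (key l i hil).1, neg_zero]
  · rcases le_total i l with hil | hil
    · exact (key i l hil).2
    · rw [hE.symm, (key l i hil).2]
      by_cases h : l = i
      · rw [h]
      · rw [if_neg h, if_neg (Ne.symm h)]

end IsHermSpace

end Hyperbolic


/-! ### Passage between lattices and rational vector spaces -/

section RationalForms

variable {Λ : Type*} [AddCommGroup Λ]

/-- The rational extension of a rational valued bilinear form. -/
def ratForm (E : Λ →ₗ[ℤ] Λ →ₗ[ℤ] ℚ) : (ℚ ⊗[ℤ] Λ) →ₗ[ℚ] (ℚ ⊗[ℤ] Λ) →ₗ[ℚ] ℚ :=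
  (LinearMap.BilinMap.baseChange ℚ E).compr₂ (LinearMap.mul' ℤ ℚ).toAddMonoidHom.toRatLinearMap

theorem ratForm_tmul (E : Λ →ₗ[ℤ] Λ →ₗ[ℤ] ℚ) (p q : ℚ) (x y : Λ) :
    ratForm E (p ⊗ₜ x) (q ⊗ₜ y) = p * q * E x y := by
  simp only [ratForm, LinearMap.compr₂_apply, LinearMap.BilinMap.baseChange_tmul]
  exact LinearMap.mul'_apply

theorem isHermSpace_ratForm {n : ℕ} (b : Module.Basis (Fin n) ℤ Λ) {E : Λ →ₗ[ℤ] Λ →ₗ[ℤ] ℚ}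
    {ψ : Module.End ℤ Λ} {D : ℕ} (hD : 0 < D) (halt : ∀ x, E x x = 0)
    (hsq : ∀ x, ψ (ψ x) = -((D : ℤ) • x)) (hpres : ∀ x y, E (ψ x) (ψ y) = (D : ℚ) * E x y) :
    IsHermSpace (ratForm E) (ψ.baseChange ℚ) D := by
  have hskew : ∀ x y, E x y = -E y x := by
    intro x y
    have h := halt (x + y)
    simp only [map_add, LinearMap.add_apply, halt] at h
    linear_combination h
  refine ⟨hD, fun x => ?_, fun x => ?_, fun x y => ?_⟩
  · have h : ratForm E = -(ratForm E).flip := by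
      refine LinearMap.ext_basis (b.baseChange ℚ) (b.baseChange ℚ) fun i k => ?_
      simp only [Module.Basis.baseChange_apply, LinearMap.neg_apply, LinearMap.flip_apply,
        ratForm_tmul]
      rw [hskew]
      ring
    have h2 := congrArg (fun F => F x x) h
    simp only [LinearMap.neg_apply, LinearMap.flip_apply] at h2
    linarith
  · have h : (ψ.baseChange ℚ) ∘ₗ (ψ.baseChange ℚ) = (-(D : ℚ)) • LinearMap.id := by
      refine (b.baseChange ℚ).ext fun i => ?_
      simp only [Module.Basis.baseChange_apply, LinearMap.comp_apply, LinearMap.smul_apply,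
        LinearMap.id_apply, LinearMap.baseChange_tmul, hsq, TensorProduct.tmul_neg, neg_smul]
      rw [← TensorProduct.smul_tmul, TensorProduct.smul_tmul']
      simp
    have := congrArg (fun F => F x) h
    simpa using this
  · have h : (ratForm E).compl₁₂ (ψ.baseChange ℚ) (ψ.baseChange ℚ) = (D : ℚ) • ratForm E := by
      refine LinearMap.ext_basis (b.baseChange ℚ) (b.baseChange ℚ) fun i k => ?_
      simp only [Module.Basis.baseChange_apply, LinearMap.compl₁₂_apply, LinearMap.smul_apply,
        LinearMap.baseChange_tmul, ratForm_tmul, hpres, smul_eq_mul]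
      ring
    have := congrArg (fun F => F x y) h
    simpa using this

theorem exists_nsmul_eq_one_tmul (x : ℚ ⊗[ℤ] Λ) : ∃ (N : ℕ) (z : Λ), 0 < N ∧ (N : ℚ) • x = 1 ⊗ₜ z := by
  induction x using TensorProduct.induction_on with
  | zero => exact ⟨1, 0, one_pos, by simp⟩
  | tmul q z =>
    refine ⟨q.den, q.num • z, q.den_pos, ?_⟩
    rw [TensorProduct.smul_tmul', ← TensorProduct.smul_tmul]
    congr 1
    rw [smul_eq_mul, zsmul_eq_mul, mul_one, mul_comm, Rat.mul_den_eq_num]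
  | add x y hx hy =>
    obtain ⟨N, z, hN, h⟩ := hx
    obtain ⟨N', z', hN', h'⟩ := hy
    refine ⟨N * N', (N' : ℤ) • z + (N : ℤ) • z', Nat.mul_pos hN hN', ?_⟩
    have e : ∀ (n : ℕ) (z : Λ), (1 : ℚ) ⊗ₜ[ℤ] ((n : ℤ) • z) = (n : ℚ) • ((1 : ℚ) ⊗ₜ[ℤ] z) := by
      intro n z
      rw [← TensorProduct.smul_tmul, TensorProduct.smul_tmul']
      simp
    rw [TensorProduct.tmul_add, e, e, ← h, ← h', smul_add, smul_smul, smul_smul]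
    push_cast
    rw [mul_comm (N' : ℚ)]

theorem one_tmul_injective {n : ℕ} (b : Module.Basis (Fin n) ℤ Λ) :
    Function.Injective fun x : Λ => (1 : ℚ) ⊗ₜ[ℤ] x := by
  have : Module.Free ℤ Λ := Module.Free.of_basis b
  exact Module.Flat.tensorProduct_mk_injective (R := ℤ) (S := ℚ) (M := Λ)

/-- A linear map between rational spaces is, up to a multiple, defined over `ℤ`. -/
theorem exists_integral_map {Λ' : Type*} [AddCommGroup Λ'] {n : ℕ} (b : Module.Basis (Fin n) ℤ Λ)
    (F : (ℚ ⊗[ℤ] Λ) →ₗ[ℚ] (ℚ ⊗[ℤ] Λ')) :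
    ∃ (N : ℕ) (f : Λ →ₗ[ℤ] Λ'), 0 < N ∧ ∀ x, (1 : ℚ) ⊗ₜ[ℤ] f x = (N : ℚ) • F (1 ⊗ₜ x) := by
  choose N z hN hz using fun i => exists_nsmul_eq_one_tmul (F (1 ⊗ₜ b i))
  refine ⟨∏ i, N i, b.constr ℤ fun i => ((∏ k ∈ Finset.univ.erase i, N k : ℕ) : ℤ) • z i,
    Finset.prod_pos fun i _ => hN i, fun x => ?_⟩
  have h : (TensorProduct.mk ℤ ℚ Λ' 1) ∘ₗ
      (b.constr ℤ fun i => ((∏ k ∈ Finset.univ.erase i, N k : ℕ) : ℤ) • z i)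
      = (((∏ i, N i : ℕ) : ℚ) • F).restrictScalars ℤ ∘ₗ TensorProduct.mk ℤ ℚ Λ 1 := by
    refine b.ext fun i => ?_
    change (1 : ℚ) ⊗ₜ[ℤ] (b.constr ℤ fun i => ((∏ k ∈ Finset.univ.erase i, N k : ℕ) : ℤ) • z i) (b i)
      = ((∏ i, N i : ℕ) : ℚ) • F (1 ⊗ₜ b i)
    rw [Module.Basis.constr_basis, ← TensorProduct.smul_tmul, ← Finset.mul_prod_erase _ _ (Finset.mem_univ i), Nat.cast_mul,
      mul_comm, mul_smul, hz, TensorProduct.smul_tmul']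
    simp
  exact congrArg (fun G => G x) h

end RationalForms

/-! ### Dimensions of eigenspaces -/

section Eigenspaces

variable {W : Type*} [AddCommGroup W] [Module ℂ W] [Module.Finite ℂ W]

/-- A map and its transpose have the same rank. The Weil condition on H^{1,0} can therefore be
checked on the tangent space. -/
theorem finrank_eigenspace_dualMap (A : Module.End ℂ W) (μ : ℂ) :
    Module.finrank ℂ (Module.End.eigenspace (R := ℂ) (M := Module.Dual ℂ W) A.dualMap μ)
      = Module.finrank ℂ (Module.End.eigenspace A μ) := by
  have h1 : Module.End.eigenspace (R := ℂ) (M := Module.Dual ℂ W) A.dualMap μ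
      = LinearMap.ker (A - μ • LinearMap.id).dualMap := by
    ext l
    rw [Module.End.mem_eigenspace_iff, LinearMap.mem_ker, ← sub_eq_zero]
    have : (A - μ • LinearMap.id).dualMap l = A.dualMap l - μ • l := by
      ext x
      simp
    rw [this]
  have h2 : Module.End.eigenspace A μ = LinearMap.ker (A - μ • LinearMap.id) := by
    ext l
    rw [Module.End.mem_eigenspace_iff, LinearMap.mem_ker, ← sub_eq_zero]
    simp
  rw [h1, h2]
  have h3 := LinearMap.finrank_range_add_finrank_ker (A - μ • LinearMap.id).dualMap
  have h4 := LinearMap.finrank_range_add_finrank_ker (A - μ • LinearMap.id)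
  rw [LinearMap.finrank_range_dualMap_eq_finrank_range, Subspace.dual_finrank_eq] at h3
  omega

/-- If `A² = μ²` and `S` is injective and anticommutes with `A`, then the two eigenspaces of `A`
have the same dimension. -/
theorem two_mul_finrank_eigenspace {A S : Module.End ℂ W} {μ : ℂ} (hμ : μ ≠ 0)
    (hA : ∀ x, A (A x) = (μ * μ) • x) (hS : Function.Injective S) (hAS : ∀ x, A (S x) = -S (A x)) :
    2 * Module.finrank ℂ (Module.End.eigenspace A μ) = Module.finrank ℂ W ∧
      2 * Module.finrank ℂ (Module.End.eigenspace A (-μ)) = Module.finrank ℂ W := by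
  have hle : ∀ ν : ℂ, Module.finrank ℂ (Module.End.eigenspace A ν)
      ≤ Module.finrank ℂ (Module.End.eigenspace A (-ν)) := by
    intro ν
    have hmap : ∀ x ∈ Module.End.eigenspace A ν, S x ∈ Module.End.eigenspace A (-ν) := by
      intro x hx
      rw [Module.End.mem_eigenspace_iff] at hx ⊢
      rw [hAS, hx, map_smul, neg_smul]
    refine LinearMap.finrank_le_finrank_of_injective (f := S.restrict hmap) ?_
    intro x y hxy
    exact Subtype.ext (hS (congrArg Subtype.val hxy))
  have h1 := hle μ
  have h2 := hle (-μ)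
  rw [neg_neg] at h2
  have hinf : Module.End.eigenspace A μ ⊓ Module.End.eigenspace A (-μ) = ⊥ := by
    rw [eq_bot_iff]
    rintro x ⟨hx1, hx2⟩
    rw [SetLike.mem_coe, Module.End.mem_eigenspace_iff] at hx1 hx2
    rw [hx1, neg_smul, eq_neg_iff_add_eq_zero, ← two_smul ℂ, smul_smul] at hx2
    rw [Submodule.mem_bot]
    exact (smul_eq_zero.1 hx2).resolve_left (mul_ne_zero two_ne_zero hμ)
  have hsup : Module.End.eigenspace A μ ⊔ Module.End.eigenspace A (-μ) = ⊤ := by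
    rw [eq_top_iff]
    rintro x -
    refine Submodule.mem_sup.2 ⟨(2 * μ)⁻¹ • (A x + μ • x), ?_, -(2 * μ)⁻¹ • (A x - μ • x), ?_, ?_⟩
    · rw [Module.End.mem_eigenspace_iff, map_smul, map_add, map_smul, hA]
      module
    · rw [Module.End.mem_eigenspace_iff, map_smul, map_sub, map_smul, hA]
      module
    · have : (2 * μ)⁻¹ * μ * 2 = 1 := by field_simp
      calc _ = ((2 * μ)⁻¹ * μ * 2) • x := by module
        _ = x := by rw [this, one_smul]
  have h3 := Submodule.finrank_sup_add_finrank_inf_eq (Module.End.eigenspace A μ)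
    (Module.End.eigenspace A (-μ))
  rw [hinf, hsup, finrank_top, finrank_bot] at h3
  omega

end Eigenspaces

/-! ### The rational Hermitian space of a variety of Weil type -/

section Weil

variable {Λ W : Type*} [AddCommGroup Λ] [AddCommGroup W] [Module ℂ W]

theorem IsComplexTorus.finite {n : ℕ} {j : Λ →ₗ[ℤ] W} (hj : IsComplexTorus n j) :
    Module.Finite ℂ W := by
  obtain ⟨b, B, h⟩ := hj
  have := Module.Finite.of_basis B
  exact Module.Finite.of_restrictScalars_finite ℝ ℂ W

theorem IsComplexTorus.finrank {n : ℕ} {j : Λ →ₗ[ℤ] W} (hj : IsComplexTorus n j) :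
    Module.finrank ℂ W = n := by
  have := hj.finite
  obtain ⟨b, B, h⟩ := hj
  have h1 := finrank_real_of_complex W
  rw [Module.finrank_eq_card_basis B, Fintype.card_fin] at h1
  omega

variable {j : Λ →ₗ[ℤ] W} {E : Λ →ₗ[ℤ] Λ →ₗ[ℤ] ℚ} {ψ : Module.End ℤ Λ} {D : ℕ}

theorem IsPolarization.alt (h : IsPolarization j E) (x : Λ) : E x x = 0 := by
  obtain ⟨ER, h1, h2, -⟩ := h
  have := h1 x x
  rw [h2] at this
  exact_mod_cast this.symm

theorem IsPolarizedWeil.isHermSpace {g : ℕ} (h : IsPolarizedWeil g j E ψ D) :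
    IsHermSpace (ratForm E) (ψ.baseChange ℚ) D := by
  obtain ⟨b, -, -⟩ := h.torus
  exact isHermSpace_ratForm b h.pos h.polarization.alt h.sq h.preserves

/-- A real quadratic form that is negative at some real vector is negative at some rational
vector. -/
theorem exists_rat_form_neg {n : ℕ} (b : Module.Basis (Fin n) ℤ Λ) (B : Module.Basis (Fin n) ℝ W)
    (hB : ∀ i, B i = j (b i)) {Q : W →ₗ[ℝ] W →ₗ[ℝ] ℝ} {F : Λ →ₗ[ℤ] Λ →ₗ[ℤ] ℚ}
    (hQ : ∀ x y, Q (j x) (j y) = F x y) {w : W} (hw : Q w w < 0) :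
    ∃ x, ratForm F x x < 0 := by
  have hexp : ∀ c : Fin n → ℝ, Q (∑ i, c i • B i) (∑ i, c i • B i)
      = ∑ i, ∑ k, c i * (c k * F (b i) (b k)) := by
    intro c
    simp only [map_sum, map_smul, LinearMap.sum_apply, LinearMap.smul_apply, smul_eq_mul,
      Finset.mul_sum, hB, hQ]
    rw [Finset.sum_comm]
    refine Finset.sum_congr rfl fun i _ => Finset.sum_congr rfl fun k _ => ?_
    ring
  -- Negativity is an open condition on real coordinates, and rational coordinate vectors are dense.
  have hopen : IsOpen {c : Fin n → ℝ | ∑ i, ∑ k, c i * (c k * (F (b i) (b k) : ℝ)) < 0} :=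
    isOpen_lt (by fun_prop) continuous_const
  obtain ⟨q, hq⟩ := (DenseRange.piMap fun _ : Fin n => Rat.denseRange_cast (𝕜 := ℝ)).exists_mem_open
    hopen ⟨B.equivFun w, by
      rw [Set.mem_ofPred_eq, ← hexp, B.sum_equivFun]
      exact hw⟩
  refine ⟨∑ i, q i ⊗ₜ b i, ?_⟩
  have h2 : ratForm F (∑ i, q i ⊗ₜ b i) (∑ i, q i ⊗ₜ b i)
      = ∑ i, ∑ k, q i * (q k * F (b i) (b k)) := by
    simp only [map_sum, LinearMap.sum_apply, ratForm_tmul]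
    rw [Finset.sum_comm]
    refine Finset.sum_congr rfl fun i _ => Finset.sum_congr rfl fun k _ => ?_
    ring
  rw [h2]
  have hq' : ∑ i, ∑ k, (q i : ℝ) * (q k * (F (b i) (b k) : ℝ)) < 0 := hq
  exact_mod_cast hq'

end Weil


section Weil

variable {Λ W : Type*} [AddCommGroup Λ] [AddCommGroup W] [Module ℂ W]
variable {j : Λ →ₗ[ℤ] W} {E : Λ →ₗ[ℤ] Λ →ₗ[ℤ] ℚ} {ψ : Module.End ℤ Λ} {D : ℕ}

/-- On a vector with Aw = ±i√D w, the form E(w, Aw) equals ∓√D E(iw, w). Both eigenspaces are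
nonzero, so the polarization gives both signs over ℝ, hence over ℚ by density. -/
theorem IsPolarizedWeil.indefinite (h : IsPolarizedWeil 2 j E ψ D) :
    (∃ x, ratForm E x (ψ.baseChange ℚ x) < 0) ∧ ∃ x, 0 < ratForm E x (ψ.baseChange ℚ x) := by
  have hfin := h.torus.finite
  obtain ⟨b, B, hB⟩ := h.torus
  obtain ⟨ER, hER, halt, hI, hpos⟩ := h.polarization
  obtain ⟨A, hA, hp, hm⟩ := h.eigenspaces
  rw [finrank_eigenspace_dualMap] at hp hm
  have hs : 0 < Real.sqrt D := Real.sqrt_pos.2 (by exact_mod_cast h.pos)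
  have hskew : ∀ x y, ER x y = -ER y x := by
    intro x y
    have h := halt (x + y)
    simp only [map_add, LinearMap.add_apply, halt] at h
    linear_combination h
  let Q : W →ₗ[ℝ] W →ₗ[ℝ] ℝ := ER.compl₂ (A.restrictScalars ℝ)
  have hQ : ∀ x y, Q (j x) (j y) = ((E.compl₂ ψ) x y : ℚ) := by
    intro x y
    change ER (j x) (A (j y)) = (E x (ψ y) : ℚ)
    rw [hA, hER]
  have hQw : ∀ (c : ℝ) (w : W), A w = (c * Complex.I) • w → Q w w = -(c * ER (Complex.I • w) w) := by
    intro c w hw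
    change ER w (A w) = _
    have : A w = c • (Complex.I • w) := by
      rw [hw, mul_smul, Complex.coe_smul]
    rw [this, map_smul, hskew, smul_eq_mul]
    ring
  have hvec : ∀ μ : ℂ, Module.finrank ℂ (Module.End.eigenspace A μ) = 2 →
      ∃ w, w ≠ 0 ∧ A w = μ • w := by
    intro μ hμ
    have : Module.End.eigenspace A μ ≠ ⊥ := by
      intro hbot
      rw [hbot, finrank_bot] at hμ
      omega
    obtain ⟨w, hw, hw0⟩ := Submodule.exists_mem_ne_zero_of_ne_bot this
    exact ⟨w, hw0, Module.End.mem_eigenspace_iff.1 hw⟩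
  have hF : ∀ x, ratForm E x (ψ.baseChange ℚ x) = ratForm (E.compl₂ ψ) x x := by
    have : (ratForm E).compl₂ (ψ.baseChange ℚ) = ratForm (E.compl₂ ψ) := by
      refine LinearMap.ext_basis (b.baseChange ℚ) (b.baseChange ℚ) fun i k => ?_
      simp only [Module.Basis.baseChange_apply, LinearMap.compl₂_apply, LinearMap.baseChange_tmul,
        ratForm_tmul]
    intro x
    exact congrArg (fun G => G x x) this
  constructor
  · obtain ⟨w, hw0, hw⟩ := hvec _ hp
    have h1 := hQw (Real.sqrt D) w (by rw [hw, sqrtNeg, mul_comm])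
    have h2 : Q w w < 0 := by
      rw [h1]
      have := mul_pos hs (hpos w hw0)
      linarith
    obtain ⟨x, hx⟩ := exists_rat_form_neg b B hB hQ h2
    exact ⟨x, by rw [hF]; exact hx⟩
  · obtain ⟨w, hw0, hw⟩ := hvec _ hm
    have h1 := hQw (-Real.sqrt D) w (by rw [hw, sqrtNeg, mul_comm Complex.I]; push_cast; rw [neg_mul])
    have h2 : (-Q) w w < 0 := by
      rw [LinearMap.neg_apply, LinearMap.neg_apply, h1]
      have := mul_pos hs (hpos w hw0)
      linarith
    obtain ⟨x, hx⟩ := exists_rat_form_neg (Q := -Q) (F := -(E.compl₂ ψ)) b B hB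
      (fun x y => by simp [hQ]) h2
    refine ⟨x, ?_⟩
    rw [hF]
    have h3 : ratForm (-(E.compl₂ ψ)) = -ratForm (E.compl₂ ψ) := by
      refine LinearMap.ext_basis (b.baseChange ℚ) (b.baseChange ℚ) fun i k => ?_
      simp only [Module.Basis.baseChange_apply, LinearMap.neg_apply, ratForm_tmul]
      ring
    rw [h3] at hx
    simpa using hx

/-- The Hermitian space of an abelian fourfold of Weil type of determinant one is hyperbolic. -/
theorem IsPolarizedWeil.exists_hyperbolic_basis (h : IsPolarizedWeil 2 j E ψ D)
    (hdet : HasDet 2 E ψ D 1) {ρ : ℚ} (hρ : ρ ≠ 0) :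
    ∃ u : Fin 4 → ℚ ⊗[ℤ] Λ, (∀ i l, ratForm E (u i) (u l) = 0) ∧
      ∀ i l, ρ * ratForm E (u i) (ψ.baseChange ℚ (u l))
        = if i = l then (![1, 1, -1, -1] : Fin 4 → ℚ) i else 0 := by
  obtain ⟨b, -, -⟩ := h.torus
  obtain ⟨e, he, z, hz, hdet⟩ := hdet
  have hE := h.isHermSpace
  have hfin : Module.finrank ℚ (ℚ ⊗[ℤ] Λ) = 8 := by
    rw [Module.finrank_eq_card_basis (b.baseChange ℚ), Fintype.card_fin]
  have hf : Module.Finite ℚ (ℚ ⊗[ℤ] Λ) := Module.Finite.of_basis (b.baseChange ℚ)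
  have hc : ((D : ℝ)) = ((D : ℚ) : ℝ) := (Rat.cast_natCast D).symm
  obtain ⟨p, q, hpq⟩ : ∃ p q : ℚ, (z : ℂ) = p + q * sqrtNeg ((D : ℚ) : ℝ) :=
    (mem_quadField_iff hE.pos_rat).1 (by rw [← hc]; exact z.2)
  have hnorm : Algebra.norm ℚ z = p ^ 2 + D * q ^ 2 := by
    clear hdet
    revert z
    rw [hc]
    intro z _ hz
    exact norm_quadField hE.pos_rat z hz
  refine hE.exists_hyperbolic_basis hfin (e := fun i => 1 ⊗ₜ e i) (p := p) (q := q) ?_ ?_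
    h.indefinite.1 h.indefinite.2 hρ
  · have h1 : ∀ x y, herm (ratForm E) (ψ.baseChange ℚ) D (1 ⊗ₜ x) (1 ⊗ₜ y) = hermForm E ψ D x y := by
      intro x y
      simp [herm, hermForm, ratForm_tmul, LinearMap.baseChange_tmul]
    simp only [h1]
    refine hdet.trans ?_
    rw [hnorm, one_mul]
  · intro h0
    have h1 := mul_nonneg hE.pos_rat.le (sq_nonneg q)
    have hp : p = 0 := by
      have : p ^ 2 = 0 := le_antisymm (by linarith) (sq_nonneg p)
      simpa using this
    have hq : q = 0 := by
      subst hp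
      simpa [hE.pos.ne'] using h0
    exact hz (Subtype.ext (by rw [hpq, hp, hq]; simp))

end Weil

/-! ### Isometries of hyperbolic spaces and the underlying lattice maps -/

section Isogeny

variable {X X' : Type*} [AddCommGroup X] [Module ℚ X] [AddCommGroup X'] [Module ℚ X']
  {E : X →ₗ[ℚ] X →ₗ[ℚ] ℚ} {J : X →ₗ[ℚ] X} {D : ℕ} {E' : X' →ₗ[ℚ] X' →ₗ[ℚ] ℚ} {J' : X' →ₗ[ℚ] X'}
  {D' : ℕ}

/-- Two hyperbolic Hermitian spaces are isometric. -/
theorem exists_isometry [Module.Finite ℚ X] (hE : IsHermSpace E J D) (hE' : IsHermSpace E' J' D')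
    (hfin : Module.finrank ℚ X = 8) {κ : ℚ} (hκ : (D : ℚ) = κ ^ 2 * D') {ε : Fin 4 → ℚ}
    (hε : ∀ i, ε i ≠ 0)
    {u : Fin 4 → X} (hu : ∀ i l, E (u i) (u l) = 0)
    (huJ : ∀ i l, E (u i) (J (u l)) = if i = l then ε i else 0)
    {u' : Fin 4 → X'} (hu' : ∀ i l, E' (u' i) (u' l) = 0)
    (huJ' : ∀ i l, κ * E' (u' i) (J' (u' l)) = if i = l then ε i else 0) :
    ∃ F : X →ₗ[ℚ] X', (∀ x y, E' (F x) (F y) = E x y) ∧ ∀ x, F (J x) = κ • J' (F x) := by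
  have hli : LinearIndependent ℚ (Sum.elim u fun i => J (u i)) := by
    refine hE.linearIndependent_of_isOrthFamily ⟨fun i l hil => ?_, fun i => ?_⟩
    · exact hE.herm_eq_zero_iff.2 ⟨by rw [huJ, if_neg hil], hu i l⟩
    · rw [huJ, if_pos rfl]; exact hε i
  let b := basisOfLinearIndependentOfCardEqFinrank hli (by simp [hfin])
  have hb : ⇑b = Sum.elim u fun i => J (u i) := coe_basisOfLinearIndependentOfCardEqFinrank _ _
  let F := b.constr ℚ (Sum.elim u' fun i => κ • J' (u' i))
  have hF : ∀ i, F (u i) = u' i := fun i => by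
    have := b.constr_basis ℚ (Sum.elim u' fun i => κ • J' (u' i)) (Sum.inl i)
    rw [hb] at this
    exact this
  have hFJ : ∀ i, F (J (u i)) = κ • J' (u' i) := fun i => by
    have := b.constr_basis ℚ (Sum.elim u' fun i => κ • J' (u' i)) (Sum.inr i)
    rw [hb] at this
    exact this
  refine ⟨F, fun x y => ?_, fun x => ?_⟩
  · have h : E'.compl₁₂ F F = E := by
      refine LinearMap.ext_basis b b fun i k => ?_
      rw [hb]
      rcases i with i | i <;> rcases k with k | k <;>
        simp only [Sum.elim_inl, Sum.elim_inr, LinearMap.compl₁₂_apply, hF, hFJ, map_smul,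
          LinearMap.smul_apply, smul_eq_mul, hE.apply_J, hE'.apply_J, hE.sq, hE'.sq, map_neg, hu, hu',
          huJ, ← huJ']
      · ring
      · ring
    exact congrArg (fun G => G x y) h
  · have h : F ∘ₗ J = κ • (J' ∘ₗ F) := by
      refine b.ext fun i => ?_
      rw [hb]
      rcases i with i | i
      · simp only [Sum.elim_inl, LinearMap.comp_apply, LinearMap.smul_apply, hF, hFJ]
      · simp only [Sum.elim_inr, LinearMap.comp_apply, LinearMap.smul_apply, hF, hFJ, hE.sq, hE'.sq,
          map_neg, map_smul, hκ]
        module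
    exact congrArg (fun G => G x) h

variable {Λ W Λ' W' : Type*} [AddCommGroup Λ] [AddCommGroup W] [Module ℂ W] [AddCommGroup Λ']
  [AddCommGroup W'] [Module ℂ W']
  {j : Λ →ₗ[ℤ] W} {E : Λ →ₗ[ℤ] Λ →ₗ[ℤ] ℚ} {ψ : Module.End ℤ Λ} {D : ℕ}
  {j' : Λ' →ₗ[ℤ] W'} {E' : Λ' →ₗ[ℤ] Λ' →ₗ[ℤ] ℚ} {φ : Module.End ℤ Λ'} {D' : ℕ}

/-- The polarized Hodge-free part of an isogeny between fourfolds of Weil type with the same field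
and determinant one. -/
theorem IsPolarizedWeil.exists_lattice_map (h : IsPolarizedWeil 2 j E ψ D)
    (hdet : HasDet 2 E ψ D 1) (h' : IsPolarizedWeil 2 j' E' φ D') (hdet' : HasDet 2 E' φ D' 1)
    (hK : quadField D = quadField D') :
    ∃ f : Λ →ₗ[ℤ] Λ',
      (∃ a b : ℕ, 0 < a ∧ 0 < b ∧ a ^ 2 * D = b ^ 2 * D' ∧ ∀ x, a • f (ψ x) = b • φ (f x)) ∧
      ∃ n : ℕ, 0 < n ∧ ∀ x y, E' (f x) (f y) = (n : ℚ) ^ 2 * E x y := by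
  have hE := h.isHermSpace
  have hE' := h'.isHermSpace
  -- Equality of the fields gives √D = κ√D'. Thus ψ must correspond to κφ, and the hyperbolic basis
  -- on the second side is normalized for κφ by taking ρ = κ.
  obtain ⟨κ, hκ, hκD⟩ := exists_sq_mul_eq_of_quadField_eq hE'.pos_rat hE.pos_rat
    (by rw [Rat.cast_natCast, Rat.cast_natCast]; exact hK)
  obtain ⟨u, hu, huJ⟩ := h.exists_hyperbolic_basis hdet one_ne_zero
  obtain ⟨u', hu', huJ'⟩ := h'.exists_hyperbolic_basis hdet' hκ.ne'
  obtain ⟨b, -, -⟩ := h.torus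
  obtain ⟨b', -, -⟩ := h'.torus
  have hfin : Module.finrank ℚ (ℚ ⊗[ℤ] Λ) = 8 := by
    rw [Module.finrank_eq_card_basis (b.baseChange ℚ), Fintype.card_fin]
  have hf : Module.Finite ℚ (ℚ ⊗[ℤ] Λ) := Module.Finite.of_basis (b.baseChange ℚ)
  obtain ⟨F, hF, hFJ⟩ := exists_isometry hE hE' hfin hκD
    (ε := ![1, 1, -1, -1]) (by intro i; fin_cases i <;> simp) hu (fun i l => by
      rw [← huJ, one_mul]) hu' huJ'
  obtain ⟨N, f, hN, hf⟩ := exists_integral_map b F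
  -- The integers a and b are the denominator and numerator of κ; n is the common denominator that
  -- makes the rational isometry integral.
  refine ⟨f, ⟨κ.den, κ.num.toNat, κ.den_pos, ?_, ?_, fun x => ?_⟩, N, hN, fun x y => ?_⟩
  · have := Rat.num_pos.2 hκ
    omega
  · have hnum : ((κ.num.toNat : ℕ) : ℚ) = κ * κ.den := by
      rw [Rat.mul_den_eq_num]
      exact_mod_cast Int.toNat_of_nonneg (Rat.num_pos.2 hκ).le
    have : ((κ.den ^ 2 * D : ℕ) : ℚ) = ((κ.num.toNat ^ 2 * D' : ℕ) : ℚ) := by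
      push_cast
      rw [hnum, hκD]
      ring
    exact_mod_cast this
  · have hnum : ((κ.num.toNat : ℕ) : ℚ) = κ * κ.den := by
      rw [Rat.mul_den_eq_num]
      exact_mod_cast Int.toNat_of_nonneg (Rat.num_pos.2 hκ).le
    refine one_tmul_injective b' ?_
    have e : ∀ (n : ℕ) (z : Λ'), (1 : ℚ) ⊗ₜ[ℤ] (n • z) = (n : ℚ) • ((1 : ℚ) ⊗ₜ[ℤ] z) := by
      intro n z
      rw [← natCast_zsmul, ← TensorProduct.smul_tmul, TensorProduct.smul_tmul']
      simp
    change (1 : ℚ) ⊗ₜ[ℤ] (κ.den • f (ψ x)) = (1 : ℚ) ⊗ₜ[ℤ] (κ.num.toNat • φ (f x))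
    rw [e, e, hf, ← LinearMap.baseChange_tmul (A := ℚ) φ, hf, map_smul, hnum,
      ← LinearMap.baseChange_tmul (A := ℚ) ψ, hFJ]
    module
  · have h1 := ratForm_tmul E' 1 1 (f x) (f y)
    rw [hf, hf, map_smul, map_smul, LinearMap.smul_apply, hF, ratForm_tmul] at h1
    simp only [smul_eq_mul, one_mul, mul_one] at h1
    rw [← h1]
    ring

end Isogeny


/-! ### The Clifford action on V ⊕ V^∨ in coordinates -/

section Coordinates

/-- Coordinates of the vectors of `V_ℂ ⊕ V_ℂ^∨`. -/
abbrev TCoord : Type := (Fin 4 → ℂ) × (Fin 4 → ℂ)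

/-- Coordinates of the vectors of `⋀² V_ℂ ⊕ ℂ`, in the order `12, 13, 14, 23, 24, 34`. -/
abbrev KCoord : Type := (Fin 6 → ℂ) × ℂ

/-- Contraction of a covector with a bivector. -/
def contract (a : Fin 6 → ℂ) (k : Fin 4 → ℂ) : Fin 4 → ℂ :=
  ![a 0 * k 1 + a 1 * k 2 + a 2 * k 3, -(a 0 * k 0) + a 3 * k 2 + a 4 * k 3,
    -(a 1 * k 0) - a 3 * k 1 + a 5 * k 3, -(a 2 * k 0) - a 4 * k 1 - a 5 * k 2]

/-- The coordinates of a bivector, considered as an alternating form on `V_ℂ`. -/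
def hodgeStar (a : Fin 6 → ℂ) : Fin 6 → ℂ := ![a 5, -a 4, a 3, a 2, -a 1, a 0]

/-- Real parameters of the family of tori in an adapted real basis of `V_ℝ`, in which
`ι h₀ = lam (e₁ ∧ e₂ + e₃ ∧ e₄)` and `h (0, 1) = s`. -/
structure Model where
  /-- the integer `ϑ₁` -/
  t₁ : ℝ
  /-- the integer `ϑ₂` -/
  t₂ : ℝ
  /-- the integer `ϑ₃` -/
  t₃ : ℝ
  /-- the number `m` -/
  m : ℝ
  /-- half of the square of `ι h₀` is `lam ^ 2` -/
  lam : ℝ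
  /-- the value of `h` at `ζ` -/
  s : ℝ
  m_pos : 0 < m
  lam_pos : 0 < lam
  t₃_ne : t₃ ≠ 0
  t_mul : t₁ * t₂ = 2 * m * t₃ ^ 2
  sq_pos : 0 < 2 * lam ^ 2 - s ^ 2 / m

namespace Model

variable (μ : Model)

/-- The Clifford action of `⋀² V_ℂ ⊕ ℂ` on `V_ℂ ⊕ V_ℂ^∨`. -/
def clifford : KCoord →ₗ[ℂ] TCoord →ₗ[ℂ] TCoord :=
  LinearMap.mk₂ ℂ (fun σ t =>
    (fun i => -(μ.m * μ.t₃ * σ.2) * t.1 i + μ.t₂ * contract σ.1 t.2 i,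
      fun i => μ.t₁ * contract (hodgeStar σ.1) t.1 i + μ.m * μ.t₃ * σ.2 * t.2 i))
    (fun a b t => by
      refine Prod.ext ?_ ?_ <;> ext i <;> fin_cases i <;> simp [contract, hodgeStar] <;> ring)
    (fun r a t => by
      refine Prod.ext ?_ ?_ <;> ext i <;> fin_cases i <;> simp [contract, hodgeStar] <;> ring)
    (fun a b t => by
      refine Prod.ext ?_ ?_ <;> ext i <;> fin_cases i <;> simp [contract, hodgeStar] <;> ring)
    (fun r a t => by
      refine Prod.ext ?_ ?_ <;> ext i <;> fin_cases i <;> simp [contract, hodgeStar] <;> ring)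

/-- The quadratic form `vol (α ∧ β) - m x y`. -/
def quad : KCoord →ₗ[ℂ] KCoord →ₗ[ℂ] ℂ :=
  LinearMap.mk₂ ℂ (fun σ τ => σ.1 0 * τ.1 5 + σ.1 5 * τ.1 0 - σ.1 1 * τ.1 4 - σ.1 4 * τ.1 1
      + σ.1 2 * τ.1 3 + σ.1 3 * τ.1 2 - μ.m * σ.2 * τ.2)
    (fun a b t => by simp; ring) (fun r a t => by simp; ring)
    (fun a b t => by simp; ring) (fun r a t => by simp; ring)

/-- The natural pairing of `V_ℂ ⊕ V_ℂ^∨` with itself. -/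
def _root_.WeilTori.pairing : TCoord →ₗ[ℂ] TCoord →ₗ[ℂ] ℂ :=
  LinearMap.mk₂ ℂ (fun x y => ∑ i, (x.2 i * y.1 i + y.2 i * x.1 i))
    (fun a b t => by simp [Fin.sum_univ_four]; ring) (fun r a t => by simp [Fin.sum_univ_four]; ring)
    (fun a b t => by simp [Fin.sum_univ_four]; ring) (fun r a t => by simp [Fin.sum_univ_four]; ring)

/-- The vector of `⋀² V_ℂ ⊕ ℂ` that corresponds to `h`. -/
def ell : KCoord := (![μ.lam, 0, 0, 0, 0, μ.lam], -(μ.s / μ.m : ℝ))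

theorem clifford_apply (σ : KCoord) (t : TCoord) : μ.clifford σ t =
    (fun i => -(μ.m * μ.t₃ * σ.2) * t.1 i + μ.t₂ * contract σ.1 t.2 i,
      fun i => μ.t₁ * contract (hodgeStar σ.1) t.1 i + μ.m * μ.t₃ * σ.2 * t.2 i) := rfl

theorem quad_apply (σ τ : KCoord) : μ.quad σ τ = σ.1 0 * τ.1 5 + σ.1 5 * τ.1 0 - σ.1 1 * τ.1 4
    - σ.1 4 * τ.1 1 + σ.1 2 * τ.1 3 + σ.1 3 * τ.1 2 - μ.m * σ.2 * τ.2 := rfl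

theorem _root_.WeilTori.pairing_apply (x y : TCoord) :
    pairing x y = ∑ i, (x.2 i * y.1 i + y.2 i * x.1 i) := rfl

theorem t_mul' : (μ.t₁ : ℂ) * μ.t₂ = 2 * μ.m * (μ.t₃ : ℂ) ^ 2 := by exact_mod_cast μ.t_mul

/-- Contracting twice with a bivector α gives its Pfaffian, half of (α, α), times -1. The bivector
part therefore contributes with the factor ϑ₁ϑ₂ and the scalar part with m²ϑ₃²; the relation `t_mul`
makes the two proportional to the same quadratic form. -/
theorem clifford_clifford_add (σ τ : KCoord) (t : TCoord) :
    μ.clifford σ (μ.clifford τ t) + μ.clifford τ (μ.clifford σ t)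
      = (-(2 * (μ.m * μ.t₃ ^ 2 : ℝ) * μ.quad σ τ : ℂ)) • t := by
  have h := μ.t_mul'
  refine Prod.ext ?_ ?_ <;> ext i <;> fin_cases i <;>
    simp [clifford_apply, quad_apply, contract, hodgeStar]
  · linear_combination (-(σ.1 0 * τ.1 5 + σ.1 5 * τ.1 0 - σ.1 1 * τ.1 4 - σ.1 4 * τ.1 1
      + σ.1 2 * τ.1 3 + σ.1 3 * τ.1 2) * t.1 0) * h
  · linear_combination (-(σ.1 0 * τ.1 5 + σ.1 5 * τ.1 0 - σ.1 1 * τ.1 4 - σ.1 4 * τ.1 1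
      + σ.1 2 * τ.1 3 + σ.1 3 * τ.1 2) * t.1 1) * h
  · linear_combination (-(σ.1 0 * τ.1 5 + σ.1 5 * τ.1 0 - σ.1 1 * τ.1 4 - σ.1 4 * τ.1 1
      + σ.1 2 * τ.1 3 + σ.1 3 * τ.1 2) * t.1 2) * h
  · linear_combination (-(σ.1 0 * τ.1 5 + σ.1 5 * τ.1 0 - σ.1 1 * τ.1 4 - σ.1 4 * τ.1 1
      + σ.1 2 * τ.1 3 + σ.1 3 * τ.1 2) * t.1 3) * h
  · linear_combination (-(σ.1 0 * τ.1 5 + σ.1 5 * τ.1 0 - σ.1 1 * τ.1 4 - σ.1 4 * τ.1 1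
      + σ.1 2 * τ.1 3 + σ.1 3 * τ.1 2) * t.2 0) * h
  · linear_combination (-(σ.1 0 * τ.1 5 + σ.1 5 * τ.1 0 - σ.1 1 * τ.1 4 - σ.1 4 * τ.1 1
      + σ.1 2 * τ.1 3 + σ.1 3 * τ.1 2) * t.2 1) * h
  · linear_combination (-(σ.1 0 * τ.1 5 + σ.1 5 * τ.1 0 - σ.1 1 * τ.1 4 - σ.1 4 * τ.1 1
      + σ.1 2 * τ.1 3 + σ.1 3 * τ.1 2) * t.2 2) * h
  · linear_combination (-(σ.1 0 * τ.1 5 + σ.1 5 * τ.1 0 - σ.1 1 * τ.1 4 - σ.1 4 * τ.1 1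
      + σ.1 2 * τ.1 3 + σ.1 3 * τ.1 2) * t.2 3) * h

theorem quad_symm (σ τ : KCoord) : μ.quad σ τ = μ.quad τ σ := by
  rw [quad_apply, quad_apply]; ring

theorem _root_.WeilTori.pairing_symm (x y : TCoord) : pairing x y = pairing y x := by
  rw [pairing_apply, pairing_apply]
  exact Finset.sum_congr rfl fun i _ => add_comm _ _

/-- Contraction with a bivector is skew, and the scalar part acts with opposite signs on V and V^∨.
-/
theorem pairing_clifford (σ : KCoord) (x y : TCoord) :
    pairing (μ.clifford σ x) y = -pairing x (μ.clifford σ y) := by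
  simp [pairing_apply, clifford_apply, contract, hodgeStar, Fin.sum_univ_four]
  ring

theorem _root_.WeilTori.eq_zero_of_pairing {x : TCoord} (h : ∀ y, pairing x y = 0) : x = 0 := by
  refine Prod.ext ?_ ?_ <;> ext i
  · simpa [pairing_apply, Pi.single_apply] using h (0, Pi.single i 1)
  · simpa [pairing_apply, Pi.single_apply] using h (Pi.single i 1, 0)

theorem eq_zero_of_quad {σ : KCoord} (h : ∀ τ, μ.quad σ τ = 0) : σ = 0 := by
  have hm : (μ.m : ℂ) ≠ 0 := by exact_mod_cast μ.m_pos.ne'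
  refine Prod.ext ?_ ?_
  · ext i
    fin_cases i
    · simpa [quad_apply] using h (Pi.single 5 1, 0)
    · simpa [quad_apply] using h (Pi.single 4 1, 0)
    · simpa [quad_apply] using h (Pi.single 3 1, 0)
    · simpa [quad_apply] using h (Pi.single 2 1, 0)
    · simpa [quad_apply] using h (Pi.single 1 1, 0)
    · simpa [quad_apply] using h (Pi.single 0 1, 0)
  · simpa [quad_apply, hm] using h (0, 1)

theorem star_clifford (σ : KCoord) (t : TCoord) :
    star (μ.clifford σ t) = μ.clifford (star σ) (star t) := by
  refine Prod.ext ?_ ?_ <;> ext i <;> fin_cases i <;>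
    simp [clifford_apply, contract, hodgeStar]

theorem star_quad (σ τ : KCoord) : star (μ.quad σ τ) = μ.quad (star σ) (star τ) := by
  simp [quad_apply]

theorem _root_.WeilTori.star_pairing (x y : TCoord) : star (pairing x y) = pairing (star x) (star y) := by
  simp [pairing_apply]

theorem star_ell : star μ.ell = μ.ell := by
  refine Prod.ext ?_ ?_
  · ext i
    fin_cases i <;> simp [ell]
  · simp [ell]

theorem quad_ell_ell : μ.quad μ.ell μ.ell = ((2 * μ.lam ^ 2 - μ.s ^ 2 / μ.m : ℝ) : ℂ) := by
  have hm : (μ.m : ℂ) ≠ 0 := by exact_mod_cast μ.m_pos.ne'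
  simp [quad_apply, ell]
  field_simp
  ring

theorem quad_ell (σ : KCoord) : μ.quad μ.ell σ = μ.lam * (σ.1 0 + σ.1 5) + μ.s * σ.2 := by
  have hm : (μ.m : ℂ) ≠ 0 := by exact_mod_cast μ.m_pos.ne'
  simp [quad_apply, ell]
  field_simp
  ring

end Model

end Coordinates


theorem two_mul_finrank_inf_eigenspace {W : Type*} [AddCommGroup W] [Module ℂ W]
    [FiniteDimensional ℂ W] {A S : Module.End ℂ W} {ν : ℂ} (hν : ν ≠ 0)
    (hA : ∀ x, A (A x) = (ν * ν) • x) (hS : Function.Injective S) (hAS : ∀ x, A (S x) = -S (A x))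
    {p : Submodule ℂ W} (hAp : ∀ x ∈ p, A x ∈ p) (hSp : ∀ x ∈ p, S x ∈ p) :
    2 * Module.finrank ℂ (p ⊓ Module.End.eigenspace A ν : Submodule ℂ W) = Module.finrank ℂ p ∧
      2 * Module.finrank ℂ (p ⊓ Module.End.eigenspace A (-ν) : Submodule ℂ W)
        = Module.finrank ℂ p := by
  have key : ∀ κ : ℂ, Module.finrank ℂ (p ⊓ Module.End.eigenspace A κ : Submodule ℂ W)
      = Module.finrank ℂ (Module.End.eigenspace (A.restrict hAp) κ) := by
    intro κ
    rw [(Submodule.equivMapOfInjective p.subtype p.injective_subtype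
      (Module.End.eigenspace (A.restrict hAp) κ)).finrank_eq]
    suffices h : p ⊓ Module.End.eigenspace A κ
        = (Module.End.eigenspace (A.restrict hAp) κ).map p.subtype by rw [h]
    ext x
    simp only [Submodule.mem_inf, Submodule.mem_map, Module.End.mem_eigenspace_iff,
      Submodule.subtype_apply]
    constructor
    · rintro ⟨hx, h⟩
      exact ⟨⟨x, hx⟩, Subtype.ext h, rfl⟩
    · rintro ⟨y, hy, rfl⟩
      exact ⟨y.2, congrArg Subtype.val hy⟩
  rw [key, key]
  refine two_mul_finrank_eigenspace (A := A.restrict hAp) (S := S.restrict hSp) hν ?_ ?_ ?_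
  · intro x
    exact Subtype.ext (hA x)
  · intro x y hxy
    exact Subtype.ext (hS (congrArg Subtype.val hxy))
  · intro x
    exact Subtype.ext (hAS x)

/-! ### Kernels of Clifford multiplication and the eigenspaces of φ -/

namespace Model

variable (μ : Model)

/-- The constant `m ϑ₃ ^ 2`. -/
def c : ℝ := μ.m * μ.t₃ ^ 2

theorem c_pos : 0 < μ.c := mul_pos μ.m_pos (by have := μ.t₃_ne; positivity)

/-- The discriminant `m ϑ₃ ^ 2 (h, h)`. -/
def disc : ℝ := μ.c * (2 * μ.lam ^ 2 - μ.s ^ 2 / μ.m)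

theorem disc_pos : 0 < μ.disc := mul_pos μ.c_pos μ.sq_pos

/-- The square root of `-disc` defined by the vector `ell`. -/
def phi : TCoord →ₗ[ℂ] TCoord := μ.clifford μ.ell

/-- The alternating form defined by `ell`. -/
def alt (x y : TCoord) : ℂ := pairing x (μ.phi y)

/-- Half of the Hermitian form defined by `alt`. -/
def posForm (u : TCoord) : ℝ := (μ.alt u (star u)).im

/-- The kernel of the Clifford multiplication by `σ`. -/
def ker (σ : KCoord) : Submodule ℂ TCoord := LinearMap.ker (μ.clifford σ)

/-- The period domain in coordinates. -/
structure IsPeriod (σ : KCoord) : Prop where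
  isotropic : μ.quad σ σ = 0
  pos : 0 < (μ.quad σ (star σ)).re
  perp : μ.quad μ.ell σ = 0

variable {μ}

theorem mem_ker {σ : KCoord} {t : TCoord} : t ∈ μ.ker σ ↔ μ.clifford σ t = 0 := Iff.rfl

theorem clifford_add (σ τ : KCoord) (t : TCoord) :
    μ.clifford σ (μ.clifford τ t) + μ.clifford τ (μ.clifford σ t)
      = (-(2 * μ.c * μ.quad σ τ : ℂ)) • t := μ.clifford_clifford_add σ τ t

theorem clifford_swap {σ τ : KCoord} (h : μ.quad σ τ = 0) (t : TCoord) :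
    μ.clifford σ (μ.clifford τ t) = -μ.clifford τ (μ.clifford σ t) := by
  have := clifford_add (μ := μ) σ τ t
  rw [h, mul_zero, neg_zero, zero_smul] at this
  exact eq_neg_of_add_eq_zero_left this

theorem clifford_clifford_self (σ : KCoord) (t : TCoord) :
    μ.clifford σ (μ.clifford σ t) = (-(μ.c * μ.quad σ σ : ℂ)) • t := by
  have := clifford_add (μ := μ) σ σ t
  rw [← two_smul ℂ] at this
  have h2 := congrArg (fun z => (2⁻¹ : ℂ) • z) this
  simp only [smul_smul] at h2
  norm_num at h2
  rw [h2, ← neg_smul]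
  congr 1
  ring

theorem c_ne : (μ.c : ℂ) ≠ 0 := by exact_mod_cast μ.c_pos.ne'

theorem quad_ell_ell' : (μ.c : ℂ) * μ.quad μ.ell μ.ell = μ.disc := by
  rw [quad_ell_ell, disc]; push_cast; ring

theorem phi_phi (t : TCoord) : μ.phi (μ.phi t) = (-(μ.disc : ℂ)) • t := by
  rw [phi, clifford_clifford_self, quad_ell_ell']

theorem phi_phi' (t : TCoord) : μ.phi (μ.phi t) = (sqrtNeg μ.disc * sqrtNeg μ.disc) • t := by
  rw [phi_phi, sqrtNeg_mul_self μ.disc_pos.le]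

theorem clifford_injective {σ : KCoord} (h : μ.quad σ σ ≠ 0) :
    Function.Injective (μ.clifford σ) := by
  rw [← LinearMap.ker_eq_bot, LinearMap.ker_eq_bot']
  intro t ht
  have := clifford_clifford_self (μ := μ) σ t
  rw [ht, map_zero, eq_comm, smul_eq_zero] at this
  exact this.resolve_left (neg_ne_zero.2 (mul_ne_zero c_ne h))

theorem eq_zero_of_mem_ker {σ τ : KCoord} (h : μ.quad σ τ ≠ 0) {t : TCoord}
    (h1 : t ∈ μ.ker σ) (h2 : t ∈ μ.ker τ) : t = 0 := by
  have := clifford_add (μ := μ) σ τ t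
  rw [mem_ker.1 h1, mem_ker.1 h2, map_zero, map_zero, add_zero, eq_comm, smul_eq_zero] at this
  exact this.resolve_left (neg_ne_zero.2 (mul_ne_zero (mul_ne_zero two_ne_zero c_ne) h))

theorem exists_quad_ne {σ : KCoord} (h : σ ≠ 0) : ∃ τ, μ.quad σ τ ≠ 0 := by
  by_contra! hc
  exact h (μ.eq_zero_of_quad hc)

/-- For isotropic σ one has σ·σ = 0. Some τ makes στ + τσ a nonzero scalar, so τ is, up to that
scalar, a contracting homotopy. -/
theorem range_clifford {σ : KCoord} (h0 : σ ≠ 0) (h : μ.quad σ σ = 0) :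
    LinearMap.range (μ.clifford σ) = μ.ker σ := by
  apply le_antisymm
  · rintro _ ⟨t, rfl⟩
    rw [mem_ker, clifford_clifford_self, h, mul_zero, neg_zero, zero_smul]
  · intro t ht
    obtain ⟨τ, hτ⟩ := exists_quad_ne (μ := μ) h0
    have := clifford_add (μ := μ) σ τ t
    rw [mem_ker.1 ht, map_zero, add_zero] at this
    refine ⟨(-(2 * μ.c * μ.quad σ τ : ℂ))⁻¹ • μ.clifford τ t, ?_⟩
    rw [map_smul, this, smul_smul, inv_mul_cancel₀, one_smul]
    exact neg_ne_zero.2 (mul_ne_zero (mul_ne_zero two_ne_zero c_ne) hτ)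

theorem _root_.WeilTori.finrank_tCoord : Module.finrank ℂ TCoord = 8 := by
  simp

theorem finrank_ker {σ : KCoord} (h0 : σ ≠ 0) (h : μ.quad σ σ = 0) :
    Module.finrank ℂ (μ.ker σ) = 4 := by
  have := LinearMap.finrank_range_add_finrank_ker (μ.clifford σ)
  rw [range_clifford h0 h, finrank_tCoord] at this
  change _ + Module.finrank ℂ (μ.ker σ) = 8 at this
  omega

/-- The kernel of σ is also its image, and σ is skew-adjoint. Applied to x and φy this becomes the
first Riemann relation. -/
theorem pairing_eq_zero {σ : KCoord} (h0 : σ ≠ 0) (h : μ.quad σ σ = 0) {x y : TCoord}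
    (hx : x ∈ μ.ker σ) (hy : y ∈ μ.ker σ) : pairing x y = 0 := by
  rw [← range_clifford h0 h] at hx
  obtain ⟨x, rfl⟩ := hx
  rw [pairing_clifford, mem_ker.1 hy, map_zero, neg_zero]

theorem clifford_mem_ker {σ τ : KCoord} (h : μ.quad τ σ = 0) {x : TCoord} (hx : x ∈ μ.ker σ) :
    μ.clifford τ x ∈ μ.ker σ := by
  rw [mem_ker, clifford_swap (by rwa [quad_symm]), mem_ker.1 hx, map_zero, neg_zero]

theorem star_mem_ker {σ : KCoord} {x : TCoord} (hx : x ∈ μ.ker σ) : star x ∈ μ.ker (star σ) := by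
  rw [mem_ker, ← star_clifford, mem_ker.1 hx, star_zero]

theorem IsPeriod.ne_zero {σ : KCoord} (h : μ.IsPeriod σ) : σ ≠ 0 := by
  rintro rfl
  simpa using h.pos

theorem IsPeriod.phi_mem {σ : KCoord} (h : μ.IsPeriod σ) {x : TCoord} (hx : x ∈ μ.ker σ) :
    μ.phi x ∈ μ.ker σ := clifford_mem_ker h.perp hx

theorem IsPeriod.alt_eq_zero {σ : KCoord} (h : μ.IsPeriod σ) {x y : TCoord}
    (hx : x ∈ μ.ker σ) (hy : y ∈ μ.ker σ) : μ.alt x y = 0 :=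
  pairing_eq_zero h.ne_zero h.isotropic hx (h.phi_mem hy)

theorem alt_add_left (x y z : TCoord) : μ.alt (x + y) z = μ.alt x z + μ.alt y z := by simp [alt]
theorem alt_add_right (x y z : TCoord) : μ.alt x (y + z) = μ.alt x y + μ.alt x z := by simp [alt]
theorem alt_smul_left (r : ℂ) (x y : TCoord) : μ.alt (r • x) y = r * μ.alt x y := by simp [alt]
theorem alt_smul_right (r : ℂ) (x y : TCoord) : μ.alt x (r • y) = r * μ.alt x y := by simp [alt]

theorem alt_neg (x y : TCoord) : μ.alt x y = -μ.alt y x := by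
  rw [alt, alt, phi, pairing_symm, pairing_clifford]

theorem alt_phi (x y : TCoord) : μ.alt (μ.phi x) (μ.phi y) = μ.disc * μ.alt x y := by
  rw [alt, alt, phi_phi, map_smul, phi, pairing_clifford, smul_eq_mul]
  ring

theorem alt_clifford {τ : KCoord} (h : μ.quad τ μ.ell = 0) (x y : TCoord) :
    μ.alt (μ.clifford τ x) (μ.clifford τ y) = -(μ.c * μ.quad τ τ) * μ.alt x y := by
  rw [alt, alt, phi, pairing_clifford, clifford_swap h, map_neg,
    clifford_clifford_self, map_smul, map_smul, smul_eq_mul, neg_neg]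

theorem star_alt (x y : TCoord) : star (μ.alt x y) = μ.alt (star x) (star y) := by
  rw [alt, alt, star_pairing, phi, star_clifford, star_ell]

theorem alt_self_star (u : TCoord) : μ.alt u (star u) = μ.posForm u * Complex.I := by
  have h1 := star_alt (μ := μ) u (star u)
  rw [star_star, alt_neg (star u)] at h1
  have h2 := congrArg Complex.re h1
  apply Complex.ext
  · simp at h2
    simp
    linarith
  · simp [posForm]

/-- A real vector of positive square orthogonal to ℓ reverses the sign of the Hermitian form. This
later excludes a negative value of (σ, σ̄). -/
theorem posForm_clifford {τ : KCoord} (h : μ.quad τ μ.ell = 0) (hτ : star τ = τ) (u : TCoord) :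
    μ.posForm (μ.clifford τ u) = -(μ.c * (μ.quad τ τ).re) * μ.posForm u := by
  have h1 : μ.alt (μ.clifford τ u) (star (μ.clifford τ u))
      = -(μ.c * μ.quad τ τ) * μ.alt u (star u) := by
    rw [star_clifford, hτ, alt_clifford h]
  have h2 : μ.quad τ τ = ((μ.quad τ τ).re : ℂ) := by
    have := star_quad (μ := μ) τ τ
    rw [hτ] at this
    exact (Complex.conj_eq_iff_re.1 this).symm
  rw [h2] at h1
  rw [posForm, h1, alt_self_star]
  simp

/-- The vector `e₁ ∧ e₄ + e₂ ∧ e₃`. -/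
def _root_.WeilTori.extraVec : KCoord := (![0, 0, 1, 1, 0, 0], 0)

theorem quad_extraVec_ell : μ.quad extraVec μ.ell = 0 := by
  rw [quad_symm, quad_ell]
  simp [extraVec]

theorem quad_extraVec : μ.quad extraVec extraVec = 2 := by
  simp [extraVec, quad_apply]
  norm_num

theorem star_extraVec : star extraVec = extraVec := by
  refine Prod.ext ?_ ?_
  · ext i
    fin_cases i <;> simp [extraVec]
  · simp [extraVec]

theorem phi_clifford {τ : KCoord} (h : μ.quad τ μ.ell = 0) (x : TCoord) :
    μ.phi (μ.clifford τ x) = -μ.clifford τ (μ.phi x) :=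
  clifford_swap (by rwa [quad_symm]) x

theorem finrank_eigenspace_phi :
    Module.finrank ℂ (Module.End.eigenspace μ.phi (sqrtNeg μ.disc)) = 4 ∧
      Module.finrank ℂ (Module.End.eigenspace μ.phi (-sqrtNeg μ.disc)) = 4 := by
  have := two_mul_finrank_eigenspace (A := μ.phi) (S := μ.clifford extraVec)
    (sqrtNeg_ne_zero μ.disc_pos) phi_phi'
    (clifford_injective (by rw [quad_extraVec]; exact two_ne_zero))
    (phi_clifford quad_extraVec_ell)
  rw [finrank_tCoord] at this
  omega

theorem exists_quad_eq_zero (f : KCoord →ₗ[ℂ] (Fin 6 → ℂ)) : ∃ τ ≠ 0, f τ = 0 := by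
  have : LinearMap.ker f ≠ ⊥ := LinearMap.ker_ne_bot_of_finrank_lt (by simp)
  obtain ⟨τ, hτ, h0⟩ := (Submodule.ne_bot_iff _).1 this
  exact ⟨τ, h0, hτ⟩

theorem quad_add_add (σ τ : KCoord) :
    μ.quad (σ + τ) (σ + τ) = μ.quad σ σ + 2 * μ.quad σ τ + μ.quad τ τ := by
  simp only [map_add, LinearMap.add_apply]
  rw [quad_symm μ τ σ]
  ring

/-- There are nonisotropic vectors orthogonal to `ell` and to another vector of `ell^⊥`. -/
theorem exists_swap {σ : KCoord} (h0 : σ ≠ 0) (hσ : μ.quad μ.ell σ = 0) :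
    ∃ τ, μ.quad τ μ.ell = 0 ∧ μ.quad τ σ = 0 ∧ μ.quad τ τ ≠ 0 := by
  have hell : μ.quad μ.ell μ.ell ≠ 0 := by
    intro h
    have := quad_ell_ell' (μ := μ)
    rw [h, mul_zero] at this
    exact μ.disc_pos.ne (by exact_mod_cast this)
  -- Otherwise the orthogonal complement of ℓ and σ is totally isotropic. A nonzero τ in it that is
  -- also orthogonal to some τ₀ in ℓ^⊥ but not in σ^⊥ is then orthogonal to the whole space, against
  -- nondegeneracy.
  by_contra! hc
  have hpol : ∀ τ ρ, μ.quad τ μ.ell = 0 → μ.quad τ σ = 0 → μ.quad ρ μ.ell = 0 →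
      μ.quad ρ σ = 0 → μ.quad τ ρ = 0 := by
    intro τ ρ h1 h2 h3 h4
    have h5 := hc (τ + ρ) (by simp [h1, h3]) (by simp [h2, h4])
    rw [quad_add_add, hc τ h1 h2, hc ρ h3 h4] at h5
    simpa using h5
  obtain ⟨y, hy⟩ := exists_quad_ne (μ := μ) h0
  set τ₀ : KCoord := y - (μ.quad y μ.ell / μ.quad μ.ell μ.ell) • μ.ell with hτ₀
  have hτ₀l : μ.quad τ₀ μ.ell = 0 := by
    simp [hτ₀, hell]
  have hτ₀σ : μ.quad τ₀ σ ≠ 0 := by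
    simp [hτ₀, hσ]
    rwa [quad_symm]
  -- Only three conditions are imposed on seven unknowns; the zero functionals are padding.
  obtain ⟨τ, hτ, hτf⟩ := exists_quad_eq_zero
    (LinearMap.pi ![μ.quad μ.ell, μ.quad σ, μ.quad τ₀, 0, 0, 0])
  have e0 : μ.quad μ.ell τ = 0 := by simpa using congrFun hτf 0
  have e1 : μ.quad σ τ = 0 := by simpa using congrFun hτf 1
  have e2 : μ.quad τ₀ τ = 0 := by simpa using congrFun hτf 2
  apply hτ
  apply μ.eq_zero_of_quad
  intro z
  set a := μ.quad z μ.ell / μ.quad μ.ell μ.ell with ha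
  set z₁ : KCoord := z - a • μ.ell with hz₁
  have hz₁l : μ.quad z₁ μ.ell = 0 := by simp [hz₁, ha, hell]
  set b := μ.quad z₁ σ / μ.quad τ₀ σ with hb
  have h1 := hpol τ (z₁ - b • τ₀) (by rwa [quad_symm]) (by rwa [quad_symm])
    (by simp [hz₁l, hτ₀l]) (by simp [hb, hτ₀σ])
  have hz : z = a • μ.ell + b • τ₀ + (z₁ - b • τ₀) := by rw [hz₁]; abel
  rw [hz, map_add, map_add, h1, map_smul, map_smul, quad_symm μ τ, quad_symm μ τ, e0, e2]
  simp

/-- The vector of `exists_swap` acts on the kernel of σ and anticommutes with φ, so it exchanges the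
two eigenspaces inside the kernel. -/
theorem finrank_ker_inf_eigenspace {σ : KCoord} (h0 : σ ≠ 0) (h : μ.quad σ σ = 0)
    (hσ : μ.quad μ.ell σ = 0) :
    Module.finrank ℂ (μ.ker σ ⊓ Module.End.eigenspace μ.phi (sqrtNeg μ.disc) :
        Submodule ℂ TCoord) = 2 ∧
      Module.finrank ℂ (μ.ker σ ⊓ Module.End.eigenspace μ.phi (-sqrtNeg μ.disc) :
        Submodule ℂ TCoord) = 2 := by
  obtain ⟨τ, h1, h2, h3⟩ := exists_swap h0 hσ
  have := two_mul_finrank_inf_eigenspace (A := μ.phi) (S := μ.clifford τ)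
    (sqrtNeg_ne_zero μ.disc_pos) phi_phi' (clifford_injective h3) (phi_clifford h1)
    (p := μ.ker σ) (fun x hx => clifford_mem_ker hσ hx) (fun x hx => clifford_mem_ker h2 hx)
  rw [finrank_ker h0 h] at this
  omega

theorem quad_star_self (σ : KCoord) : μ.quad σ (star σ) = ((μ.quad σ (star σ)).re : ℂ) := by
  have := star_quad (μ := μ) σ (star σ)
  rw [star_star, quad_symm μ (star σ)] at this
  exact (Complex.conj_eq_iff_re.1 this).symm

theorem IsPeriod.quad_star_ne {σ : KCoord} (h : μ.IsPeriod σ) : μ.quad σ (star σ) ≠ 0 := by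
  intro h0
  simpa [h0] using h.pos

theorem IsPeriod.eq_zero_of_star_mem {σ : KCoord} (h : μ.IsPeriod σ) {t : TCoord}
    (ht : t ∈ μ.ker σ) (ht' : star t ∈ μ.ker σ) : t = 0 := by
  refine eq_zero_of_mem_ker h.quad_star_ne ht ?_
  simpa using star_mem_ker ht'

end Model


/-! ### The sign of the polarization on the period domain -/

namespace Model

variable {μ : Model}

/-- Completed squares: the real quadratic form which is the restriction of the polarization. -/
theorem quadratic_nonneg {p q w : ℝ} (hp : 0 < p) (h : 0 ≤ p * q - w ^ 2) (a b : ℝ) :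
    0 ≤ p * a ^ 2 + q * b ^ 2 - 2 * w * a * b := by
  have : p * a ^ 2 + q * b ^ 2 - 2 * w * a * b
      = ((p * a - w * b) ^ 2 + (p * q - w ^ 2) * b ^ 2) / p := by
    field_simp
    ring
  rw [this]
  positivity

theorem quadratic_pos {p q w : ℝ} (hp : 0 < p) (h : 0 < p * q - w ^ 2) {a b : ℝ}
    (hne : ¬ (a = 0 ∧ b = 0)) : 0 < p * a ^ 2 + q * b ^ 2 - 2 * w * a * b := by
  have : p * a ^ 2 + q * b ^ 2 - 2 * w * a * b
      = ((p * a - w * b) ^ 2 + (p * q - w ^ 2) * b ^ 2) / p := by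
    field_simp
    ring
  rw [this]
  apply div_pos _ hp
  rcases eq_or_ne b 0 with rfl | hb
  · have ha : a ≠ 0 := fun ha => hne ⟨ha, rfl⟩
    simp only [mul_zero, sub_zero]
    positivity
  · positivity

/-- Completing squares in (a, b) leaves the binary form in (y, z) multiplied by d/Δ · (2Δ - dξ²/l),
with Δ = pq - w²; the sign of this factor is the cone condition. -/
theorem quartic_pos {p q w ξ l d a b y z : ℝ} (hl : 0 < l) (hd : 0 < d) (hp : 0 < p)
    (h : 0 < 2 * (p * q - w ^ 2) - d / l * ξ ^ 2) (hne : ¬ (a = 0 ∧ b = 0 ∧ y = 0 ∧ z = 0)) :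
    0 < l * (p * a ^ 2 + q * b ^ 2 - 2 * w * a * b) + 2 * d * (p * y ^ 2 + q * z ^ 2 - 2 * w * y * z)
      + 2 * d * ξ * (b * y - a * z) := by
  have hη : 0 ≤ d / l * ξ ^ 2 := by positivity
  have hΔ : 0 < p * q - w ^ 2 := by linarith
  set Δ := p * q - w ^ 2 with hΔ'
  set a' := a + d * ξ / (l * Δ) * (w * y - q * z) with ha'
  set b' := b + d * ξ / (l * Δ) * (p * y - w * z) with hb'
  have hform : l * (p * a ^ 2 + q * b ^ 2 - 2 * w * a * b)
      + 2 * d * (p * y ^ 2 + q * z ^ 2 - 2 * w * y * z) + 2 * d * ξ * (b * y - a * z)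
      = l * (p * a' ^ 2 + q * b' ^ 2 - 2 * w * a' * b')
        + d / Δ * (2 * Δ - d / l * ξ ^ 2) * (p * y ^ 2 + q * z ^ 2 - 2 * w * y * z) := by
    rw [ha', hb']
    field_simp
    rw [hΔ']
    ring
  rw [hform]
  have h1 := quadratic_nonneg hp hΔ.le a' b'
  have h2 := quadratic_nonneg hp hΔ.le y z
  have h3 : 0 < d / Δ * (2 * Δ - d / l * ξ ^ 2) := by positivity
  by_cases hyz : y = 0 ∧ z = 0
  · have : 0 < p * a' ^ 2 + q * b' ^ 2 - 2 * w * a' * b' := by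
      apply quadratic_pos hp hΔ
      rintro ⟨h4, h5⟩
      rw [ha', hyz.1, hyz.2] at h4
      rw [hb', hyz.1, hyz.2] at h5
      simp only [mul_zero, sub_zero, add_zero] at h4 h5
      exact hne ⟨h4, h5, hyz⟩
    positivity
  · have := quadratic_pos hp hΔ hyz
    positivity

/-- The constant `s / (2 lam)`. -/
def slope (μ : Model) : ℝ := μ.s / (2 * μ.lam)

/-- The constant `m - 2 slope ^ 2`. -/
def eta (μ : Model) : ℝ := μ.m - 2 * μ.slope ^ 2

theorem s_eq : μ.s = 2 * μ.lam * μ.slope := by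
  have hl := μ.lam_pos
  rw [slope]
  field_simp

theorem eta_pos : 0 < μ.eta := by
  have h := μ.sq_pos
  have hl := μ.lam_pos
  have hm := μ.m_pos
  have : μ.eta = (μ.m / (2 * μ.lam ^ 2)) * (2 * μ.lam ^ 2 - μ.s ^ 2 / μ.m) := by
    rw [eta, slope]
    field_simp
  rw [this]
  positivity

theorem perp_iff {σ : KCoord} : μ.quad μ.ell σ = 0 ↔ σ.1 0 + σ.1 5 = -2 * μ.slope * σ.2 := by
  have hl : (μ.lam : ℂ) ≠ 0 := by exact_mod_cast μ.lam_pos.ne'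
  rw [quad_ell, s_eq]
  push_cast
  constructor
  · intro h
    apply mul_left_cancel₀ hl
    linear_combination h
  · intro h
    linear_combination (μ.lam : ℂ) * h

theorem quad_star_re (σ : KCoord) : (μ.quad σ (star σ)).re =
    2 * ((σ.1 0).re * (σ.1 5).re + (σ.1 0).im * (σ.1 5).im
      - (σ.1 1).re * (σ.1 4).re - (σ.1 1).im * (σ.1 4).im
      + (σ.1 2).re * (σ.1 3).re + (σ.1 2).im * (σ.1 3).im)
      - μ.m * (σ.2.re ^ 2 + σ.2.im ^ 2) := by
  simp [quad_apply]
  ring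

/-- Up to sign this coordinate is the pairing of σ with the real isotropic vector e₁ ∧ e₃ of ℓ^⊥. As
ℓ^⊥ has signature (2,4), the complement of the positive plane spanned by Re σ and Im σ is negative
definite and contains no isotropic vector. In coordinates this is the triangle inequality. -/
theorem IsPeriod.ne {σ : KCoord} (h : μ.IsPeriod σ) : σ.1 4 ≠ 0 := by
  intro h4
  have h5 : σ.1 5 = -2 * μ.slope * σ.2 - σ.1 0 := by linear_combination perp_iff.1 h.perp
  set w : ℂ := σ.1 0 + μ.slope * σ.2 with hw
  have h0 : σ.1 0 = w - μ.slope * σ.2 := by rw [hw]; ring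
  rw [h0] at h5
  have hq : σ.1 2 * σ.1 3 = w ^ 2 + μ.eta / 2 * σ.2 ^ 2 := by
    have := h.isotropic
    rw [quad_apply, h4, h5, h0] at this
    rw [eta]
    push_cast
    linear_combination this / 2
  have hpos := h.pos
  have hre : 2 * (‖w‖ ^ 2 + μ.eta / 2 * ‖σ.2‖ ^ 2) < 2 * (σ.1 2 * star (σ.1 3)).re := by
    rw [quad_star_re, h5, h0, h4] at hpos
    rw [Complex.sq_norm, Complex.sq_norm, Complex.normSq_apply, Complex.normSq_apply, eta]
    simp at hpos ⊢
    linarith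
  have h1 : (σ.1 2 * star (σ.1 3)).re ≤ ‖σ.1 2 * σ.1 3‖ := by
    refine (Complex.re_le_norm _).trans (le_of_eq ?_)
    simp
  have h2 : ‖σ.1 2 * σ.1 3‖ ≤ ‖w‖ ^ 2 + μ.eta / 2 * ‖σ.2‖ ^ 2 := by
    rw [hq]
    refine (norm_add_le _ _).trans (le_of_eq ?_)
    have := eta_pos (μ := μ)
    simp [abs_of_pos this]
  linarith

/-- The cone condition for a normalized period. -/
theorem quad_star_re_of_normalized {σ : KCoord} (h4 : σ.1 4 = 1) (h : μ.quad σ σ = 0)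
    (hp : μ.quad μ.ell σ = 0) : (μ.quad σ (star σ)).re =
    2 * (2 * ((σ.1 2).im * (σ.1 3).im - ((σ.1 0).im + μ.slope * σ.2.im) ^ 2)
      - μ.eta * σ.2.im ^ 2) := by
  have h5 : σ.1 5 = -2 * μ.slope * σ.2 - σ.1 0 := by linear_combination perp_iff.1 hp
  have h1 : 2 * (σ.1 1).re = (2 * (σ.1 0 * σ.1 5 + σ.1 2 * σ.1 3) - μ.m * σ.2 ^ 2).re := by
    have h1 : 2 * σ.1 1 = 2 * (σ.1 0 * σ.1 5 + σ.1 2 * σ.1 3) - μ.m * σ.2 ^ 2 := by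
      rw [quad_apply, h4] at h
      linear_combination -h
    simpa using congrArg Complex.re h1
  rw [quad_star_re, h4, h5, eta]
  rw [h5] at h1
  simp [pow_two] at h1 ⊢
  linear_combination -h1

theorem posForm_eq (u : TCoord) : μ.posForm u = 2 * (μ.lam * (
    μ.t₁ * ((u.1 0 * star (u.1 1)).im + (u.1 2 * star (u.1 3)).im)
      + μ.t₂ * ((u.2 0 * star (u.2 1)).im + (u.2 2 * star (u.2 3)).im))
      + μ.s * μ.t₃ * (u.2 0 * star (u.1 0) + u.2 1 * star (u.1 1) + u.2 2 * star (u.1 2)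
        + u.2 3 * star (u.1 3)).im) := by
  have hm : μ.m ≠ 0 := μ.m_pos.ne'
  simp [posForm, alt, phi, pairing_apply, clifford_apply, ell, contract, hodgeStar,
    Fin.sum_univ_four]
  field_simp
  ring

/-- The kernel equations express four coordinates of u through the other four. The Hermitian form
then splits into two copies of one real quadratic form, on the real and on the imaginary parts, to
which `quartic_pos` applies. -/
theorem posForm_sign_of_normalized {σ : KCoord} (h : μ.IsPeriod σ) (h4 : σ.1 4 = 1) {u : TCoord}
    (hu : u ∈ μ.ker σ) (hu0 : u ≠ 0) : 0 < μ.t₁ * (σ.1 2).im * μ.posForm u := by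
  have h5 : σ.1 5 = -2 * μ.slope * σ.2 - σ.1 0 := by linear_combination perp_iff.1 h.perp
  have hcone := h.pos
  rw [quad_star_re_of_normalized h4 h.isotropic h.perp] at hcone
  have ht1 : μ.t₁ ≠ 0 := by
    intro h0
    have := μ.t_mul
    rw [h0, zero_mul] at this
    have h3 := μ.c_pos
    rw [c] at h3
    linarith
  have ht3 := μ.t₃_ne
  have hm := μ.m_pos.ne'
  have ht2 : μ.t₂ = 2 * μ.m * μ.t₃ ^ 2 / μ.t₁ := by
    rw [← μ.t_mul]
    field_simp
  have ht2' : μ.t₂ ≠ 0 := by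
    rw [ht2]
    positivity
  have ht1' : (μ.t₁ : ℂ) ≠ 0 := by exact_mod_cast ht1
  have ht2'' : (μ.t₂ : ℂ) ≠ 0 := by exact_mod_cast ht2'
  -- These are κ = mϑ₃/ϑ₁ and ν = mϑ₃/ϑ₂, the latter rewritten as ϑ₁/(2ϑ₃) by ϑ₁ϑ₂ = 2mϑ₃²; they
  -- arise on dividing the kernel equations by ϑ₁ and ϑ₂.
  obtain ⟨κ, hκ⟩ : ∃ κ : ℝ, κ * μ.t₁ = μ.m * μ.t₃ := ⟨μ.m * μ.t₃ / μ.t₁, by field_simp⟩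
  obtain ⟨ν, hν⟩ : ∃ ν : ℝ, ν * (2 * μ.t₃) = μ.t₁ := ⟨μ.t₁ / (2 * μ.t₃), by field_simp⟩
  have hν2 : ν * μ.t₂ = μ.m * μ.t₃ := by
    apply mul_left_cancel₀ (mul_ne_zero two_ne_zero ht3)
    rw [ht2]
    field_simp
    linear_combination hν
  have hκ' : (κ : ℂ) * μ.t₁ = μ.m * μ.t₃ := by exact_mod_cast hκ
  have hν' : (ν : ℂ) * μ.t₂ = μ.m * μ.t₃ := by exact_mod_cast hν2
  have hu' := mem_ker.1 hu
  rw [clifford_apply] at hu'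
  have e1 := congrFun (congrArg Prod.fst hu') 1
  have e3 := congrFun (congrArg Prod.fst hu') 3
  have e0 := congrFun (congrArg Prod.snd hu') 0
  have e2 := congrFun (congrArg Prod.snd hu') 2
  simp [contract, hodgeStar, h4] at e0 e1 e2 e3
  have f3 : u.2 3 = σ.1 0 * u.2 0 - σ.1 3 * u.2 2 + ν * (σ.2 * u.1 1) := by
    apply mul_left_cancel₀ ht2''
    linear_combination e1 - σ.2 * u.1 1 * hν'
  have f1 : u.2 1 = -(σ.1 2 * u.2 0) - σ.1 5 * u.2 2 - ν * (σ.2 * u.1 3) := by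
    apply mul_left_cancel₀ ht2''
    linear_combination -e3 + σ.2 * u.1 3 * hν'
  have g2 : u.1 2 = σ.1 5 * u.1 1 + σ.1 3 * u.1 3 + κ * (σ.2 * u.2 0) := by
    apply mul_left_cancel₀ ht1'
    linear_combination -e0 - σ.2 * u.2 0 * hκ'
  have g0 : u.1 0 = σ.1 2 * u.1 1 - σ.1 0 * u.1 3 - κ * (σ.2 * u.2 2) := by
    apply mul_left_cancel₀ ht1'
    linear_combination e2 + σ.2 * u.2 2 * hκ'
  set p := (σ.1 2).im with hp
  set q := (σ.1 3).im with hq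
  set w := (σ.1 0).im + μ.slope * σ.2.im with hw
  set ξ := σ.2.im with hξ
  have hform : ∀ p q w ξ a b y z : ℝ, μ.lam * (p * a ^ 2 + q * b ^ 2 - 2 * w * a * b)
      + 2 * (μ.lam * μ.eta) * (p * y ^ 2 + q * z ^ 2 - 2 * w * y * z)
      + 2 * (μ.lam * μ.eta) * ξ * (b * y - a * z) = μ.lam * (p * a ^ 2 + q * b ^ 2
      - 2 * w * a * b + 2 * μ.eta * (p * y ^ 2 + q * z ^ 2 - 2 * w * y * z + ξ * (b * y - a * z)))
      := by
    intros; ring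
  set F : ℝ → ℝ → ℝ → ℝ → ℝ := fun a b y z => μ.lam * (p * a ^ 2 + q * b ^ 2
      - 2 * w * a * b + 2 * μ.eta * (p * y ^ 2 + q * z ^ 2 - 2 * w * y * z + ξ * (b * y - a * z)))
      with hF
  -- After the shift by 2·slope·ϑ₃ in the first two arguments, the parameter s enters the form only
  -- through w and `eta`.
  have hid : μ.t₁ * μ.posForm u = 2 * (F (μ.t₁ * (u.1 1).re - 2 * μ.slope * μ.t₃ * (u.2 0).re)
        (μ.t₁ * (u.1 3).re - 2 * μ.slope * μ.t₃ * (u.2 2).re) (μ.t₃ * (u.2 0).re)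
        (μ.t₃ * (u.2 2).re) + F (μ.t₁ * (u.1 1).im - 2 * μ.slope * μ.t₃ * (u.2 0).im)
        (μ.t₁ * (u.1 3).im - 2 * μ.slope * μ.t₃ * (u.2 2).im) (μ.t₃ * (u.2 0).im)
        (μ.t₃ * (u.2 2).im)) := by
    rw [posForm_eq, f1, f3, g0, g2, h5, s_eq, hF]
    have hν3 : ν = μ.t₁ / (2 * μ.t₃) := by rw [← hν]; field_simp
    have hκ3 : κ = μ.m * μ.t₃ / μ.t₁ := by rw [← hκ]; field_simp
    simp [eta, hw, hp, hq, hξ]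
    rw [hν3, hκ3, ht2]
    field_simp
    ring
  have hFpos : ∀ a b y z, ¬ (a = 0 ∧ b = 0 ∧ y = 0 ∧ z = 0) → 0 < p * F a b y z := by
    intro a b y z hne
    have hdl : μ.lam * μ.eta / μ.lam = μ.eta := by
      field_simp [μ.lam_pos.ne']
    have hpq : 0 < 2 * (p * q - w ^ 2) - μ.eta * ξ ^ 2 := by linarith
    have hp0 : p ≠ 0 := by
      intro hp0
      rw [hp0] at hpq
      have := eta_pos (μ := μ)
      nlinarith [sq_nonneg w, mul_nonneg this.le (sq_nonneg ξ)]
    -- F is linear in (p, q, w, ξ) jointly, so p < 0 reduces to p > 0 by changing all four signs.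
    rcases lt_or_gt_of_ne hp0 with h | h
    · apply mul_pos_of_neg_of_neg h
      have := quartic_pos (p := -p) (q := -q) (w := -w) (ξ := -ξ) (l := μ.lam)
        (d := μ.lam * μ.eta) μ.lam_pos (mul_pos μ.lam_pos eta_pos) (by linarith)
        (by rw [hdl]; linarith) hne
      rw [hform] at this
      rw [hF]
      linarith
    · apply mul_pos h
      have := quartic_pos (l := μ.lam)
        (d := μ.lam * μ.eta) (q := q) (w := w) (ξ := ξ) μ.lam_pos (mul_pos μ.lam_pos eta_pos) h
        (by rw [hdl]; linarith) hne
      rwa [hform] at this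
  have hFnn : ∀ a b y z, 0 ≤ p * F a b y z := by
    intro a b y z
    by_cases hne : a = 0 ∧ b = 0 ∧ y = 0 ∧ z = 0
    · obtain ⟨rfl, rfl, rfl, rfl⟩ := hne
      simp [hF]
    · exact (hFpos a b y z hne).le
  rw [mul_right_comm, hid, mul_comm, ← mul_assoc, mul_comm p, mul_assoc, mul_add]
  apply mul_pos two_pos
  clear_value F
  by_cases hre : (u.1 1).re = 0 ∧ (u.1 3).re = 0 ∧ (u.2 0).re = 0 ∧ (u.2 2).re = 0
  · refine add_pos_of_nonneg_of_pos (hFnn _ _ _ _) (hFpos _ _ _ _ ?_)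
    rintro ⟨h1, h2, h3, h4⟩
    rw [mul_eq_zero, or_iff_right ht3] at h3 h4
    rw [h3, mul_zero, sub_zero, mul_eq_zero, or_iff_right ht1] at h1
    rw [h4, mul_zero, sub_zero, mul_eq_zero, or_iff_right ht1] at h2
    have k1 : u.1 1 = 0 := Complex.ext hre.1 h1
    have k2 : u.1 3 = 0 := Complex.ext hre.2.1 h2
    have k3 : u.2 0 = 0 := Complex.ext hre.2.2.1 h3
    have k4 : u.2 2 = 0 := Complex.ext hre.2.2.2 h4
    simp only [k1, k2, k3, k4, mul_zero, add_zero, sub_zero, neg_zero] at f1 f3 g0 g2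
    apply hu0
    refine Prod.ext ?_ ?_ <;> ext i <;> fin_cases i <;> assumption
  · refine add_pos_of_pos_of_nonneg (hFpos _ _ _ _ ?_) (hFnn _ _ _ _)
    rintro ⟨h1, h2, h3, h4⟩
    rw [mul_eq_zero, or_iff_right ht3] at h3 h4
    rw [h3, mul_zero, sub_zero, mul_eq_zero, or_iff_right ht1] at h1
    rw [h4, mul_zero, sub_zero, mul_eq_zero, or_iff_right ht1] at h2
    exact hre ⟨h1, h2, h3, h4⟩

theorem ker_smul {a : ℂ} (ha : a ≠ 0) (σ : KCoord) : μ.ker (a • σ) = μ.ker σ := by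
  ext t
  rw [mem_ker, mem_ker, map_smul, LinearMap.smul_apply, smul_eq_zero, or_iff_right ha]

theorem isPeriod_smul {a : ℂ} (ha : a ≠ 0) {σ : KCoord} (h : μ.IsPeriod σ) :
    μ.IsPeriod (a • σ) where
  isotropic := by simp [h.isotropic]
  pos := by
    have h1 : μ.quad (a • σ) (star (a • σ)) = (‖a‖ ^ 2 : ℝ) * μ.quad σ (star σ) := by
      rw [star_smul]
      simp only [map_smul, LinearMap.smul_apply, smul_eq_mul]
      rw [← mul_assoc, mul_comm (star a)]
      congr 1
      push_cast
      exact Complex.mul_conj' a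
    rw [h1, Complex.re_ofReal_mul]
    exact mul_pos (by positivity) h.pos
  perp := by simp [h.perp]

/-- The sign that distinguishes the two components of the period domain. -/
def side (σ : KCoord) : ℝ := (σ.1 2 * star (σ.1 4)).im

theorem posForm_sign {σ : KCoord} (h : μ.IsPeriod σ) {u : TCoord}
    (hu : u ∈ μ.ker σ) (hu0 : u ≠ 0) : 0 < μ.t₁ * side σ * μ.posForm u := by
  have h4 := h.ne
  have h1 := posForm_sign_of_normalized (isPeriod_smul (inv_ne_zero h4) h)
    (by simp [h4]) (u := u) (by rwa [ker_smul (inv_ne_zero h4)]) hu0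
  have h2 : side σ = ‖σ.1 4‖ ^ 2 * (((σ.1 4)⁻¹ • σ).1 2).im := by
    have : σ.1 2 * star (σ.1 4) = (‖σ.1 4‖ ^ 2 : ℝ) * ((σ.1 4)⁻¹ • σ).1 2 := by
      push_cast
      rw [← Complex.mul_conj' (σ.1 4)]
      simp
      field_simp
    rw [side, this, Complex.im_ofReal_mul]
  rw [h2]
  have : 0 < ‖σ.1 4‖ ^ 2 := by positivity
  calc 0 < ‖σ.1 4‖ ^ 2 * (μ.t₁ * (((σ.1 4)⁻¹ • σ).1 2).im * μ.posForm u) := mul_pos this h1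
    _ = _ := by ring

end Model


/-! ### Parametrization of each half of the period domain by a vector space -/

namespace Model

variable {μ : Model}

/-- The parameters of the tube domain. -/
abbrev TubeParam : Type := (ℝ × ℝ) × (ℝ × ℝ) × (ℂ × ℂ)

/-- The parametrization of one half of the period domain: one coordinate is normalized, and the
cone condition is solved for the imaginary part of another one. -/
def tube (μ : Model) (ε : ℝ) (z : TubeParam) : KCoord :=
  let p : ℝ := ε * Real.exp z.1.1
  let q : ℝ := (z.2.2.1.im ^ 2 + μ.eta / 2 * z.2.2.2.im ^ 2 + Real.exp z.1.2) / p
  let a₂ : ℂ := z.2.1.1 + p * Complex.I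
  let a₃ : ℂ := z.2.1.2 + q * Complex.I
  let a₀ : ℂ := z.2.2.1 - μ.slope * z.2.2.2
  let a₅ : ℂ := -z.2.2.1 - μ.slope * z.2.2.2
  (![a₀, a₀ * a₅ + a₂ * a₃ - μ.m / 2 * z.2.2.2 ^ 2, a₂, a₃, 1, a₅], z.2.2.2)

theorem continuous_tube {ε : ℝ} (hε : ε ≠ 0) : Continuous (μ.tube ε) := by
  have h : ∀ z : TubeParam, (ε : ℂ) * Complex.exp z.1.1 ≠ 0 := fun z =>
    mul_ne_zero (by exact_mod_cast hε) (Complex.exp_ne_zero _)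
  unfold tube
  refine Continuous.prodMk ?_ (by fun_prop)
  refine continuous_pi fun i => ?_
  fin_cases i <;> simp <;> fun_prop (disch := exact h)

theorem isPeriod_tube {ε : ℝ} (hε : ε ≠ 0) (z : TubeParam) : μ.IsPeriod (μ.tube ε z) := by
  have h : ε * Real.exp z.1.1 ≠ 0 := by positivity
  have h1 : μ.quad (μ.tube ε z) (μ.tube ε z) = 0 := by
    simp [quad_apply, tube]
    ring
  have h2 : μ.quad μ.ell (μ.tube ε z) = 0 := by
    rw [perp_iff]
    simp [tube]
    ring
  refine ⟨h1, ?_, h2⟩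
  rw [quad_star_re_of_normalized (by simp [tube]) h1 h2]
  have : ((μ.tube ε z).1 2).im * ((μ.tube ε z).1 3).im
      = z.2.2.1.im ^ 2 + μ.eta / 2 * z.2.2.2.im ^ 2 + Real.exp z.1.2 := by
    have h2 : ((μ.tube ε z).1 2).im = ε * Real.exp z.1.1 := by
      simp [tube, -Complex.ofReal_exp]
    have h3 : ((μ.tube ε z).1 3).im = (z.2.2.1.im ^ 2 + μ.eta / 2 * z.2.2.2.im ^ 2
        + Real.exp z.1.2) / (ε * Real.exp z.1.1) := by
      simp only [tube, Matrix.cons_val, Complex.add_im, Complex.ofReal_im, zero_add,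
        Complex.im_ofReal_mul, Complex.I_im, mul_one]
    rw [h2, h3]
    field_simp
  rw [this]
  have h5 : ((μ.tube ε z).1 0).im + μ.slope * (μ.tube ε z).2.im = z.2.2.1.im := by
    simp [tube]
  have h6 : (μ.tube ε z).2.im = z.2.2.2.im := rfl
  rw [h5, h6]
  have := Real.exp_pos z.1.2
  linarith

theorem side_tube {ε : ℝ} (z : TubeParam) : side (μ.tube ε z) = ε * Real.exp z.1.1 := by
  simp [side, tube, -Complex.ofReal_exp]

/-- The coordinate `σ.1 4` never vanishes on a period and can be scaled to 1. The sign of `side` and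
the cone inequality are the two positivity conditions whose logarithms serve as parameters. -/
theorem exists_tube {ε : ℝ} {σ : KCoord} (h : μ.IsPeriod σ) (hσ : 0 < ε * side σ) :
    ∃ a : ℂ, a ≠ 0 ∧ ∃ z, σ = a • μ.tube ε z := by
  have h4 := h.ne
  suffices hz : ∃ z, (σ.1 4)⁻¹ • σ = μ.tube ε z by
    obtain ⟨z, hz⟩ := hz
    refine ⟨σ.1 4, h4, z, ?_⟩
    rw [← hz, smul_smul, mul_inv_cancel₀ h4, one_smul]
  have hτ := isPeriod_smul (inv_ne_zero h4) h
  have hτ4 : ((σ.1 4)⁻¹ • σ).1 4 = 1 := by simp [h4]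
  have hs : 0 < ε * (((σ.1 4)⁻¹ • σ).1 2).im := by
    have : side σ = ‖σ.1 4‖ ^ 2 * (((σ.1 4)⁻¹ • σ).1 2).im := by
      have : σ.1 2 * star (σ.1 4) = (‖σ.1 4‖ ^ 2 : ℝ) * ((σ.1 4)⁻¹ • σ).1 2 := by
        push_cast
        rw [← Complex.mul_conj' (σ.1 4)]
        simp
        field_simp
      rw [side, this, Complex.im_ofReal_mul]
    rw [this, mul_left_comm] at hσ
    exact (mul_pos_iff_of_pos_left (by positivity)).1 hσ
  generalize (σ.1 4)⁻¹ • σ = τ at hτ hτ4 hs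
  have h5 : τ.1 5 = -2 * μ.slope * τ.2 - τ.1 0 := by linear_combination perp_iff.1 hτ.perp
  have hcone := hτ.pos
  rw [quad_star_re_of_normalized hτ4 hτ.isotropic hτ.perp] at hcone
  have hε : ε ≠ 0 := by rintro rfl; simp at hs
  have hp : (τ.1 2).im ≠ 0 := by intro h; simp [h] at hs
  set r := (τ.1 2).im * (τ.1 3).im - ((τ.1 0).im + μ.slope * τ.2.im) ^ 2
    - μ.eta / 2 * τ.2.im ^ 2 with hr
  have hr0 : 0 < r := by linarith
  have hs' : 0 < (τ.1 2).im / ε := by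
    have : (τ.1 2).im / ε = ε * (τ.1 2).im / ε ^ 2 := by field_simp
    rw [this]
    positivity
  have hp' : ε * Real.exp (Real.log ((τ.1 2).im / ε)) = (τ.1 2).im := by
    rw [Real.exp_log hs']
    field_simp
  refine ⟨((Real.log ((τ.1 2).im / ε), Real.log r), ((τ.1 2).re, (τ.1 3).re),
    (τ.1 0 + μ.slope * τ.2, τ.2)), ?_⟩
  have e2 : ((τ.1 2).re : ℂ) + ((τ.1 2).im : ℂ) * Complex.I = τ.1 2 := Complex.re_add_im _
  have e3 : (((τ.1 0 + μ.slope * τ.2).im ^ 2 + μ.eta / 2 * τ.2.im ^ 2 + Real.exp (Real.log r))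
      / (τ.1 2).im) = (τ.1 3).im := by
    rw [Real.exp_log hr0, hr]
    simp
    field_simp
  have e3' : ((τ.1 3).re : ℂ) + ((τ.1 3).im : ℂ) * Complex.I = τ.1 3 := Complex.re_add_im _
  have e1 : τ.1 1 = τ.1 0 * τ.1 5 + τ.1 2 * τ.1 3 - μ.m / 2 * τ.2 ^ 2 := by
    have := hτ.isotropic
    rw [quad_apply, hτ4] at this
    linear_combination -this / 2
  rw [tube]
  simp only [hp', e2, e3, e3']
  refine Prod.ext ?_ rfl
  ext i
  fin_cases i
  · simp
  · simp [-mul_eq_mul_left_iff, -add_left_inj, e1, h5]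
    ring
  · simp
  · simp
  · simp [hτ4]
  · simp [h5]
    ring

/-! ### Hodge structures of Weil type are kernels of Clifford multiplication -/

theorem pairing_eigenspace {ν : ℂ} (hν : ν * ν = -(μ.disc : ℂ)) {x y : TCoord}
    (hx : μ.phi x = ν • x) (hy : μ.phi y = ν • y) : pairing x y = 0 := by
  have h1 : μ.alt x y = -μ.alt y x := alt_neg x y
  rw [alt, alt, hx, hy, map_smul, map_smul, pairing_symm y x, smul_eq_mul] at h1
  have hd : (μ.disc : ℂ) ≠ 0 := by exact_mod_cast μ.disc_pos.ne'
  have h0 : ν ≠ 0 := by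
    rintro rfl
    rw [mul_zero, eq_comm, neg_eq_zero] at hν
    exact hd hν
  have h2 : ν * pairing x y = 0 := by
    linear_combination h1 / 2
  exact (mul_eq_zero.1 h2).resolve_left h0

/-- An eigenvector decomposition for `phi`. -/
theorem exists_eigen_add {ν : ℂ} (hν : ν * ν = -(μ.disc : ℂ)) (p : Submodule ℂ TCoord)
    (hp : ∀ x ∈ p, μ.phi x ∈ p) {x : TCoord} (hx : x ∈ p) : ∃ y ∈ p, ∃ z ∈ p,
    μ.phi y = ν • y ∧ μ.phi z = -ν • z ∧ x = y + z := by
  have hd : (μ.disc : ℂ) ≠ 0 := by exact_mod_cast μ.disc_pos.ne'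
  have h0 : ν ≠ 0 := by
    rintro rfl
    rw [mul_zero, eq_comm, neg_eq_zero] at hν
    exact hd hν
  refine ⟨(2 * ν)⁻¹ • (ν • x + μ.phi x), p.smul_mem _ (p.add_mem (p.smul_mem _ hx) (hp x hx)),
    (2 * ν)⁻¹ • (ν • x - μ.phi x), p.smul_mem _ (p.sub_mem (p.smul_mem _ hx) (hp x hx)), ?_, ?_, ?_⟩
  · rw [map_smul, map_add, map_smul, phi_phi, ← hν]
    module
  · rw [map_smul, map_sub, map_smul, phi_phi, ← hν]
    module
  · rw [← smul_add]
    have : ν • x + μ.phi x + (ν • x - μ.phi x) = (2 * ν) • x := by module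
    rw [this, smul_smul, inv_mul_cancel₀ (mul_ne_zero two_ne_zero h0), one_smul]

/-- A nonzero vector whose Clifford multiplication kills a plane in an eigenspace of `phi`. -/
theorem exists_clifford_eq_zero {ν : ℂ} (hν : ν * ν = -(μ.disc : ℂ))
    (hT : Module.finrank ℂ (Module.End.eigenspace μ.phi ν) = 4) {P : Submodule ℂ TCoord}
    (hP : P ≤ Module.End.eigenspace μ.phi ν) (hP2 : Module.finrank ℂ P = 2) :
    ∃ σ ≠ 0, μ.quad μ.ell σ = 0 ∧ P ≤ μ.ker σ := by
  obtain ⟨C, hC⟩ := Submodule.exists_isCompl P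
  set Q := C ⊓ Module.End.eigenspace μ.phi ν with hQ
  have hsup : P ⊔ Q = Module.End.eigenspace μ.phi ν := by
    rw [hQ, ← sup_inf_assoc_of_le C hP, hC.sup_eq_top, top_inf_eq]
  have hQ2 : Module.finrank ℂ Q = 2 := by
    have h := Submodule.finrank_sup_add_finrank_inf_eq P Q
    have h2 : P ⊓ Q = ⊥ := by
      rw [hQ, ← inf_assoc, hC.inf_eq_bot, bot_inf_eq]
    rw [hsup, hT, h2, hP2, finrank_bot] at h
    omega
  let u := Module.finBasisOfFinrankEq ℂ P hP2
  let e := Module.finBasisOfFinrankEq ℂ Q hQ2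
  let β : TCoord → TCoord → KCoord →ₗ[ℂ] ℂ := fun x y =>
    (pairing.flip y) ∘ₗ (μ.clifford.flip x)
  have hβ : ∀ x y σ, β x y σ = pairing (μ.clifford σ x) y := fun x y σ => rfl
  -- On the eigenspace P ⊕ Q the form (x, y) ↦ pairing (σx) y is skew. Its vanishing on P × (P ⊕ Q)
  -- amounts to 1 + 4 equations; with σ ⊥ ℓ there are six, on seven unknowns.
  obtain ⟨σ, h0, hσ⟩ := exists_quad_eq_zero (LinearMap.pi ![μ.quad μ.ell, β (u 0) (u 1),
    β (u 0) (e 0), β (u 0) (e 1), β (u 1) (e 0), β (u 1) (e 1)])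
  have c0 : μ.quad μ.ell σ = 0 := by simpa using congrFun hσ 0
  have c1 : pairing (μ.clifford σ (u 0)) (u 1) = 0 := by simpa [hβ] using congrFun hσ 1
  have c2 : pairing (μ.clifford σ (u 0)) (e 0) = 0 := by simpa [hβ] using congrFun hσ 2
  have c3 : pairing (μ.clifford σ (u 0)) (e 1) = 0 := by simpa [hβ] using congrFun hσ 3
  have c4 : pairing (μ.clifford σ (u 1)) (e 0) = 0 := by simpa [hβ] using congrFun hσ 4
  have c5 : pairing (μ.clifford σ (u 1)) (e 1) = 0 := by simpa [hβ] using congrFun hσ 5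
  have hself : ∀ x, pairing (μ.clifford σ x) x = 0 := by
    intro x
    have := pairing_clifford μ σ x x
    rw [pairing_symm x] at this
    exact self_eq_neg.1 this
  have hskew : ∀ x y, pairing (μ.clifford σ x) y = -pairing (μ.clifford σ y) x := by
    intro x y
    rw [pairing_clifford, pairing_symm]
  refine ⟨σ, h0, c0, ?_⟩
  have huT : ∀ i, μ.phi (u i) = ν • (u i : TCoord) := fun i =>
    Module.End.mem_eigenspace_iff.1 (hP (u i).2)
  have hmem : ∀ i k, pairing (μ.clifford σ (u i)) (u k) = 0 := by
    intro i k
    fin_cases i <;> fin_cases k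
    · exact hself _
    · exact c1
    · exact (hskew _ _).trans (neg_eq_zero.2 c1)
    · exact hself _
  have hmem' : ∀ i k, pairing (μ.clifford σ (u i)) (e k) = 0 := by
    intro i k
    fin_cases i <;> fin_cases k <;> assumption
  have hall : ∀ i, ∀ z ∈ Module.End.eigenspace μ.phi ν, pairing (μ.clifford σ (u i)) z = 0 := by
    intro i z hz
    rw [← hsup] at hz
    obtain ⟨a, ha, b, hb, rfl⟩ := Submodule.mem_sup.1 hz
    have h1 := u.sum_repr ⟨a, ha⟩
    have h2 := e.sum_repr ⟨b, hb⟩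
    rw [Fin.sum_univ_two] at h1 h2
    have h1' := congrArg Subtype.val h1
    have h2' := congrArg Subtype.val h2
    simp only [Submodule.coe_add, Submodule.coe_smul] at h1' h2'
    rw [← h1', ← h2']
    simp only [map_add, map_smul, hmem, hmem', smul_zero, add_zero]
  -- Being orthogonal to ℓ, σ sends the ν-eigenspace to the (-ν)-eigenspace, which is isotropic for
  -- the pairing; so σu is detected by the ν-eigenspace alone.
  have hker : ∀ i, μ.clifford σ (u i) = 0 := by
    intro i
    apply eq_zero_of_pairing
    intro y
    obtain ⟨z, -, z', -, hz, hz', rfl⟩ := exists_eigen_add hν ⊤ (fun _ _ => trivial) (x := y) trivial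
    rw [map_add, hall i z (Module.End.mem_eigenspace_iff.2 hz), zero_add]
    refine pairing_eigenspace (ν := -ν) (by rw [neg_mul_neg, hν]) ?_ hz'
    rw [phi, clifford_swap c0]
    have := huT i
    rw [phi] at this
    rw [this, map_smul, neg_smul]
  intro x hx
  have h1 := u.sum_repr ⟨x, hx⟩
  rw [Fin.sum_univ_two] at h1
  have h1' := congrArg Subtype.val h1
  simp only [Submodule.coe_add, Submodule.coe_smul] at h1'
  rw [mem_ker, ← h1', map_add, map_smul, map_smul, hker, hker, smul_zero, smul_zero, add_zero]

/-- Every Hodge structure of Weil type on `V ⊕ V^∨` that is polarized by `alt` is defined by a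
period. -/
theorem exists_ker_eq {H : Submodule ℂ TCoord} (hdim : Module.finrank ℂ H = 4)
    (hphi : ∀ x ∈ H, μ.phi x ∈ H) (halt : ∀ x ∈ H, ∀ y ∈ H, μ.alt x y = 0)
    (hpos : ∀ x ∈ H, x ≠ 0 → 0 < μ.posForm x)
    (hplus : Module.finrank ℂ (H ⊓ Module.End.eigenspace μ.phi (sqrtNeg μ.disc) :
      Submodule ℂ TCoord) = 2) : ∃ σ, μ.IsPeriod σ ∧ H = μ.ker σ := by
  have hν : sqrtNeg μ.disc * sqrtNeg μ.disc = -(μ.disc : ℂ) := sqrtNeg_mul_self μ.disc_pos.le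
  have hd : (μ.disc : ℂ) ≠ 0 := by exact_mod_cast μ.disc_pos.ne'
  obtain ⟨σ, h0, hell, hker⟩ := exists_clifford_eq_zero hν finrank_eigenspace_phi.1
    inf_le_right hplus
  have hnebot : ∃ u ∈ H ⊓ Module.End.eigenspace μ.phi (sqrtNeg μ.disc), u ≠ 0 := by
    apply (Submodule.ne_bot_iff _).1
    intro hbot
    rw [hbot, finrank_bot] at hplus
    omega
  obtain ⟨u, hu, hu0⟩ := hnebot
  have hiso : μ.quad σ σ = 0 := by
    have h1 := clifford_clifford_self (μ := μ) σ u
    rw [mem_ker.1 (hker hu), map_zero, eq_comm, smul_eq_zero, or_iff_left hu0, neg_eq_zero] at h1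
    exact (mul_eq_zero.1 h1).resolve_left c_ne
  have hpair : ∀ x ∈ H, ∀ y ∈ H, pairing x y = 0 := by
    intro x hx y hy
    have := halt x hx (μ.phi y) (hphi y hy)
    rw [alt, phi_phi, map_smul, smul_eq_zero] at this
    exact this.resolve_left (neg_ne_zero.2 hd)
  have hplus' : H ⊓ Module.End.eigenspace μ.phi (sqrtNeg μ.disc)
      = μ.ker σ ⊓ Module.End.eigenspace μ.phi (sqrtNeg μ.disc) := by
    apply Submodule.eq_of_le_of_finrank_eq (le_inf hker inf_le_right)
    rw [hplus, (finrank_ker_inf_eigenspace h0 hiso hell).1]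
  -- The √(-disc)-parts of H and of the kernel are planes, one inside the other. For z in the other
  -- part of H, σz pairs trivially with the first eigenspace, and its pairing with w₂ in the second
  -- is minus that of z with σw₂, which lies in H; H is isotropic.
  have hHker : H = μ.ker σ := by
    apply Submodule.eq_of_le_of_finrank_eq _ (by rw [hdim, finrank_ker h0 hiso])
    intro x hx
    obtain ⟨y, hy, z, hz, hyν, hzν, rfl⟩ := exists_eigen_add hν H hphi hx
    refine (μ.ker σ).add_mem (hker ⟨hy, Module.End.mem_eigenspace_iff.2 hyν⟩) ?_
    rw [mem_ker]
    apply eq_zero_of_pairing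
    intro w
    obtain ⟨w₁, -, w₂, -, hw₁, hw₂, rfl⟩ :=
      exists_eigen_add hν ⊤ (fun _ _ => trivial) (x := w) trivial
    have hswap : ∀ (κ : ℂ) v, μ.phi v = κ • v → μ.phi (μ.clifford σ v) = -κ • μ.clifford σ v := by
      intro κ v hv
      rw [phi, clifford_swap hell]
      rw [phi] at hv
      rw [hv, map_smul, neg_smul]
    rw [map_add, pairing_eigenspace hν (x := μ.clifford σ z) (by simpa using hswap _ _ hzν) hw₁,
      zero_add, pairing_clifford, neg_eq_zero]
    refine hpair z hz _ ?_
    have : μ.clifford σ w₂ ∈ μ.ker σ ⊓ Module.End.eigenspace μ.phi (sqrtNeg μ.disc) := by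
      refine ⟨?_, Module.End.mem_eigenspace_iff.2 (by simpa using hswap _ _ hw₂)⟩
      rw [SetLike.mem_coe, mem_ker, clifford_clifford_self, hiso, mul_zero, neg_zero, zero_smul]
    rw [← hplus'] at this
    exact this.1
  refine ⟨σ, ⟨hiso, ?_, hell⟩, hHker⟩
  have hdisj : ∀ x ∈ H, star x ∈ H → x = 0 := by
    intro x hx hx'
    by_contra hne
    have := hpos x hx hne
    rw [posForm, halt x hx _ hx'] at this
    simp at this
  have hue : u ∈ H := hu.1
  have hself : ∀ x, μ.clifford σ (μ.clifford σ x) = 0 := fun x => by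
    rw [clifford_clifford_self, hiso, mul_zero, neg_zero, zero_smul]
  have hiso' : μ.quad (star σ) (star σ) = 0 := by rw [← star_quad, hiso, star_zero]
  have hell' : μ.quad μ.ell (star σ) = 0 := by rw [← star_ell, ← star_quad, hell, star_zero]
  -- If σ and σ̄ were orthogonal, σ̄u and its conjugate would both lie in H, so σ̄u = 0. Then the
  -- conjugate of u would lie in H as well, against the positivity of the form on H.
  have hne : μ.quad σ (star σ) ≠ 0 := by
    intro h
    have hmemstar : ∀ x ∈ H, star x ∈ μ.ker (star σ) := by
      intro x hx
      rw [hHker] at hx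
      exact star_mem_ker hx
    have h1 : μ.clifford (star σ) u ∈ H := by
      rw [hHker] at hue ⊢
      exact clifford_mem_ker (by rwa [quad_symm]) hue
    have h2 : star (μ.clifford (star σ) u) ∈ H := by
      rw [hHker, mem_ker, star_clifford, star_star, hself]
    have h3 := hdisj _ h1 h2
    have h4 : star u ∈ H := by
      rw [hHker, mem_ker]
      have := congrArg star h3
      rwa [star_clifford, star_star, star_zero] at this
    exact hu0 (hdisj u hue h4)
  set r := (μ.quad σ (star σ)).re with hr
  have hrr : μ.quad σ (star σ) = (r : ℂ) := quad_star_self σ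
  have hr0 : r ≠ 0 := by
    intro h
    rw [hrr, h] at hne
    simp at hne
  by_contra hlt
  have hlt : r < 0 := lt_of_le_of_ne (not_lt.1 hlt) hr0
  have hrc : (r : ℂ) ≠ 0 := by exact_mod_cast hr0
  set k := μ.quad extraVec σ with hk
  have hk' : μ.quad extraVec (star σ) = star k := by
    rw [hk, star_quad, star_extraVec]
  -- The component of `extraVec` orthogonal to σ and σ̄. It is real and orthogonal to ℓ, and for r <
  -- 0 its square 2 - 2|k|²/r is positive. Clifford multiplication by τ then preserves H but
  -- reverses the sign of the Hermitian form.
  set τ : KCoord := extraVec - (star k / r) • σ - (k / r) • star σ with hτ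
  have hstar : star τ = τ := by
    rw [hτ, star_sub, star_sub, star_smul, star_smul, star_extraVec, star_star, star_div₀,
      star_div₀, star_star]
    simp only [RCLike.star_def, Complex.conj_ofReal]
    abel
  have hτσ : μ.quad τ σ = 0 := by
    rw [hτ]
    simp only [map_sub, LinearMap.sub_apply, map_smul, LinearMap.smul_apply, hiso,
      quad_symm μ (star σ) σ, hrr, ← hk, smul_eq_mul]
    field_simp
    ring
  have hτell : μ.quad τ μ.ell = 0 := by
    rw [hτ]
    simp only [map_sub, LinearMap.sub_apply, map_smul, LinearMap.smul_apply,
      quad_symm μ _ μ.ell, hell, hell', smul_eq_mul]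
    rw [quad_symm, quad_extraVec_ell]
    ring
  have hττ : (μ.quad τ τ).re = 2 - 2 * ‖k‖ ^ 2 / r := by
    have : μ.quad τ τ = ((2 - 2 * ‖k‖ ^ 2 / r : ℝ) : ℂ) := by
      rw [hτ]
      simp only [map_sub, LinearMap.sub_apply, map_smul, LinearMap.smul_apply, quad_extraVec,
        quad_symm μ _ extraVec, quad_symm μ (star σ) σ, hiso, hiso', hrr, hk', ← hk, smul_eq_mul]
      push_cast
      rw [← Complex.mul_conj' k]
      simp only [RCLike.star_def]
      field_simp
      ring
    rw [this, Complex.ofReal_re]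
  have hττ2 : 0 < (μ.quad τ τ).re := by
    rw [hττ]
    have : 2 * ‖k‖ ^ 2 / r ≤ 0 := div_nonpos_of_nonneg_of_nonpos (by positivity) hlt.le
    linarith
  have hinj : Function.Injective (μ.clifford τ) := by
    apply clifford_injective
    intro h
    rw [h] at hττ2
    simp at hττ2
  have h1 : μ.clifford τ u ∈ H := by
    rw [hHker] at hue ⊢
    exact clifford_mem_ker hτσ hue
  have h2 := hpos _ h1 (fun h => hu0 (hinj (h.trans (map_zero _).symm)))
  rw [posForm_clifford hτell hstar] at h2
  have h3 := hpos u hue hu0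
  have h4 := mul_pos (mul_pos μ.c_pos hττ2) h3
  linarith

end Model


/-! ### Complexified exterior algebra: symmetry, conjugation and evaluation -/

section Bridge

variable {V : Type*} [AddCommGroup V]

theorem wedge_self (v : V) : wedge V v v = 0 := by
  simp only [wedge, LinearMap.mk₂_apply]
  exact AlternatingMap.map_eq_zero_of_eq _ _ (i := 0) (j := 1) rfl (by decide)

theorem wedge_swap (v w : V) : wedge V v w = -wedge V w v := by
  have h := wedge_self (v + w)
  simp only [map_add, LinearMap.add_apply, wedge_self, zero_add, add_zero] at h
  exact eq_neg_of_add_eq_zero_right h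

theorem volForm_swap (vol : ⋀[ℤ]^4 V ≃ₗ[ℤ] ℤ) (a b c d : V) :
    volForm vol (wedge V a b) (wedge V c d) = -volForm vol (wedge V a c) (wedge V b d) := by
  rw [volForm_wedge, volForm_wedge, ← map_neg]
  congr 1
  rw [← AlternatingMap.map_swap (exteriorPower.ιMulti ℤ 4) ![a, c, b, d]
    (show (1 : Fin 4) ≠ 2 by decide)]
  congr 1
  ext i
  fin_cases i <;> rfl

theorem volForm_wedge_comm (vol : ⋀[ℤ]^4 V ≃ₗ[ℤ] ℤ) (a b c d : V) :
    volForm vol (wedge V a b) (wedge V c d) = volForm vol (wedge V c d) (wedge V a b) := by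
  rw [volForm_swap, wedge_swap a c, map_neg, LinearMap.neg_apply, neg_neg, wedge_swap b d, map_neg,
    volForm_swap, neg_neg, wedge_swap a b, map_neg, volForm_swap vol c d b a, neg_neg,
    wedge_swap d a]

theorem exteriorPower_two_ext {M : Type*} [AddCommGroup M] {f g : (⋀[ℤ]^2 V) →ₗ[ℤ] M}
    (h : ∀ v w, f (wedge V v w) = g (wedge V v w)) : f = g := by
  apply exteriorPower.linearMap_ext
  ext x
  have := h (x 0) (x 1)
  simp only [wedge, LinearMap.mk₂_apply] at this
  have hx : ![x 0, x 1] = x := by ext i; fin_cases i <;> rfl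
  rw [hx] at this
  exact this

theorem volForm_comm (vol : ⋀[ℤ]^4 V ≃ₗ[ℤ] ℤ) (α β : ⋀[ℤ]^2 V) :
    volForm vol α β = volForm vol β α := by
  have h : volForm vol = (volForm vol).flip := by
    apply exteriorPower_two_ext
    intro a b
    apply exteriorPower_two_ext
    intro c d
    exact volForm_wedge_comm vol a b c d
  exact congrArg (fun F => F α β) h

theorem wedgeC_tmul (z w : ℂ) (a b : V) :
    wedgeC V (z ⊗ₜ a) (w ⊗ₜ b) = (z * w) ⊗ₜ wedge V a b := rfl

theorem volFormC_tmul (vol : ⋀[ℤ]^4 V ≃ₗ[ℤ] ℤ) (z w : ℂ) (a b : ⋀[ℤ]^2 V) :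
    volFormC vol (z ⊗ₜ a) (w ⊗ₜ b) = (volForm vol a b : ℂ) * (z * w) := by
  rw [volFormC, LinearMap.BilinForm.baseChange_tmul, zsmul_eq_mul]

theorem dual_baseChange_tmul {M : Type*} [AddCommGroup M] (f : Module.Dual ℤ M) (z : ℂ) (a : M) :
    Module.Dual.baseChange ℂ f (z ⊗ₜ a) = (f a : ℂ) * z := by
  simp

theorem volFormC_comm (vol : ⋀[ℤ]^4 V ≃ₗ[ℤ] ℤ) (α β : ℂ ⊗[ℤ] ⋀[ℤ]^2 V) :
    volFormC vol α β = volFormC vol β α := by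
  induction α with
  | zero => simp
  | add x y hx hy => simp [hx, hy]
  | tmul z a =>
    induction β with
    | zero => simp
    | add x y hx hy => simp [hx, hy]
    | tmul w b => rw [volFormC_tmul, volFormC_tmul, volForm_comm, mul_comm z]

theorem wedgeC_swap (x y : ℂ ⊗[ℤ] V) : wedgeC V x y = -wedgeC V y x := by
  induction x with
  | zero => simp
  | add x y hx hy => simp only [map_add, LinearMap.add_apply, hx, hy, neg_add]
  | tmul z a =>
    induction y with
    | zero => simp
    | add x y hx hy => simp only [map_add, LinearMap.add_apply, hx, hy, neg_add]
    | tmul w b => rw [wedgeC_tmul, wedgeC_tmul, wedge_swap, mul_comm z, TensorProduct.tmul_neg]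

theorem wedgeC_self (x : ℂ ⊗[ℤ] V) : wedgeC V x x = 0 := by
  have h := add_eq_zero_iff_eq_neg.2 (wedgeC_swap x x)
  rw [← two_smul ℂ] at h
  rw [← one_smul ℂ (wedgeC V x x), ← inv_mul_cancel₀ (two_ne_zero (α := ℂ)), mul_smul, h, smul_zero]

theorem volFormC_swap (vol : ⋀[ℤ]^4 V ≃ₗ[ℤ] ℤ) (x y z w : ℂ ⊗[ℤ] V) :
    volFormC vol (wedgeC V x y) (wedgeC V z w) = -volFormC vol (wedgeC V x z) (wedgeC V y w) := by
  induction x with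
  | zero => simp
  | add x x' hx hx' => simp only [map_add, LinearMap.add_apply, hx, hx', neg_add]
  | tmul r a =>
  induction y with
  | zero => simp
  | add x x' hx hx' => simp only [map_add, LinearMap.add_apply, hx, hx', neg_add]
  | tmul s b =>
  induction z with
  | zero => simp
  | add x x' hx hx' => simp only [map_add, LinearMap.add_apply, hx, hx', neg_add]
  | tmul t c =>
  induction w with
  | zero => simp
  | add x x' hx hx' => simp only [map_add, hx, hx', neg_add]
  | tmul u d =>
    rw [wedgeC_tmul, wedgeC_tmul, wedgeC_tmul, wedgeC_tmul, volFormC_tmul, volFormC_tmul,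
      volForm_swap]
    push_cast
    ring

/-- Complex conjugation on `ℂ ⊗ M`. -/
def conjT (M : Type*) [AddCommGroup M] : ℂ ⊗[ℤ] M →ₗ[ℤ] ℂ ⊗[ℤ] M :=
  LinearMap.rTensor M ((starRingEnd ℂ).toAddMonoidHom.toIntLinearMap)

theorem conjT_tmul {M : Type*} [AddCommGroup M] (z : ℂ) (a : M) :
    conjT M (z ⊗ₜ a) = star z ⊗ₜ a := rfl

theorem conjT_smul {M : Type*} [AddCommGroup M] (z : ℂ) (x : ℂ ⊗[ℤ] M) :
    conjT M (z • x) = star z • conjT M x := by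
  induction x with
  | zero => simp
  | add x y hx hy => simp only [smul_add, map_add, hx, hy]
  | tmul w a => simp [TensorProduct.smul_tmul', conjT_tmul]

theorem wedgeC_conj (x y : ℂ ⊗[ℤ] V) :
    conjT _ (wedgeC V x y) = wedgeC V (conjT V x) (conjT V y) := by
  induction x with
  | zero => simp
  | add x y hx hy => simp only [map_add, LinearMap.add_apply, hx, hy]
  | tmul z a =>
    induction y with
    | zero => simp
    | add x y hx hy => simp only [map_add, hx, hy]
    | tmul w b => simp [wedgeC_tmul, conjT_tmul]

theorem volFormC_conj (vol : ⋀[ℤ]^4 V ≃ₗ[ℤ] ℤ) (α β : ℂ ⊗[ℤ] ⋀[ℤ]^2 V) :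
    volFormC vol (conjT _ α) (conjT _ β) = star (volFormC vol α β) := by
  induction α with
  | zero => simp
  | add x y hx hy => simp only [map_add, LinearMap.add_apply, hx, hy, star_add]
  | tmul z a =>
    induction β with
    | zero => simp
    | add x y hx hy => simp only [map_add, hx, hy, star_add]
    | tmul w b => simp [conjT_tmul, volFormC_tmul]

theorem dual_baseChange_conj {M : Type*} [AddCommGroup M] (f : Module.Dual ℤ M) (x : ℂ ⊗[ℤ] M) :
    Module.Dual.baseChange ℂ f (conjT M x) = star (Module.Dual.baseChange ℂ f x) := by
  induction x with
  | zero => simp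
  | add x y hx hy => simp only [map_add, hx, hy, star_add]
  | tmul z a => simp [conjT_tmul]

/-- The functional `g ∧ k` on `⋀² V_ℂ`. -/
theorem pairingDual_wedgeC (g k : Module.Dual ℤ V) (x y : ℂ ⊗[ℤ] V) :
    Module.Dual.baseChange ℂ (exteriorPower.pairingDual ℤ V 2 (wedge (Module.Dual ℤ V) g k))
      (wedgeC V x y) = Module.Dual.baseChange ℂ g x * Module.Dual.baseChange ℂ k y
        - Module.Dual.baseChange ℂ g y * Module.Dual.baseChange ℂ k x := by
  induction x with
  | zero => simp
  | add x y hx hy => simp only [map_add, LinearMap.add_apply, hx, hy]; ring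
  | tmul z a =>
    induction y with
    | zero => simp
    | add x y hx hy => simp only [map_add, hx, hy]; ring
    | tmul w b =>
      rw [wedgeC_tmul, dual_baseChange_tmul, dual_baseChange_tmul, dual_baseChange_tmul,
        dual_baseChange_tmul, dual_baseChange_tmul]
      simp only [wedge, LinearMap.mk₂_apply, exteriorPower.pairingDual_ιMulti_ιMulti,
        Matrix.det_fin_two]
      simp
      ring

end Bridge


section Alternation

variable {V : Type*} [AddCommGroup V] (vol : ⋀[ℤ]^4 V ≃ₗ[ℤ] ℤ) (x y z w : ℂ ⊗[ℤ] V)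

theorem volFormC_zero_left : volFormC vol (wedgeC V x x) (wedgeC V z w) = 0 := by
  rw [wedgeC_self, map_zero, LinearMap.zero_apply]

theorem volFormC_zero_outer : volFormC vol (wedgeC V x y) (wedgeC V x w) = 0 := by
  rw [volFormC_swap, volFormC_zero_left, neg_zero]

theorem volFormC_zero_inner : volFormC vol (wedgeC V x y) (wedgeC V y w) = 0 := by
  rw [wedgeC_swap, map_neg, LinearMap.neg_apply, volFormC_zero_outer, neg_zero]

theorem volFormC_zero_ends : volFormC vol (wedgeC V x y) (wedgeC V z x) = 0 := by
  rw [wedgeC_swap z, map_neg, volFormC_zero_outer, neg_zero]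

theorem volFormC_zero_second : volFormC vol (wedgeC V x y) (wedgeC V z y) = 0 := by
  rw [wedgeC_swap z, map_neg, volFormC_zero_inner, neg_zero]

theorem volFormC_perm : volFormC vol (wedgeC V x w) (wedgeC V y z)
    = volFormC vol (wedgeC V x y) (wedgeC V z w) := by
  rw [volFormC_swap, wedgeC_swap w, map_neg, neg_neg]

end Alternation

/-- A basis of `V_ℂ` of volume one, consisting of real vectors. -/
structure Frame {V : Type*} [AddCommGroup V] (vol : ⋀[ℤ]^4 V ≃ₗ[ℤ] ℤ) where
  /-- the basis -/
  e : Module.Basis (Fin 4) ℂ (ℂ ⊗[ℤ] V)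
  conj_e : ∀ i, conjT V (e i) = e i
  vol_e : volFormC vol (wedgeC V (e 0) (e 1)) (wedgeC V (e 2) (e 3)) = 1

theorem hodgeStar_hodgeStar (a : Fin 6 → ℂ) : hodgeStar (hodgeStar a) = a := by
  ext i
  fin_cases i <;> simp [hodgeStar]

/-! ### Coordinates with respect to a real frame of volume one -/

namespace Frame

variable {V : Type*} [AddCommGroup V] {vol : ⋀[ℤ]^4 V ≃ₗ[ℤ] ℤ} (F : Frame vol)

/-- The bivectors of a frame. -/
def biv : Fin 6 → ℂ ⊗[ℤ] ⋀[ℤ]^2 V :=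
  ![wedgeC V (F.e 0) (F.e 1), wedgeC V (F.e 0) (F.e 2), wedgeC V (F.e 0) (F.e 3),
    wedgeC V (F.e 1) (F.e 2), wedgeC V (F.e 1) (F.e 3), wedgeC V (F.e 2) (F.e 3)]

/-- Each basis bivector is dual, up to sign, to the complementary one, and `hodgeStar` records this
permutation with signs. That is why `coords` is obtained from pairings with the bivectors. -/
theorem volFormC_biv (i k : Fin 6) :
    volFormC vol (F.biv i) (F.biv k) = hodgeStar (Pi.single k 1) i := by
  have h1 := F.vol_e
  have h2 : volFormC vol (wedgeC V (F.e 0) (F.e 2)) (wedgeC V (F.e 1) (F.e 3)) = -1 := by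
    rw [volFormC_swap, h1]
  have h3 : volFormC vol (wedgeC V (F.e 0) (F.e 3)) (wedgeC V (F.e 1) (F.e 2)) = 1 := by
    rw [volFormC_perm, h1]
  have h1' := (volFormC_comm vol _ _).trans h1
  have h2' := (volFormC_comm vol _ _).trans h2
  have h3' := (volFormC_comm vol _ _).trans h3
  fin_cases i <;> fin_cases k <;>
    simp [biv, hodgeStar, volFormC_zero_outer, volFormC_zero_inner,
      volFormC_zero_ends, volFormC_zero_second, h1, h2, h3, h1', h2', h3']

theorem conj_biv (i : Fin 6) : conjT _ (F.biv i) = F.biv i := by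
  fin_cases i <;> simp [biv, wedgeC_conj, F.conj_e]

/-- The coordinates of a bivector. -/
def coords : (ℂ ⊗[ℤ] ⋀[ℤ]^2 V) →ₗ[ℂ] (Fin 6 → ℂ) where
  toFun α := hodgeStar fun i => volFormC vol α (F.biv i)
  map_add' α β := by ext i; fin_cases i <;> simp [hodgeStar] <;> ring
  map_smul' r α := by ext i; fin_cases i <;> simp [hodgeStar]

theorem hodgeStar_coords (α : ℂ ⊗[ℤ] ⋀[ℤ]^2 V) :
    hodgeStar (F.coords α) = fun i => volFormC vol α (F.biv i) :=
  hodgeStar_hodgeStar fun i => volFormC vol α (F.biv i)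

theorem coords_biv (k : Fin 6) : F.coords (F.biv k) = Pi.single k 1 := by
  change hodgeStar (fun i => volFormC vol (F.biv k) (F.biv i)) = _
  simp_rw [volFormC_comm vol (F.biv k), volFormC_biv]
  exact hodgeStar_hodgeStar _

variable [Module.Free ℤ V] [Module.Finite ℤ V]

theorem finrank_bivectors (vol : ⋀[ℤ]^4 V ≃ₗ[ℤ] ℤ) :
    Module.finrank ℂ (ℂ ⊗[ℤ] ⋀[ℤ]^2 V) = 6 := by
  rw [Module.finrank_baseChange, exteriorPower.finrank_eq, finrank_eq_four vol]
  rfl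

theorem coords_bijective : Function.Bijective F.coords := by
  have hs : Function.Surjective F.coords := by
    intro a
    refine ⟨∑ k, a k • F.biv k, ?_⟩
    rw [map_sum]
    simp only [map_smul, coords_biv]
    ext i
    simp [Finset.sum_apply, Pi.single_apply]
  refine ⟨?_, hs⟩
  rw [LinearMap.injective_iff_surjective_of_finrank_eq_finrank]
  · exact hs
  · rw [finrank_bivectors vol]
    simp

theorem eq_sum (α : ℂ ⊗[ℤ] ⋀[ℤ]^2 V) : α = ∑ k, F.coords α k • F.biv k := by
  apply F.coords_bijective.1
  rw [map_sum]
  simp only [map_smul, coords_biv]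
  ext i
  simp [Finset.sum_apply, Pi.single_apply]

theorem volFormC_eq (α β : ℂ ⊗[ℤ] ⋀[ℤ]^2 V) : volFormC vol α β =
    F.coords α 0 * F.coords β 5 + F.coords α 5 * F.coords β 0 - F.coords α 1 * F.coords β 4
      - F.coords α 4 * F.coords β 1 + F.coords α 2 * F.coords β 3 + F.coords α 3 * F.coords β 2 := by
  have h : ∀ k, volFormC vol (F.biv k) β = hodgeStar (F.coords β) k := by
    intro k
    rw [hodgeStar_coords, volFormC_comm]
  conv_lhs => rw [F.eq_sum α]
  simp only [map_add, map_smul, LinearMap.add_apply, LinearMap.smul_apply, h, Fin.sum_univ_six]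
  simp [hodgeStar]
  ring

/-- The coordinates of a vector of `⋀² V_ℂ ⊕ ℂ`. -/
def kCoord : K3Space V ≃ₗ[ℂ] KCoord :=
  (LinearEquiv.ofBijective F.coords F.coords_bijective).prodCongr (LinearEquiv.refl ℂ ℂ)

theorem kCoord_apply (σ : K3Space V) : F.kCoord σ = (F.coords σ.1, σ.2) := rfl

omit [Module.Free ℤ V] [Module.Finite ℤ V] in
theorem star_coords (α : ℂ ⊗[ℤ] ⋀[ℤ]^2 V) : F.coords (conjT _ α) = star (F.coords α) := by
  have h : ∀ k, volFormC vol (conjT _ α) (F.biv k) = star (volFormC vol α (F.biv k)) := by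
    intro k
    conv_lhs => rw [← F.conj_biv k]
    exact volFormC_conj vol α _
  ext i
  change hodgeStar (fun i => volFormC vol (conjT _ α) (F.biv i)) i
    = star (hodgeStar (fun i => volFormC vol α (F.biv i)) i)
  simp_rw [h]
  fin_cases i <;> simp [hodgeStar]

theorem kCoord_conj (σ : K3Space V) : F.kCoord (K3Space.conj σ) = star (F.kCoord σ) := by
  rw [kCoord_apply, kCoord_apply]
  refine Prod.ext ?_ rfl
  exact F.star_coords σ.1

/-- The coordinates of a vector of `V_ℂ ⊕ V_ℂ^∨`. -/
def tCoord : ((ℂ ⊗[ℤ] V) × Module.Dual ℂ (ℂ ⊗[ℤ] V)) ≃ₗ[ℂ] TCoord :=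
  F.e.equivFun.prodCongr F.e.dualBasis.equivFun

omit [Module.Free ℤ V] [Module.Finite ℤ V] in
theorem tCoord_fst (x : (ℂ ⊗[ℤ] V) × Module.Dual ℂ (ℂ ⊗[ℤ] V)) (i : Fin 4) :
    (F.tCoord x).1 i = F.e.repr x.1 i := rfl

omit [Module.Free ℤ V] [Module.Finite ℤ V] in
theorem tCoord_snd (x : (ℂ ⊗[ℤ] V) × Module.Dual ℂ (ℂ ⊗[ℤ] V)) (i : Fin 4) :
    (F.tCoord x).2 i = x.2 (F.e i) := by
  simp [tCoord, Module.Basis.equivFun_apply, Module.Basis.dualBasis_repr]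

omit [Module.Free ℤ V] [Module.Finite ℤ V] in
theorem pairing_tCoord (x y : (ℂ ⊗[ℤ] V) × Module.Dual ℂ (ℂ ⊗[ℤ] V)) :
    pairing (F.tCoord x) (F.tCoord y) = x.2 y.1 + y.2 x.1 := by
  rw [pairing_apply, Finset.sum_add_distrib]
  simp only [tCoord_fst, tCoord_snd]
  conv_rhs => rw [← F.e.sum_repr x.1, ← F.e.sum_repr y.1]
  simp only [map_sum, map_smul, smul_eq_mul]
  congr 1 <;> exact Finset.sum_congr rfl fun i _ => mul_comm _ _

omit [Module.Free ℤ V] [Module.Finite ℤ V] in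
/-- Contraction with a bivector in coordinates. -/
theorem contract_hodgeStar (α : ℂ ⊗[ℤ] ⋀[ℤ]^2 V) (x : ℂ ⊗[ℤ] V) (i : Fin 4) :
    contract (hodgeStar (F.coords α)) (fun k => F.e.repr x k) i
      = volFormC vol α (wedgeC V (F.e i) x) := by
  rw [hodgeStar_coords]
  conv_rhs => rw [← F.e.sum_repr x]
  simp only [map_smul, Fin.sum_univ_four, smul_eq_mul, map_add]
  fin_cases i
  · simp [contract, biv, wedgeC_self]
    ring
  · simp [contract, biv, wedgeC_self, wedgeC_swap (F.e 1) (F.e 0)]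
    ring
  · simp [contract, biv, wedgeC_self, wedgeC_swap (F.e 2) (F.e 0), wedgeC_swap (F.e 2) (F.e 1)]
    ring
  · simp [contract, biv, wedgeC_self, wedgeC_swap (F.e 3) (F.e 0), wedgeC_swap (F.e 3) (F.e 1),
      wedgeC_swap (F.e 3) (F.e 2)]
    ring

theorem sum_mul_contract (g k : Module.Dual ℤ V) (α : ℂ ⊗[ℤ] ⋀[ℤ]^2 V) :
    ∑ i, Module.Dual.baseChange ℂ g (F.e i) * contract (F.coords α)
      (fun j => Module.Dual.baseChange ℂ k (F.e j)) i
      = Module.Dual.baseChange ℂ (exteriorPower.pairingDual ℤ V 2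
        (wedge (Module.Dual ℤ V) g k)) α := by
  conv_rhs => rw [F.eq_sum α]
  simp only [map_smul, Fin.sum_univ_six, smul_eq_mul, map_add]
  simp only [biv, Matrix.cons_val, pairingDual_wedgeC, Fin.sum_univ_four, contract]
  ring

/-- The map `V ⊕ V^∨ → V_ℂ ⊕ V_ℂ^∨`. -/
def _root_.WeilTori.latticeMap (V : Type*) [AddCommGroup V] : (V × Module.Dual ℤ V) →ₗ[ℤ]
    ((ℂ ⊗[ℤ] V) × Module.Dual ℂ (ℂ ⊗[ℤ] V)) :=
  LinearMap.prodMap (TensorProduct.mk ℤ ℂ V 1) (Module.Dual.baseChange ℂ)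

omit [Module.Free ℤ V] [Module.Finite ℤ V] in
theorem star_tCoord (x : V × Module.Dual ℤ V) :
    star (F.tCoord (latticeMap V x)) = F.tCoord (latticeMap V x) := by
  refine Prod.ext ?_ ?_
  · ext i
    change star (F.e.repr ((1 : ℂ) ⊗ₜ[ℤ] x.1) i) = F.e.repr ((1 : ℂ) ⊗ₜ[ℤ] x.1) i
    have h : conjT V ((1 : ℂ) ⊗ₜ[ℤ] x.1) = (1 : ℂ) ⊗ₜ[ℤ] x.1 := by
      rw [conjT_tmul, star_one]
    have h2 : conjT V ((1 : ℂ) ⊗ₜ[ℤ] x.1)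
        = ∑ i, star (F.e.repr ((1 : ℂ) ⊗ₜ[ℤ] x.1) i) • F.e i := by
      conv_lhs => rw [← F.e.sum_repr ((1 : ℂ) ⊗ₜ[ℤ] x.1)]
      simp only [map_sum, conjT_smul, F.conj_e]
    rw [h] at h2
    conv_rhs => rw [h2]
    simp [Finsupp.single_apply]
  · ext i
    rw [Prod.snd_star, Pi.star_apply, tCoord_snd]
    change star (Module.Dual.baseChange ℂ x.2 (F.e i)) = Module.Dual.baseChange ℂ x.2 (F.e i)
    rw [← dual_baseChange_conj, F.conj_e]

end Frame


/-! ### Frames adapted to h -/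

variable {V : Type*} [AddCommGroup V] [Module.Free ℤ V] [Module.Finite ℤ V]

omit [Module.Free ℤ V] [Module.Finite ℤ V] in
theorem isUnit_vol_basis (vol : ⋀[ℤ]^4 V ≃ₗ[ℤ] ℤ) (b : Module.Basis (Fin 4) ℤ V) :
    IsUnit (volForm vol (wedge V (b 0) (b 1)) (wedge V (b 2) (b 3))) := by
  rw [volForm_wedge]
  have hb : (![b 0, b 1, b 2, b 3] : Fin 4 → V) = b := by ext i; fin_cases i <;> rfl
  rw [hb]
  let volA : V [⋀^Fin 4]→ₗ[ℤ] ℤ :=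
    exteriorPower.alternatingMapLinearEquiv.symm (vol : ⋀[ℤ]^4 V →ₗ[ℤ] ℤ)
  have hvolA : ∀ x, vol (exteriorPower.ιMulti ℤ 4 x) = volA x := fun x => rfl
  have hvol : volA = volA b • b.det := volA.eq_smul_basis_det b
  rw [hvolA]
  have hmap : (vol : ⋀[ℤ]^4 V →ₗ[ℤ] ℤ)
      = volA b • exteriorPower.alternatingMapLinearEquiv b.det := by
    apply exteriorPower.linearMap_ext
    ext x
    simpa [hvolA] using congrArg (fun F => F x) hvol
  have h1 := congrArg (fun F => F (vol.symm 1)) hmap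
  simp only [LinearEquiv.coe_coe, LinearEquiv.apply_symm_apply, LinearMap.smul_apply,
    smul_eq_mul] at h1
  exact IsUnit.of_mul_eq_one _ h1.symm

/-- Some pairing of l with a basis bivector is nonzero; a permutation moves it to the first place.
The orientation is corrected by the sign of the third vector, which does not affect that pairing. -/
theorem exists_basis (vol : ⋀[ℤ]^4 V ≃ₗ[ℤ] ℤ) {l : ⋀[ℤ]^2 V} (hl : l ≠ 0) :
    ∃ b : Module.Basis (Fin 4) ℤ V, volForm vol (wedge V (b 0) (b 1)) (wedge V (b 2) (b 3)) = 1 ∧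
      volForm vol l (wedge V (b 0) (b 1)) ≠ 0 := by
  have b₀ : Module.Basis (Fin 4) ℤ V := Module.finBasisOfFinrankEq ℤ V (finrank_eq_four vol)
  obtain ⟨i, k, hik⟩ : ∃ i k, volForm vol l (wedge V (b₀ i) (b₀ k)) ≠ 0 := by
    by_contra! hc
    apply hl
    apply (volForm_bijective vol).1
    rw [map_zero]
    apply exteriorPower_two_ext
    intro v w
    rw [← b₀.sum_repr v, ← b₀.sum_repr w]
    simp only [Fin.sum_univ_four, map_add, map_smul, LinearMap.add_apply, LinearMap.smul_apply, hc,
      smul_zero, add_zero, LinearMap.zero_apply]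
  have hne : i ≠ k := by
    rintro rfl
    rw [wedge_self, map_zero] at hik
    exact hik rfl
  obtain ⟨π, h0, h1⟩ : ∃ π : Equiv.Perm (Fin 4), π 0 = i ∧ π 1 = k := by
    clear hik
    revert i k
    decide
  set b₁ : Module.Basis (Fin 4) ℤ V := b₀.reindex π.symm with hb₁
  have e0 : b₁ 0 = b₀ i := by simp [hb₁, h0]
  have e1 : b₁ 1 = b₀ k := by simp [hb₁, h1]
  obtain ⟨u, hu⟩ := isUnit_vol_basis vol b₁
  refine ⟨b₁.unitsSMul ![1, 1, u, 1], ?_, ?_⟩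
  · simp only [Module.Basis.unitsSMul_apply, Matrix.cons_val, one_smul, Units.smul_def,
      map_smul, LinearMap.smul_apply, ← hu, smul_eq_mul]
    rcases Int.units_eq_one_or u with rfl | rfl <;> simp
  · simpa [Module.Basis.unitsSMul_apply, e0, e1] using hik

/-- The frame defined by an integral basis. -/
def Frame.ofBasis {vol : ⋀[ℤ]^4 V ≃ₗ[ℤ] ℤ} (b : Module.Basis (Fin 4) ℤ V)
    (hb : volForm vol (wedge V (b 0) (b 1)) (wedge V (b 2) (b 3)) = 1) : Frame vol where
  e := b.baseChange ℂ
  conj_e i := by simp [conjT_tmul]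
  vol_e := by
    simp only [Module.Basis.baseChange_apply, wedgeC_tmul, volFormC_tmul, hb]
    simp

theorem volForm_eq_pfaffian {vol : ⋀[ℤ]^4 V ≃ₗ[ℤ] ℤ} (b : Module.Basis (Fin 4) ℤ V)
    (hb : volForm vol (wedge V (b 0) (b 1)) (wedge V (b 2) (b 3)) = 1) (l : ⋀[ℤ]^2 V) :
    volForm vol l l = 2 * (volForm vol l (wedge V (b 0) (b 1)) * volForm vol l (wedge V (b 2) (b 3))
      - volForm vol l (wedge V (b 0) (b 2)) * volForm vol l (wedge V (b 1) (b 3))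
      + volForm vol l (wedge V (b 0) (b 3)) * volForm vol l (wedge V (b 1) (b 2))) := by
  set F := Frame.ofBasis b hb with hF
  have h1 := F.volFormC_eq ((1 : ℂ) ⊗ₜ l) ((1 : ℂ) ⊗ₜ l)
  have h2 : ∀ i, F.coords ((1 : ℂ) ⊗ₜ l) i
      = hodgeStar (fun k => volFormC vol ((1 : ℂ) ⊗ₜ l) (F.biv k)) i := fun i => rfl
  simp only [h2, volFormC_tmul] at h1
  simp [hodgeStar, Frame.biv, hF, Frame.ofBasis, wedgeC_tmul, volFormC_tmul] at h1
  have h3 : ((volForm vol l l : ℤ) : ℂ) = ((2 * (volForm vol l (wedge V (b 0) (b 1))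
      * volForm vol l (wedge V (b 2) (b 3))
      - volForm vol l (wedge V (b 0) (b 2)) * volForm vol l (wedge V (b 1) (b 3))
      + volForm vol l (wedge V (b 0) (b 3)) * volForm vol l (wedge V (b 1) (b 2))) : ℤ) : ℂ) := by
    rw [h1]
    push_cast
    ring
  exact_mod_cast h3

/-- Symplectic Gram–Schmidt for the alternating form (v, w) ↦ (l, v ∧ w). The number r is the square
root of its Pfaffian, half of (l, l); volume one together with equal blocks forces this value. It
may be irrational, so the frame is real and not rational. -/
theorem exists_frame (vol : ⋀[ℤ]^4 V ≃ₗ[ℤ] ℤ) {l : ⋀[ℤ]^2 V} (hl : 0 < volForm vol l l) :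
    ∃ (F : Frame vol) (r : ℝ), 0 < r ∧
      ∀ i, volFormC vol ((1 : ℂ) ⊗ₜ l) (F.biv i) = ![(r : ℂ), 0, 0, 0, 0, r] i := by
  obtain ⟨b, hb, ha⟩ := exists_basis vol (l := l) (by rintro rfl; simp at hl)
  set F := Frame.ofBasis b hb with hF
  obtain ⟨N, hN⟩ : ∃ N : Fin 6 → ℝ, N = ![(volForm vol l (wedge V (b 0) (b 1)) : ℝ), volForm vol l (wedge V (b 0) (b 2)),
    volForm vol l (wedge V (b 0) (b 3)), volForm vol l (wedge V (b 1) (b 2)),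
    volForm vol l (wedge V (b 1) (b 3)), volForm vol l (wedge V (b 2) (b 3))] := ⟨_, rfl⟩
  have hFN : ∀ i, volFormC vol ((1 : ℂ) ⊗ₜ l) (F.biv i) = N i := by
    intro i
    fin_cases i <;>
      simp [Frame.biv, hF, Frame.ofBasis, wedgeC_tmul, volFormC_tmul, hN]
  have hpf : (volForm vol l l : ℝ) = 2 * (N 0 * N 5 - N 1 * N 4 + N 2 * N 3) := by
    rw [volForm_eq_pfaffian b hb, hN]
    simp
  set P : ℝ := N 0 * N 5 - N 1 * N 4 + N 2 * N 3 with hP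
  have hP0 : 0 < P := by
    have : (0 : ℝ) < volForm vol l l := by exact_mod_cast hl
    linarith
  set r := Real.sqrt P with hr
  have hr0 : 0 < r := Real.sqrt_pos.2 hP0
  have hr2 : (r : ℂ) * r = N 0 * N 5 - N 1 * N 4 + N 2 * N 3 := by
    have := Real.mul_self_sqrt hP0.le
    rw [← hr] at this
    exact_mod_cast this
  have ha' : (N 0 : ℂ) ≠ 0 := by
    have : N 0 ≠ 0 := by simpa [hN] using ha
    exact_mod_cast this
  have hrc : (r : ℂ) ≠ 0 := by exact_mod_cast hr0.ne'
  set e : Fin 4 → ℂ ⊗[ℤ] V := ![F.e 0, ((r / N 0 : ℝ) : ℂ) • F.e 1,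
    F.e 2 + ((N 3 / N 0 : ℝ) : ℂ) • F.e 0 - ((N 1 / N 0 : ℝ) : ℂ) • F.e 1,
    ((N 0 / r : ℝ) : ℂ) • (F.e 3 + ((N 4 / N 0 : ℝ) : ℂ) • F.e 0
      - ((N 2 / N 0 : ℝ) : ℂ) • F.e 1)] with he
  have hspan : ⊤ ≤ Submodule.span ℂ (Set.range e) := by
    have hm : ∀ i, e i ∈ Submodule.span ℂ (Set.range e) := fun i =>
      Submodule.subset_span ⟨i, rfl⟩
    have m0 : F.e 0 ∈ Submodule.span ℂ (Set.range e) := hm 0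
    have m1 : F.e 1 ∈ Submodule.span ℂ (Set.range e) := by
      have h1 := Submodule.smul_mem _ ((N 0 / r : ℝ) : ℂ) (hm 1)
      have h2 : ((N 0 / r : ℝ) : ℂ) • e 1 = F.e 1 := by
        simp only [he, Matrix.cons_val, smul_smul]
        push_cast
        rw [div_mul_div_cancel₀ hrc, div_self ha', one_smul]
      rwa [h2] at h1
    have m2 : F.e 2 ∈ Submodule.span ℂ (Set.range e) := by
      have h2 : e 2 - ((N 3 / N 0 : ℝ) : ℂ) • F.e 0 + ((N 1 / N 0 : ℝ) : ℂ) • F.e 1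
          = F.e 2 := by
        simp only [he, Matrix.cons_val]
        abel
      rw [← h2]
      exact add_mem (sub_mem (hm 2) (Submodule.smul_mem _ _ m0)) (Submodule.smul_mem _ _ m1)
    have m3 : F.e 3 ∈ Submodule.span ℂ (Set.range e) := by
      have h2 : ((r / N 0 : ℝ) : ℂ) • e 3 - ((N 4 / N 0 : ℝ) : ℂ) • F.e 0
          + ((N 2 / N 0 : ℝ) : ℂ) • F.e 1 = F.e 3 := by
        simp only [he, Matrix.cons_val, smul_smul]
        push_cast
        rw [div_mul_div_cancel₀ ha', div_self hrc, one_smul]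
        abel
      rw [← h2]
      exact add_mem (sub_mem (Submodule.smul_mem _ _ (hm 3)) (Submodule.smul_mem _ _ m0))
        (Submodule.smul_mem _ _ m1)
    rw [← F.e.span_eq, Submodule.span_le]
    rintro _ ⟨i, rfl⟩
    fin_cases i <;> assumption
  have hcard : Fintype.card (Fin 4) = Module.finrank ℂ (ℂ ⊗[ℤ] V) := by
    rw [Module.finrank_baseChange, finrank_eq_four vol, Fintype.card_fin]
  set B := basisOfTopLeSpanOfCardEqFinrank e hspan hcard with hB
  have hBe : ∀ i, B i = e i := fun i => by
    rw [hB, coe_basisOfTopLeSpanOfCardEqFinrank]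
  have hw : ∀ i, F.biv i = ![wedgeC V (F.e 0) (F.e 1), wedgeC V (F.e 0) (F.e 2),
    wedgeC V (F.e 0) (F.e 3), wedgeC V (F.e 1) (F.e 2), wedgeC V (F.e 1) (F.e 3),
    wedgeC V (F.e 2) (F.e 3)] i := fun i => rfl
  have n0 := hFN 0
  have n1 := hFN 1
  have n2 := hFN 2
  have n3 := hFN 3
  have n4 := hFN 4
  have n5 := hFN 5
  have hv := F.vol_e
  simp only [hw, Matrix.cons_val] at n0 n1 n2 n3 n4 n5
  refine ⟨⟨B, ?_, ?_⟩, r, hr0, ?_⟩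
  · intro i
    rw [hBe]
    fin_cases i <;> simp only [he, Fin.reduceFinMk, Matrix.cons_val, Fin.zero_eta, Fin.mk_one,
      map_add, map_sub, conjT_smul, F.conj_e, RCLike.star_def, Complex.conj_ofReal]
  · simp only [hBe, he, Matrix.cons_val, map_add, map_sub, map_smul, LinearMap.add_apply,
      LinearMap.sub_apply, LinearMap.smul_apply, volFormC_zero_outer, volFormC_zero_inner,
      volFormC_zero_ends, volFormC_zero_second, wedgeC_self, hv, smul_eq_mul]
    push_cast
    field_simp
    simp only [mul_zero, add_zero, map_zero]
    ring
  · intro i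
    fin_cases i <;> simp only [Frame.biv, hBe, he, Fin.reduceFinMk, Matrix.cons_val, Fin.zero_eta,
      Fin.mk_one, map_add, map_sub, map_smul, LinearMap.add_apply,
      LinearMap.sub_apply, LinearMap.smul_apply, wedgeC_self, n0, n1, n2, n3, n4, n5,
      smul_eq_mul, wedgeC_swap (F.e 1) (F.e 0), wedgeC_swap (F.e 2) (F.e 0),
      wedgeC_swap (F.e 2) (F.e 1), map_neg, map_zero] <;> push_cast <;> field_simp
    · ring
    · ring
    · ring
    · ring
    · rw [pow_two, hr2]
      ring

/-- The data of the theorem, with an adapted frame. -/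
structure Datum (V : Type*) [AddCommGroup V] [Module.Free ℤ V] [Module.Finite ℤ V] where
  /-- the volume form -/
  vol : ⋀[ℤ]^4 V ≃ₗ[ℤ] ℤ
  /-- the integer `ϑ₁` -/
  t₁ : ℤ
  /-- the integer `ϑ₂` -/
  t₂ : ℤ
  /-- the integer `ϑ₃` -/
  t₃ : ℤ
  /-- the number `m` -/
  m : ℚ
  /-- the polarization vector -/
  h : Module.Dual ℤ (⋀[ℤ]^2 V × ℤ)
  t₁_ne : t₁ ≠ 0
  t₃_ne : t₃ ≠ 0
  m_pos : 0 < m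
  t_mul : (t₁ : ℚ) * t₂ = 2 * m * (t₃ : ℚ) ^ 2
  sq_pos : 0 < dualSq vol m h
  /-- the frame -/
  frame : Frame vol
  /-- the real number such that `ι h₀ = lam (e₁ ∧ e₂ + e₃ ∧ e₄)` -/
  lam : ℝ
  lam_pos : 0 < lam
  ell_biv : ∀ i, volFormC vol ((1 : ℂ) ⊗ₜ iotaEquiv vol (h ∘ₗ LinearMap.inl ℤ _ _)) (frame.biv i)
    = ![(lam : ℂ), 0, 0, 0, 0, lam] i

theorem exists_datum (vol : ⋀[ℤ]^4 V ≃ₗ[ℤ] ℤ) (t₁ t₂ t₃ : ℤ) (h₁ : t₁ ≠ 0) (h₃ : t₃ ≠ 0)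
    (m : ℚ) (hm : 0 < m) (ht : (t₁ : ℚ) * t₂ = 2 * m * (t₃ : ℚ) ^ 2)
    (h : Module.Dual ℤ (⋀[ℤ]^2 V × ℤ)) (hh : 0 < dualSq vol m h) :
    ∃ d : Datum V, d.vol = vol ∧ d.t₁ = t₁ ∧ d.t₂ = t₂ ∧ d.t₃ = t₃ ∧ d.m = m ∧ d.h = h := by
  have hl : 0 < volForm vol (iotaEquiv vol (h ∘ₗ LinearMap.inl ℤ _ _))
      (iotaEquiv vol (h ∘ₗ LinearMap.inl ℤ _ _)) := by
    have h1 := hh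
    rw [dualSq] at h1
    have h2 : 0 ≤ m * (-(h (0, 1) : ℚ) / m) * (-(h (0, 1) : ℚ) / m) := by
      rw [mul_assoc]
      exact mul_nonneg hm.le (mul_self_nonneg _)
    have h3 := lt_of_le_of_lt h2 (sub_pos.1 h1)
    exact_mod_cast h3
  obtain ⟨F, r, hr, hF⟩ := exists_frame vol hl
  exact ⟨⟨vol, t₁, t₂, t₃, m, h, h₁, h₃, hm, ht, hh, F, r, hr, hF⟩, rfl, rfl, rfl, rfl, rfl, rfl⟩


/-! ### H^{1,0} as a Clifford kernel, and integrality of φ -/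

variable {V : Type*} [AddCommGroup V] [Module.Free ℤ V] [Module.Finite ℤ V]

theorem volFormC_iotaEquiv (vol : ⋀[ℤ]^4 V ≃ₗ[ℤ] ℤ) (f : Module.Dual ℤ (⋀[ℤ]^2 V))
    (α : ℂ ⊗[ℤ] ⋀[ℤ]^2 V) :
    volFormC vol ((1 : ℂ) ⊗ₜ iotaEquiv vol f) α = Module.Dual.baseChange ℂ f α := by
  induction α with
  | zero => simp
  | add x y hx hy => rw [map_add, map_add, hx, hy]
  | tmul z a => rw [volFormC_tmul, volForm_iotaEquiv, dual_baseChange_tmul, one_mul]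

namespace Datum

variable (d : Datum V)

/-- The vector `ι h₀`. -/
def l : ⋀[ℤ]^2 V := iotaEquiv d.vol (d.h ∘ₗ LinearMap.inl ℤ _ _)

/-- The value of `h` at `ζ`. -/
def s : ℤ := d.h (0, 1)

theorem coords_l : d.frame.coords ((1 : ℂ) ⊗ₜ d.l) = ![(d.lam : ℂ), 0, 0, 0, 0, d.lam] := by
  have h : (fun i => volFormC d.vol ((1 : ℂ) ⊗ₜ d.l) (d.frame.biv i))
      = ![(d.lam : ℂ), 0, 0, 0, 0, d.lam] := funext d.ell_biv
  change hodgeStar (fun i => volFormC d.vol ((1 : ℂ) ⊗ₜ d.l) (d.frame.biv i)) = _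
  rw [h]
  ext i
  fin_cases i <;> simp [hodgeStar]

theorem volForm_l : (volForm d.vol d.l d.l : ℝ) = 2 * d.lam ^ 2 := by
  have h := d.frame.volFormC_eq ((1 : ℂ) ⊗ₜ d.l) ((1 : ℂ) ⊗ₜ d.l)
  rw [coords_l, volFormC_tmul] at h
  have h2 : ((volForm d.vol d.l d.l : ℝ) : ℂ) = ((2 * d.lam ^ 2 : ℝ) : ℂ) := by
    simp at h
    push_cast
    rw [h]
    ring
  exact_mod_cast h2

theorem dualSq_eq : (dualSq d.vol d.m d.h : ℝ) = 2 * d.lam ^ 2 - (d.s : ℝ) ^ 2 / d.m := by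
  have hm : (d.m : ℝ) ≠ 0 := by exact_mod_cast d.m_pos.ne'
  rw [← volForm_l, dualSq]
  push_cast
  rw [l, s]
  field_simp

/-- The parameters in the adapted frame. -/
def model : Model where
  t₁ := d.t₁
  t₂ := d.t₂
  t₃ := d.t₃
  m := d.m
  lam := d.lam
  s := d.s
  m_pos := by exact_mod_cast d.m_pos
  lam_pos := d.lam_pos
  t₃_ne := by exact_mod_cast d.t₃_ne
  t_mul := by exact_mod_cast d.t_mul
  sq_pos := by
    rw [← dualSq_eq]
    exact_mod_cast d.sq_pos

theorem disc_eq : d.model.disc = ((d.t₃ ^ 2 * (d.m * dualSq d.vol d.m d.h) : ℚ) : ℝ) := by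
  rw [Model.disc, Model.c]
  push_cast
  rw [dualSq_eq]
  simp only [model]
  ring

/-- The coordinates of the period vectors. -/
abbrev kCoord : K3Space V ≃ₗ[ℂ] KCoord := d.frame.kCoord

/-- The coordinates of the vectors of `V_ℂ ⊕ V_ℂ^∨`. -/
abbrev tCoord : ((ℂ ⊗[ℤ] V) × Module.Dual ℂ (ℂ ⊗[ℤ] V)) ≃ₗ[ℂ] TCoord := d.frame.tCoord

theorem quad_kCoord (σ τ : K3Space V) :
    d.model.quad (d.kCoord σ) (d.kCoord τ) = K3Space.form d.vol d.m σ τ := by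
  rw [K3Space.form, d.frame.volFormC_eq, Model.quad_apply]
  simp [Frame.kCoord_apply, model]

theorem ell_eq : d.model.ell = d.kCoord ((1 : ℂ) ⊗ₜ d.l, -((d.s : ℂ) / d.m)) := by
  rw [Frame.kCoord_apply, coords_l, Model.ell]
  simp [model]

theorem quad_ell_kCoord (σ : K3Space V) :
    d.model.quad d.model.ell (d.kCoord σ) = K3Space.pair d.h σ := by
  have hm : (d.m : ℂ) ≠ 0 := by exact_mod_cast d.m_pos.ne'
  rw [ell_eq, quad_kCoord, K3Space.form, K3Space.pair, l, volFormC_iotaEquiv, s]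
  field_simp
  ring

theorem isPeriod_iff (σ : K3Space V) : d.model.IsPeriod (d.kCoord σ) ↔
    K3Space.form d.vol d.m σ σ = 0 ∧ 0 < (K3Space.form d.vol d.m σ (K3Space.conj σ)).re ∧
      K3Space.pair d.h σ = 0 := by
  rw [← quad_kCoord, ← quad_kCoord, ← quad_ell_kCoord, Frame.kCoord_conj]
  exact ⟨fun h => ⟨h.isotropic, h.pos, h.perp⟩, fun h => ⟨h.1, h.2.1, h.2.2⟩⟩

theorem antisymMap_apply (α : ℂ ⊗[ℤ] ⋀[ℤ]^2 V) (x y : ℂ ⊗[ℤ] V) :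
    antisymMap d.vol α x y = volFormC d.vol α (wedgeC V y x) := rfl

theorem clifford_tCoord_snd (σ : K3Space V) (x : (ℂ ⊗[ℤ] V) × Module.Dual ℂ (ℂ ⊗[ℤ] V))
    (i : Fin 4) : (d.model.clifford (d.kCoord σ) (d.tCoord x)).2 i
      = d.t₁ * antisymMap d.vol σ.1 x.1 (d.frame.e i) + d.m * d.t₃ * σ.2 * x.2 (d.frame.e i) := by
  rw [antisymMap_apply, ← d.frame.contract_hodgeStar, Model.clifford_apply,
    ← Frame.tCoord_snd]
  simp only [model, Frame.kCoord_apply]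
  rfl

theorem clifford_tCoord_fst (σ : K3Space V) (x : (ℂ ⊗[ℤ] V) × Module.Dual ℂ (ℂ ⊗[ℤ] V))
    (i : Fin 4) : (d.model.clifford (d.kCoord σ) (d.tCoord x)).1 i
      = -(d.m * d.t₃ * σ.2) * (d.tCoord x).1 i
        + d.t₂ * contract (d.kCoord σ).1 (d.tCoord x).2 i := by
  rw [Model.clifford_apply]
  simp only [model, Frame.kCoord_apply]
  push_cast
  rfl

theorem t₂_ne : d.t₂ ≠ 0 := by
  intro h
  have h1 := d.t_mul
  rw [h, Int.cast_zero, mul_zero] at h1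
  have h2 : (0 : ℚ) < 2 * d.m * (d.t₃ : ℚ) ^ 2 := by
    have := d.m_pos
    have : (d.t₃ : ℚ) ≠ 0 := by exact_mod_cast d.t₃_ne
    positivity
  linarith

theorem contract_skew (a : Fin 6 → ℂ) (k k' : Fin 4 → ℂ) :
    ∑ i, k i * contract a k' i = -∑ i, contract a k i * k' i := by
  simp [contract, Fin.sum_univ_four]
  ring

/-- If x ≠ 0, the V^∨-component of σ·(v, g) = 0 solves for g in terms of v; the factor ϑ₁/(mϑ₃)
equals 2ϑ₃/ϑ₂, which gives the normalization of the graph. If x = 0, the equations for v and g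
separate and define U and its annihilator. -/
theorem hodge10_eq {σ : K3Space V} (h0 : σ ≠ 0) (h : K3Space.form d.vol d.m σ σ = 0) :
    hodge10 d.vol d.t₂ d.t₃ σ = (d.model.ker (d.kCoord σ)).comap d.tCoord.toLinearMap := by
  have hm : (d.m : ℂ) ≠ 0 := by exact_mod_cast d.m_pos.ne'
  have ht1 : (d.t₁ : ℂ) ≠ 0 := by exact_mod_cast d.t₁_ne
  have ht2 : (d.t₂ : ℂ) ≠ 0 := by exact_mod_cast d.t₂_ne
  have ht3 : (d.t₃ : ℂ) ≠ 0 := by exact_mod_cast d.t₃_ne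
  have htm : (d.t₁ : ℂ) * d.t₂ = 2 * d.m * (d.t₃ : ℂ) ^ 2 := by
    have := d.t_mul
    exact_mod_cast this
  have hk0 : d.kCoord σ ≠ 0 := by simpa using h0
  have hk : d.model.quad (d.kCoord σ) (d.kCoord σ) = 0 := by rw [quad_kCoord, h]
  ext x
  rw [Submodule.mem_comap, Model.mem_ker, hodge10, LinearEquiv.coe_coe]
  split_ifs with hx
  · rw [LinearMap.mem_graph_iff]
    have hsnd : (d.model.clifford (d.kCoord σ) (d.tCoord x)).2 = 0 ↔
        x.2 = antisymMap d.vol ((-2 * (d.t₃ : ℂ) / ((d.t₂ : ℂ) * σ.2)) • σ.1) x.1 := by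
      have key : ∀ i, (d.model.clifford (d.kCoord σ) (d.tCoord x)).2 i
          = d.m * d.t₃ * σ.2 * (x.2 (d.frame.e i)
            - antisymMap d.vol ((-2 * (d.t₃ : ℂ) / ((d.t₂ : ℂ) * σ.2)) • σ.1) x.1 (d.frame.e i)) := by
        intro i
        rw [clifford_tCoord_snd, antisymMap_apply, antisymMap_apply, map_smul,
          LinearMap.smul_apply, smul_eq_mul]
        field_simp
        linear_combination (volFormC d.vol σ.1 (wedgeC V (d.frame.e i) x.1)) * htm
      constructor
      · intro h0
        apply d.frame.e.ext
        intro i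
        have := congrFun h0 i
        rw [key, Pi.zero_apply, mul_eq_zero, sub_eq_zero] at this
        exact this.resolve_left (mul_ne_zero (mul_ne_zero hm ht3) hx)
      · intro h0
        ext i
        rw [key, h0, sub_self, mul_zero, Pi.zero_apply]
    rw [← hsnd]
    constructor
    · intro h2
      refine Prod.ext ?_ h2
      -- The V-component comes for free: applying σ once more gives zero, and on a vector without
      -- V^∨-part its V-component is multiplication by a nonzero scalar.
      have h3 := Model.clifford_clifford_self (μ := d.model) (d.kCoord σ) (d.tCoord x)
      rw [hk, mul_zero, neg_zero, zero_smul] at h3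
      ext i
      have h4 := congrFun (congrArg Prod.fst h3) i
      rw [Model.clifford_apply d.model (d.kCoord σ) (d.model.clifford _ _), h2] at h4
      have h5 : contract (d.kCoord σ).1 0 = 0 := by
        ext i
        fin_cases i <;> simp [contract]
      simp only [h5] at h4
      simp only [Pi.zero_apply, mul_zero, add_zero, model, Prod.fst_zero, mul_eq_zero,
        neg_eq_zero] at h4
      rcases h4 with ((h4 | h4) | h4) | h4
      · exact absurd h4 (by simpa using hm)
      · exact absurd h4 (by simpa using ht3)
      · exact absurd h4 hx
      · exact h4
    · intro h2
      rw [h2]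
      rfl
  · have hx : σ.2 = 0 := not_not.1 hx
    have hker : ∀ w, w ∈ LinearMap.ker (antisymMap d.vol σ.1) ↔
        d.model.clifford (d.kCoord σ) (d.tCoord (w, 0)) = 0 := by
      intro w
      have key : ∀ i, (d.model.clifford (d.kCoord σ) (d.tCoord (w, 0))).2 i
          = d.t₁ * antisymMap d.vol σ.1 w (d.frame.e i) := by
        intro i
        rw [clifford_tCoord_snd]
        simp
      rw [LinearMap.mem_ker]
      constructor
      · intro hw
        refine Prod.ext ?_ ?_
        · ext i
          rw [clifford_tCoord_fst, hx]
          have : (d.tCoord (w, 0)).2 = 0 := by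
            ext i
            rw [Frame.tCoord_snd]
            simp
          rw [this]
          fin_cases i <;> simp [contract]
        · ext i
          rw [key, hw]
          simp
      · intro hw
        apply d.frame.e.ext
        intro i
        have := key i
        rw [hw] at this
        simpa [ht1] using this.symm
    rw [Submodule.mem_prod, hker, Submodule.mem_dualAnnihilator]
    have hfst : ∀ y : (ℂ ⊗[ℤ] V) × Module.Dual ℂ (ℂ ⊗[ℤ] V),
        ((d.model.clifford (d.kCoord σ) (d.tCoord y)).1 = 0 ↔
          contract (d.kCoord σ).1 (d.tCoord y).2 = 0) := by
      intro y
      constructor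
      · intro h1
        ext i
        have := congrFun h1 i
        rw [clifford_tCoord_fst, hx] at this
        simpa [ht2] using this
      · intro h1
        ext i
        rw [clifford_tCoord_fst, hx, h1]
        simp
    have hann : (∀ w ∈ LinearMap.ker (antisymMap d.vol σ.1), x.2 w = 0) ↔
        contract (d.kCoord σ).1 (d.tCoord x).2 = 0 := by
      have hsum : ∀ w, x.2 w = ∑ i, (d.tCoord x).2 i * (d.tCoord (w, 0)).1 i := by
        intro w
        have := d.frame.pairing_tCoord x (w, 0)
        rw [pairing_apply] at this
        simp only [LinearMap.zero_apply, add_zero] at this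
        rw [← this]
        refine Finset.sum_congr rfl fun i _ => ?_
        have : (d.tCoord (w, 0)).2 i = 0 := by
          rw [Frame.tCoord_snd]
          simp
        rw [this, zero_mul, add_zero]
      constructor
      · intro h1
        -- As α is isotropic, U contains all contractions of covectors with α. Contraction is skew,
        -- so annihilating all of them means that the contraction of `x.2` with α is zero.
        have h2 : ∀ k : Fin 4 → ℂ, ∑ i, contract (d.kCoord σ).1 (d.tCoord x).2 i * k i = 0 := by
          intro k
          set w : ℂ ⊗[ℤ] V := (d.tCoord.symm (contract (d.kCoord σ).1 k, 0)).1 with hw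
          have hwT : d.tCoord (w, 0) = (contract (d.kCoord σ).1 k, 0) := by
            have hz : (d.tCoord.symm (contract (d.kCoord σ).1 k, 0)).2 = 0 := by
              apply d.frame.e.ext
              intro i
              rw [← Frame.tCoord_snd]
              simp
            rw [hw, ← hz]
            simp
          have hwk : w ∈ LinearMap.ker (antisymMap d.vol σ.1) := by
            rw [hker, hwT]
            have h3 := Model.clifford_clifford_self (μ := d.model) (d.kCoord σ) (0, k)
            rw [hk, mul_zero, neg_zero, zero_smul] at h3
            have h4 : d.model.clifford (d.kCoord σ) (0, k)
                = (d.t₂ : ℂ) • (contract (d.kCoord σ).1 k, (0 : Fin 4 → ℂ)) := by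
              rw [Model.clifford_apply]
              refine Prod.ext ?_ ?_ <;> ext i
              · simp [model]
              · fin_cases i <;> simp [contract, Frame.kCoord_apply, hx]
            rw [h4, map_smul, smul_eq_zero] at h3
            exact h3.resolve_left ht2
          have h5 := h1 w hwk
          rw [hsum, hwT] at h5
          simp only at h5
          rw [contract_skew, neg_eq_zero] at h5
          exact h5
        ext i
        simpa [Pi.single_apply] using h2 (Pi.single i 1)
      · intro h1 w hw
        rw [hker] at hw
        have h3 : d.tCoord (w, 0) ∈ d.model.ker (d.kCoord σ) := hw
        -- Conversely, kernel equals image shows that U consists of contractions of α.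
        rw [← Model.range_clifford hk0 hk] at h3
        obtain ⟨y, hy⟩ := h3
        have h4 : ∀ i, (d.tCoord (w, 0)).1 i = d.t₂ * contract (d.kCoord σ).1 y.2 i := by
          intro i
          rw [← hy, Model.clifford_apply]
          simp [model, Frame.kCoord_apply, hx]
        rw [hsum]
        simp only [h4, mul_left_comm _ (d.t₂ : ℂ)]
        rw [← Finset.mul_sum, contract_skew, h1]
        simp
    rw [hann, ← hfst]
    have hadd : d.model.clifford (d.kCoord σ) (d.tCoord x)
        = ((d.model.clifford (d.kCoord σ) (d.tCoord x)).1,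
          (d.model.clifford (d.kCoord σ) (d.tCoord (x.1, 0))).2) := by
      refine Prod.ext rfl ?_
      ext i
      rw [clifford_tCoord_snd, clifford_tCoord_snd, hx]
      simp
    constructor
    · rintro ⟨h1, h2⟩
      rw [hadd, h1, h2]
      rfl
    · intro h1
      refine ⟨?_, by rw [h1]; rfl⟩
      refine Prod.ext ?_ ?_
      · refine (hfst _).2 ?_
        have : (d.tCoord (x.1, 0)).2 = 0 := by
          ext i
          rw [Frame.tCoord_snd]
          simp
        rw [this]
        ext i
        fin_cases i <;> simp [contract]
      · have h2 := congrArg Prod.snd (hadd.symm.trans h1)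
        exact h2

/-- Contraction of a covector with the bivector `l`. -/
def contractL : Module.Dual ℤ V →ₗ[ℤ] V :=
  (Module.evalEquiv ℤ V).symm.toLinearMap ∘ₗ
    ((iotaWedge d.vol).flip.compr₂ ((volForm d.vol).flip d.l))

theorem apply_contractL (g k : Module.Dual ℤ V) :
    g (d.contractL k) = volForm d.vol (iotaWedge d.vol g k) d.l := by
  have := (Module.apply_evalEquiv_symm_apply (R := ℤ) (M := V) g
    (((iotaWedge d.vol).flip.compr₂ ((volForm d.vol).flip d.l)) k))
  exact this

/-- The alternating form defined by `l` as a map from `V` to its dual. -/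
def formL : V →ₗ[ℤ] Module.Dual ℤ V := ((wedge V).compr₂ (volForm d.vol d.l)).flip

theorem formL_apply (v w : V) : d.formL v w = volForm d.vol d.l (wedge V w v) := rfl

/-- The endomorphism of `V ⊕ V^∨`. -/
def phiZ : Module.End ℤ (V × Module.Dual ℤ V) :=
  LinearMap.prod
    ((d.s * d.t₃) • LinearMap.fst ℤ _ _ + d.t₂ • (d.contractL ∘ₗ LinearMap.snd ℤ _ _))
    (d.t₁ • (d.formL ∘ₗ LinearMap.fst ℤ _ _) - (d.s * d.t₃) • LinearMap.snd ℤ _ _)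

theorem phiZ_apply (x : V × Module.Dual ℤ V) : d.phiZ x =
    ((d.s * d.t₃) • x.1 + d.t₂ • d.contractL x.2, d.t₁ • d.formL x.1 - (d.s * d.t₃) • x.2) := rfl

theorem h_apply (α : ⋀[ℤ]^2 V) (x : ℤ) : d.h (α, x) = volForm d.vol d.l α + d.s * x := by
  have h1 : d.h (α, x) = d.h (α, 0) + d.h (0, x) := by
    rw [← map_add]
    simp
  have h2 : d.h (0, x) = x * d.h (0, 1) := by
    have : ((0 : ⋀[ℤ]^2 V), x) = x • ((0 : ⋀[ℤ]^2 V), (1 : ℤ)) := by simp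
    rw [this, map_smul, smul_eq_mul]
  rw [h1, h2, l, volForm_iotaEquiv, s, mul_comm x]
  rfl

/-- The polarization form of the datum. -/
abbrev form : (V × Module.Dual ℤ V) →ₗ[ℤ] (V × Module.Dual ℤ V) →ₗ[ℤ] ℚ :=
  polForm d.vol d.t₁ d.t₂ d.t₃ d.h

theorem form_apply (x y : V × Module.Dual ℤ V) : d.form x y =
    ((d.t₁ * volForm d.vol d.l (wedge V x.1 y.1) + d.t₂ * volForm d.vol d.l
      (iotaWedge d.vol x.2 y.2) + d.s * (d.t₃ * (x.2 y.1 - y.2 x.1)) : ℤ) : ℚ) := by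
  have : d.form x y = ((d.h (Phi d.vol d.t₁ d.t₂ d.t₃ x y) : ℤ) : ℚ) := rfl
  rw [this, Phi, LinearMap.mk₂_apply, h_apply, map_add, map_smul, map_smul]
  simp only [smul_eq_mul]

/-- This identity characterizes φ: the polarization form is written through the natural pairing of V
⊕ V^∨, which is unimodular, so the resulting endomorphism is integral. -/
theorem form_eq_pairing (x y : V × Module.Dual ℤ V) :
    d.form x y = ((x.2 (d.phiZ y).1 + (d.phiZ y).2 x.1 : ℤ) : ℚ) := by
  rw [form_apply]
  congr 1
  simp only [phiZ_apply, LinearMap.smul_apply, LinearMap.sub_apply, map_add,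
    map_smul, apply_contractL, formL_apply, smul_eq_mul, volForm_comm d.vol _ d.l]
  ring

theorem alt_lattice (x y : V × Module.Dual ℤ V) :
    d.model.alt (d.tCoord (latticeMap V x)) (d.tCoord (latticeMap V y)) = (d.form x y : ℂ) := by
  have hg : ∀ (g k : Module.Dual ℤ V), ∑ i, Module.Dual.baseChange ℂ g (d.frame.e i)
      * contract (d.frame.coords ((1 : ℂ) ⊗ₜ d.l))
        (fun j => Module.Dual.baseChange ℂ k (d.frame.e j)) i
      = volForm d.vol d.l (iotaWedge d.vol g k) := by
    intro g k
    rw [d.frame.sum_mul_contract, dual_baseChange_tmul, mul_one, volForm_comm, iotaWedge,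
      LinearMap.compr₂_apply, LinearMap.comp_apply, LinearEquiv.coe_coe, volForm_iotaEquiv]
  have hN : ∀ v w : V, ∑ i, d.frame.e.repr ((1 : ℂ) ⊗ₜ v) i
      * contract (hodgeStar (d.frame.coords ((1 : ℂ) ⊗ₜ d.l)))
        (fun j => d.frame.e.repr ((1 : ℂ) ⊗ₜ w) j) i = volForm d.vol d.l (wedge V v w) := by
    intro v w
    simp only [d.frame.contract_hodgeStar]
    have h1 : volFormC d.vol ((1 : ℂ) ⊗ₜ d.l) (wedgeC V ((1 : ℂ) ⊗ₜ v) ((1 : ℂ) ⊗ₜ w))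
        = volForm d.vol d.l (wedge V v w) := by
      rw [wedgeC_tmul, volFormC_tmul]
      simp
    rw [← h1]
    conv_rhs => rw [← d.frame.e.sum_repr ((1 : ℂ) ⊗ₜ[ℤ] v)]
    simp only [map_sum, map_smul, LinearMap.sum_apply, LinearMap.smul_apply, smul_eq_mul]
  have hP : ∀ (g : Module.Dual ℤ V) (w : V), ∑ i, Module.Dual.baseChange ℂ g (d.frame.e i)
      * d.frame.e.repr ((1 : ℂ) ⊗ₜ w) i = (g w : ℂ) := by
    intro g w
    have h1 : (g w : ℂ) = Module.Dual.baseChange ℂ g ((1 : ℂ) ⊗ₜ w) := by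
      rw [dual_baseChange_tmul, mul_one]
    rw [h1]
    conv_rhs => rw [← d.frame.e.sum_repr ((1 : ℂ) ⊗ₜ[ℤ] w)]
    simp only [map_sum, map_smul, smul_eq_mul]
    exact Finset.sum_congr rfl fun i _ => mul_comm _ _
  have hm : (d.m : ℂ) ≠ 0 := by exact_mod_cast d.m_pos.ne'
  rw [Model.alt, Model.phi, pairing_apply, ell_eq, form_apply]
  have e1 : ∀ i, (d.tCoord (latticeMap V x)).1 i = d.frame.e.repr ((1 : ℂ) ⊗ₜ[ℤ] x.1) i :=
    fun i => rfl
  have e1' : ∀ i, (d.tCoord (latticeMap V y)).1 i = d.frame.e.repr ((1 : ℂ) ⊗ₜ[ℤ] y.1) i :=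
    fun i => rfl
  have e2 : ∀ i, (d.tCoord (latticeMap V x)).2 i
    = Module.Dual.baseChange ℂ x.2 (d.frame.e i) := fun i => d.frame.tCoord_snd _ i
  have e2' : ∀ i, (d.tCoord (latticeMap V y)).2 i
    = Module.Dual.baseChange ℂ y.2 (d.frame.e i) := fun i => d.frame.tCoord_snd _ i
  have e1f : (d.tCoord (latticeMap V y)).1 = fun i => d.frame.e.repr ((1 : ℂ) ⊗ₜ[ℤ] y.1) i :=
    funext e1'
  have e2f : (d.tCoord (latticeMap V y)).2
    = fun i => Module.Dual.baseChange ℂ y.2 (d.frame.e i) := funext e2'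
  rw [Model.clifford_apply]
  simp only [Frame.kCoord_apply, e1, e2]
  rw [e1f, e2f]
  push_cast
  rw [← hg, ← hN, ← hP, ← hP]
  simp only [model, Finset.mul_sum, ← Finset.sum_add_distrib, ← Finset.sum_sub_distrib]
  refine Finset.sum_congr rfl fun i _ => ?_
  push_cast
  field_simp
  ring

omit [Module.Free ℤ V] [Module.Finite ℤ V] in
theorem _root_.WeilTori.latticeMap_apply (x : V × Module.Dual ℤ V) :
    latticeMap V x = ((1 : ℂ) ⊗ₜ x.1, Module.Dual.baseChange ℂ x.2) := rfl

/-- The complex basis of `V_ℂ ⊕ V_ℂ^∨` defined by an integral basis. -/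
theorem exists_lattice_basis (V : Type*) [AddCommGroup V] [Module.Free ℤ V] [Module.Finite ℤ V]
    (hV : Module.finrank ℤ V = 4) :
    ∃ (b : Module.Basis (Fin 8) ℤ (V × Module.Dual ℤ V))
      (B : Module.Basis (Fin 8) ℂ ((ℂ ⊗[ℤ] V) × Module.Dual ℂ (ℂ ⊗[ℤ] V))),
      ∀ i, B i = latticeMap V (b i) := by
  let b : Module.Basis (Fin 4) ℤ V := Module.finBasisOfFinrankEq ℤ V hV
  refine ⟨(b.prod b.dualBasis).reindex finSumFinEquiv,
    ((b.baseChange ℂ).prod (b.baseChange ℂ).dualBasis).reindex finSumFinEquiv, fun i => ?_⟩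
  rw [Module.Basis.reindex_apply, Module.Basis.reindex_apply]
  cases (finSumFinEquiv (m := 4) (n := 4)).symm i with
  | inl k =>
    rw [Module.Basis.prod_apply, Module.Basis.prod_apply]
    refine Prod.ext ?_ ?_ <;> simp [latticeMap_apply]
  | inr k =>
    rw [Module.Basis.prod_apply, Module.Basis.prod_apply]
    refine Prod.ext ?_ ?_
    · simp [latticeMap_apply]
    · apply (b.baseChange ℂ).ext
      intro j
      simp [latticeMap_apply, Finsupp.single_apply]

/-- By `alt_lattice` and `form_eq_pairing` both sides have the same pairing with every lattice
vector, and lattice vectors span. -/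
theorem phi_lattice (x : V × Module.Dual ℤ V) :
    d.model.phi (d.tCoord (latticeMap V x)) = d.tCoord (latticeMap V (d.phiZ x)) := by
  obtain ⟨b, B, hB⟩ := exists_lattice_basis V (finrank_eq_four d.vol)
  rw [← sub_eq_zero]
  apply eq_zero_of_pairing
  intro y
  rw [pairing_symm]
  have h : ∀ y, pairing (d.tCoord y) (d.model.phi (d.tCoord (latticeMap V x))
      - d.tCoord (latticeMap V (d.phiZ x))) = 0 := by
    intro y
    rw [← B.sum_repr y]
    simp only [map_sum, LinearMap.sum_apply, map_smul, LinearMap.smul_apply]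
    refine Finset.sum_eq_zero fun i _ => ?_
    rw [hB, map_sub, d.frame.pairing_tCoord]
    have := d.alt_lattice (b i) x
    rw [Model.alt, form_eq_pairing] at this
    rw [this]
    simp [latticeMap_apply]
  simpa using h (d.tCoord.symm y)

end Datum


/-! ### The Riemann relations for the torus of a period -/

namespace Model

variable {μ : Model}

/-- The projection to the conjugate of `ker σ` along `ker σ`. -/
def proj (μ : Model) (σ : KCoord) : TCoord →ₗ[ℂ] TCoord :=
  (-(2 * μ.c * μ.quad σ (star σ) : ℂ))⁻¹ • (μ.clifford (star σ) ∘ₗ μ.clifford σ)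

namespace IsPeriod

variable {σ : KCoord} (h : μ.IsPeriod σ)

theorem proj_of_mem {t : TCoord} (ht : t ∈ μ.ker σ) : μ.proj σ t = 0 := by
  rw [proj, LinearMap.smul_apply, LinearMap.comp_apply, mem_ker.1 ht, map_zero, smul_zero]

include h

theorem clifford_self (t : TCoord) : μ.clifford σ (μ.clifford σ t) = 0 := by
  rw [clifford_clifford_self, h.isotropic, mul_zero, neg_zero, zero_smul]

/-- Since σσ̄ + σ̄σ is a nonzero scalar, each t is the sum of an element of the image of σ and one
of the image of σ̄; these images lie in the kernels of σ and σ̄. -/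
theorem sub_proj_mem (t : TCoord) : t - μ.proj σ t ∈ μ.ker σ := by
  have hκ0 : -(2 * μ.c * μ.quad σ (star σ) : ℂ) ≠ 0 :=
    neg_ne_zero.2 (mul_ne_zero (mul_ne_zero two_ne_zero c_ne) h.quad_star_ne)
  have h1 : t - μ.proj σ t = (-(2 * μ.c * μ.quad σ (star σ) : ℂ))⁻¹ •
      μ.clifford σ (μ.clifford (star σ) t) := by
    have h2 := clifford_add (μ := μ) σ (star σ) t
    rw [eq_sub_of_add_eq h2, smul_sub, smul_smul, inv_mul_cancel₀ hκ0, one_smul]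
    rfl
  rw [h1, mem_ker, map_smul, h.clifford_self, smul_zero]

theorem star_proj_mem (t : TCoord) : star (μ.proj σ t) ∈ μ.ker σ := by
  rw [proj, LinearMap.smul_apply, LinearMap.comp_apply, mem_ker, star_smul, map_smul,
    star_clifford, star_star, h.clifford_self, smul_zero]

theorem proj_eq_zero_iff {t : TCoord} : μ.proj σ t = 0 ↔ t ∈ μ.ker σ := by
  refine ⟨fun h1 => ?_, proj_of_mem⟩
  simpa [h1] using h.sub_proj_mem t

theorem eq_add_star {t : TCoord} (ht : star t = t) : t = μ.proj σ t + star (μ.proj σ t) := by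
  rw [← sub_eq_zero]
  have h1 : t - (μ.proj σ t + star (μ.proj σ t)) ∈ μ.ker σ := by
    rw [← sub_sub]
    exact (μ.ker σ).sub_mem (h.sub_proj_mem t) (h.star_proj_mem t)
  apply h.eq_zero_of_star_mem h1
  rwa [star_sub, star_add, star_star, ht, add_comm]

theorem proj_star {u : TCoord} (hu : u ∈ μ.ker σ) : μ.proj σ (star u) = star u := by
  rw [eq_comm, ← sub_eq_zero]
  apply h.eq_zero_of_star_mem (h.sub_proj_mem _)
  rw [star_sub, star_star]
  exact (μ.ker σ).sub_mem hu (h.star_proj_mem _)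

end IsPeriod

theorem posForm_star (u : TCoord) : μ.posForm (star u) = -μ.posForm u := by
  rw [posForm, star_star, alt_neg, posForm, Complex.neg_im]

/-- The real bilinear form `2 Re alt (q x) (star (q y))`. -/
def realForm {W : Type*} [AddCommGroup W] [Module ℂ W] (μ : Model) (q : W →ₗ[ℂ] TCoord) :
    W →ₗ[ℝ] W →ₗ[ℝ] ℝ :=
  LinearMap.mk₂ ℝ (fun x y => 2 * (μ.alt (q x) (star (q y))).re)
    (fun x y z => by rw [map_add, alt_add_left, Complex.add_re]; ring)
    (fun r x y => by
      rw [← Complex.coe_smul, map_smul, alt_smul_left, Complex.re_ofReal_mul, smul_eq_mul]; ring)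
    (fun x y z => by rw [map_add, star_add, alt_add_right, Complex.add_re]; ring)
    (fun r x y => by
      rw [← Complex.coe_smul, map_smul, star_smul, alt_smul_right, RCLike.star_def,
        Complex.conj_ofReal, Complex.re_ofReal_mul, smul_eq_mul]; ring)

theorem realForm_apply {W : Type*} [AddCommGroup W] [Module ℂ W] (q : W →ₗ[ℂ] TCoord) (x y : W) :
    μ.realForm q x y = 2 * (μ.alt (q x) (star (q y))).re := rfl

/-- The map q identifies W with the conjugate of the kernel of σ. As `alt` vanishes on the kernel
and on its conjugate, E becomes 2 Re alt(qx, conjugate of qy), which is automatically of type (1,1).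
The lattice spans W over ℝ, so the real extension is unique and only positivity remains. -/
theorem isPolarization_iff {Λ W : Type*} [AddCommGroup Λ] [AddCommGroup W] [Module ℂ W]
    {j : Λ →ₗ[ℤ] W} {n : ℕ} (hj : IsComplexTorus n j) {E : Λ →ₗ[ℤ] Λ →ₗ[ℤ] ℚ}
    {σ : KCoord} (h : μ.IsPeriod σ) (q : W →ₗ[ℂ] TCoord) (hq : Function.Injective q)
    (hqσ : ∀ w, star (q w) ∈ μ.ker σ) (hqs : ∀ u ∈ μ.ker σ, ∃ w, q w = star u)
    (hE : ∀ x y, μ.alt (q (j x) + star (q (j x))) (q (j y) + star (q (j y))) = (E x y : ℂ)) :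
    IsPolarization j E ↔ ∀ u ∈ μ.ker σ, u ≠ 0 → 0 < μ.posForm u := by
  have hEj : ∀ x y, μ.realForm q (j x) (j y) = (E x y : ℝ) := by
    intro x y
    have h1 := hE x y
    have h3 : μ.alt (q (j x)) (q (j y)) = 0 := by
      have := star_alt (μ := μ) (q (j x)) (q (j y))
      rwa [h.alt_eq_zero (hqσ _) (hqσ _), star_eq_zero] at this
    rw [alt_add_left, alt_add_right, alt_add_right, h.alt_eq_zero (hqσ _) (hqσ _), h3, zero_add,
      add_zero] at h1
    have h2 := star_alt (μ := μ) (q (j x)) (star (q (j y)))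
    rw [star_star] at h2
    rw [← h2] at h1
    have h4 := congrArg Complex.re h1
    rw [realForm_apply]
    simp at h4
    rw [← h4]
    ring
  have hpos : ∀ v, μ.realForm q (Complex.I • v) v = 2 * μ.posForm (star (q v)) := by
    intro v
    rw [realForm_apply, map_smul, alt_smul_left, alt_self_star, posForm_star]
    simp
  constructor
  · rintro ⟨ER, h1, -, -, h4⟩ u hu hu0
    obtain ⟨b, B, hB⟩ := hj
    have hER : ER = μ.realForm q := by
      apply B.ext
      intro i
      apply B.ext
      intro k
      rw [hB, hB, h1, hEj]
    obtain ⟨w, hw⟩ := hqs u hu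
    have h5 := h4 w (by rintro rfl; rw [map_zero, eq_comm, star_eq_zero] at hw; exact hu0 hw)
    rw [hER, hpos, hw, star_star] at h5
    linarith
  · intro hp
    refine ⟨μ.realForm q, hEj, ?_, ?_, ?_⟩
    · intro v
      rw [realForm_apply, alt_self_star]
      simp
    · intro v w
      rw [realForm_apply, realForm_apply, map_smul, map_smul, star_smul, alt_smul_left,
        alt_smul_right, ← mul_assoc]
      simp
    · intro v hv
      rw [hpos]
      have := hp _ (hqσ v) (by
        rw [Ne, star_eq_zero]
        exact fun h0 => hv (hq (h0.trans (map_zero _).symm)))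
      linarith

end Model

theorem isComplexTorus_of {Λ W : Type*} [AddCommGroup Λ] [AddCommGroup W] [Module ℂ W]
    [FiniteDimensional ℂ W] {j : Λ →ₗ[ℤ] W} {n : ℕ} (b : Module.Basis (Fin (2 * n)) ℤ Λ)
    (hW : Module.finrank ℂ W = n)
    (hli : ∀ r : Fin (2 * n) → ℝ, ∑ i, (r i : ℂ) • j (b i) = 0 → r = 0) : IsComplexTorus n j := by
  have h1 : LinearIndependent ℝ (fun i => j (b i)) := by
    rw [Fintype.linearIndependent_iff]
    intro r hr i
    have : ∑ i, (r i : ℂ) • j (b i) = 0 := by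
      rw [← hr]
      exact Finset.sum_congr rfl fun i _ => Complex.coe_smul _ _
    exact congrFun (hli r this) i
  have h2 : Fintype.card (Fin (2 * n)) = Module.finrank ℝ W := by
    rw [finrank_real_of_complex, hW, Fintype.card_fin]
  rcases Nat.eq_zero_or_pos n with rfl | hn
  · have : Subsingleton W := Module.finrank_zero_iff.1 hW
    have : IsEmpty (Fin (2 * 0)) := inferInstanceAs (IsEmpty (Fin 0))
    exact ⟨b, Module.Basis.empty W, fun i => Subsingleton.elim _ _⟩
  · have : Nonempty (Fin (2 * n)) := ⟨⟨0, by omega⟩⟩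
    exact ⟨b, basisOfLinearIndependentOfCardEqFinrank h1 h2, fun i => by simp⟩


/-! ### The tori J: Weil type and determinant -/

variable {V : Type*} [AddCommGroup V] [Module.Free ℤ V] [Module.Finite ℤ V]

namespace Datum

variable (d : Datum V)

theorem latticeMap_injective (hV : Module.finrank ℤ V = 4) :
    Function.Injective (latticeMap V) := by
  obtain ⟨b, B, hB⟩ := exists_lattice_basis V hV
  rw [← LinearMap.ker_eq_bot, LinearMap.ker_eq_bot']
  intro x hx
  rw [← b.sum_repr x] at hx ⊢
  simp only [map_sum, map_smul, ← hB] at hx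
  have h1 : ∑ i, (b.repr x i : ℂ) • B i = 0 := by
    rw [← hx]
    exact Finset.sum_congr rfl fun i _ => Int.cast_smul_eq_zsmul ℂ _ _
  have h2 := Fintype.linearIndependent_iff.1 B.linearIndependent _ h1
  refine Finset.sum_eq_zero fun i _ => ?_
  have : b.repr x i = 0 := by exact_mod_cast h2 i
  rw [this, zero_smul]

/-- The square of the integral endomorphism `phiZ` is the scalar -disc, so this number is an integer
although m is only rational. -/
theorem exists_disc : ∃ D : ℕ, 0 < D ∧ (D : ℝ) = d.model.disc := by
  obtain ⟨b, B, hB⟩ := exists_lattice_basis V (finrank_eq_four d.vol)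
  have h1 : latticeMap V (d.phiZ (d.phiZ (b 0))) = (-(d.model.disc : ℂ)) • B 0 := by
    apply d.tCoord.injective
    rw [← phi_lattice, ← phi_lattice, Model.phi_phi, map_smul, hB]
  rw [← b.sum_repr (d.phiZ (d.phiZ (b 0)))] at h1
  simp only [map_sum, map_smul, ← hB] at h1
  set n := b.repr (d.phiZ (d.phiZ (b 0))) 0 with hn
  have h2 := congrArg (fun z => B.repr z 0) h1
  simp only [map_sum, map_smul, map_zsmul, Module.Basis.repr_self] at h2
  simp [Finsupp.single_apply] at h2
  have h3 : ((-n : ℤ) : ℝ) = d.model.disc := by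
    have : ((-n : ℤ) : ℂ) = (d.model.disc : ℂ) := by
      push_cast
      rw [hn, h2, neg_neg]
    exact_mod_cast this
  have h4 : 0 < -n := by
    have := d.model.disc_pos
    rw [← h3] at this
    exact_mod_cast this
  refine ⟨(-n).toNat, by omega, ?_⟩
  rw [← h3]
  have : (((-n).toNat : ℤ) : ℝ) = ((-n : ℤ) : ℝ) := by rw [Int.toNat_of_nonneg h4.le]
  exact_mod_cast this

/-- The natural number `m ϑ₃ ^ 2 (h, h)`. -/
def D : ℕ := d.exists_disc.choose

theorem D_pos : 0 < d.D := d.exists_disc.choose_spec.1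

theorem D_eq : (d.D : ℝ) = d.model.disc := d.exists_disc.choose_spec.2

theorem quadField_D : quadField d.D = quadField ((d.m * dualSq d.vol d.m d.h : ℚ) : ℝ) := by
  rw [D_eq, disc_eq]
  exact quadField_sq_mul (by exact_mod_cast d.t₃_ne)

theorem phiZ_phiZ (x : V × Module.Dual ℤ V) : d.phiZ (d.phiZ x) = -((d.D : ℤ) • x) := by
  apply latticeMap_injective (finrank_eq_four d.vol)
  apply d.tCoord.injective
  rw [← phi_lattice, ← phi_lattice, Model.phi_phi, map_neg, map_neg, map_smul, map_zsmul,
    neg_smul, ← D_eq]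
  congr 1
  rw [← Int.cast_smul_eq_zsmul ℂ]
  norm_cast

theorem form_phiZ (x y : V × Module.Dual ℤ V) :
    d.form (d.phiZ x) (d.phiZ y) = (d.D : ℚ) * d.form x y := by
  have h1 := d.alt_lattice (d.phiZ x) (d.phiZ y)
  rw [← phi_lattice, ← phi_lattice, Model.alt_phi, alt_lattice, ← D_eq] at h1
  exact_mod_cast h1.symm

variable {d}

/-- The coordinates of a representative of a point of the projective space. -/
abbrev rep (d : Datum V) (p : ℙ ℂ (K3Space V)) : KCoord := d.kCoord p.rep

theorem mem_periodDomain {p : ℙ ℂ (K3Space V)} :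
    p ∈ periodDomain d.vol d.m d.h ↔ d.model.IsPeriod (d.rep p) := (d.isPeriod_iff p.rep).symm

section Period

variable {p : ℙ ℂ (K3Space V)} (hp : d.model.IsPeriod (d.rep p))

/-- The tangent space of the torus. -/
abbrev T (d : Datum V) (p : ℙ ℂ (K3Space V)) : Type _ := JTangent d.vol d.t₂ d.t₃ p

/-- The lattice of the torus. -/
abbrev j (d : Datum V) (p : ℙ ℂ (K3Space V)) : (V × Module.Dual ℤ V) →ₗ[ℤ] d.T p :=
  JLattice d.vol d.t₂ d.t₃ p

/-- The projection to the tangent space. -/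
abbrev π (d : Datum V) (p : ℙ ℂ (K3Space V)) :
    ((ℂ ⊗[ℤ] V) × Module.Dual ℂ (ℂ ⊗[ℤ] V)) →ₗ[ℂ] d.T p :=
  (hodge10 d.vol d.t₂ d.t₃ p.rep).mkQ

theorem j_apply (x : V × Module.Dual ℤ V) : d.j p x = d.π p (latticeMap V x) := rfl

include hp

theorem hodge_eq : hodge10 d.vol d.t₂ d.t₃ p.rep
    = (d.model.ker (d.rep p)).comap d.tCoord.toLinearMap :=
  d.hodge10_eq p.rep_nonzero (by rw [← quad_kCoord]; exact hp.isotropic)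

theorem π_eq_zero_iff (x : (ℂ ⊗[ℤ] V) × Module.Dual ℂ (ℂ ⊗[ℤ] V)) :
    d.π p x = 0 ↔ d.tCoord x ∈ d.model.ker (d.rep p) := by
  rw [Submodule.mkQ_apply, Submodule.Quotient.mk_eq_zero, hodge_eq hp]
  rfl

/-- The tangent space as the conjugate of `H^{1,0}`. -/
theorem exists_q : ∃ q : d.T p →ₗ[ℂ] TCoord,
    ∀ x, q (d.π p x) = d.model.proj (d.rep p) (d.tCoord x) := by
  refine ⟨(hodge10 d.vol d.t₂ d.t₃ p.rep).liftQ
    (d.model.proj (d.rep p) ∘ₗ d.tCoord.toLinearMap) ?_, fun x => ?_⟩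
  · rw [hodge_eq hp]
    intro x hx
    exact Model.IsPeriod.proj_of_mem hx
  · rfl

theorem finrank_hodge : Module.finrank ℂ (hodge10 d.vol d.t₂ d.t₃ p.rep) = 4 := by
  rw [hodge_eq hp]
  exact (LinearEquiv.ofSubmodule' d.tCoord (d.model.ker (d.rep p))).finrank_eq.trans
    (Model.finrank_ker hp.ne_zero hp.isotropic)

theorem finrank_T : Module.finrank ℂ (d.T p) = 4 := by
  have h1 := (hodge10 d.vol d.t₂ d.t₃ p.rep).finrank_quotient_add_finrank
  have h2 := d.tCoord.finrank_eq
  rw [finrank_tCoord] at h2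
  rw [finrank_hodge hp, h2] at h1
  exact Nat.add_right_cancel h1

/-- A real combination of lattice vectors that dies in the tangent space is a real vector of
H^{1,0}, hence zero, because H^{1,0} meets its conjugate trivially. -/
theorem isComplexTorus : IsComplexTorus (2 * 2) (d.j p) := by
  obtain ⟨b, B, hB⟩ := exists_lattice_basis V (finrank_eq_four d.vol)
  have := d.tCoord.symm.finiteDimensional
  refine isComplexTorus_of (n := 4) b (finrank_T hp) fun r hr => ?_
  have h1 : d.π p (∑ i, (r i : ℂ) • B i) = 0 := by
    rw [map_sum, ← hr]
    refine Finset.sum_congr rfl fun i _ => ?_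
    rw [map_smul, hB]
    rfl
  rw [π_eq_zero_iff hp] at h1
  have h2 : star (d.tCoord (∑ i, (r i : ℂ) • B i)) = d.tCoord (∑ i, (r i : ℂ) • B i) := by
    simp only [map_sum, map_smul, star_sum, star_smul, hB, d.frame.star_tCoord, RCLike.star_def,
      Complex.conj_ofReal]
  have h3 := hp.eq_zero_of_star_mem h1 (by rwa [h2])
  rw [LinearEquiv.map_eq_zero_iff] at h3
  have h4 := Fintype.linearIndependent_iff.1 B.linearIndependent _ h3
  ext i
  exact_mod_cast h4 i

theorem isPolarization_iff : IsPolarization (d.j p) d.form ↔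
    ∀ u ∈ d.model.ker (d.rep p), u ≠ 0 → 0 < d.model.posForm u := by
  obtain ⟨q, hq⟩ := exists_q hp
  have hsurj : ∀ w : d.T p, ∃ x, d.π p x = w := Submodule.mkQ_surjective _
  refine Model.isPolarization_iff (isComplexTorus hp) hp q ?_ ?_ ?_ ?_
  · rw [← LinearMap.ker_eq_bot, LinearMap.ker_eq_bot']
    intro w hw
    obtain ⟨x, rfl⟩ := hsurj w
    rw [hq, hp.proj_eq_zero_iff] at hw
    exact (π_eq_zero_iff hp x).2 hw
  · intro w
    obtain ⟨x, rfl⟩ := hsurj w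
    rw [hq]
    exact hp.star_proj_mem _
  · intro u hu
    refine ⟨d.π p (d.tCoord.symm (star u)), ?_⟩
    rw [hq, LinearEquiv.apply_symm_apply, hp.proj_star hu]
  · intro x y
    have h1 : ∀ x, q (d.j p x) + star (q (d.j p x)) = d.tCoord (latticeMap V x) := by
      intro x
      rw [j_apply, hq]
      exact (hp.eq_add_star (d.frame.star_tCoord x)).symm
    rw [h1, h1, alt_lattice]

/-- Endomorphisms of `V_ℂ ⊕ V_ℂ^∨` that preserve `H^{1,0}` act on the tangent space. -/
theorem exists_map {A : TCoord →ₗ[ℂ] TCoord}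
    (hA : ∀ x ∈ d.model.ker (d.rep p), A x ∈ d.model.ker (d.rep p)) :
    ∃ A' : Module.End ℂ (d.T p), ∀ x, A' (d.π p (d.tCoord.symm x)) = d.π p (d.tCoord.symm (A x)) := by
  refine ⟨(hodge10 d.vol d.t₂ d.t₃ p.rep).mapQ (hodge10 d.vol d.t₂ d.t₃ p.rep)
    (d.tCoord.symm.toLinearMap ∘ₗ A ∘ₗ d.tCoord.toLinearMap) ?_, fun x => ?_⟩
  · rw [hodge_eq hp]
    intro x hx
    simpa using hA _ hx
  · rw [Submodule.mkQ_apply, Submodule.mapQ_apply]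
    simp

/-- A nonisotropic τ orthogonal to ℓ and σ descends to the tangent space and exchanges the
eigenspaces of φ there. -/
theorem exists_eigenspaces : ∃ A : Module.End ℂ (d.T p), (∀ x, A (d.j p x) = d.j p (d.phiZ x)) ∧
    Module.finrank ℂ (Module.End.eigenspace A.dualMap (sqrtNeg d.D)) = 2 ∧
    Module.finrank ℂ (Module.End.eigenspace A.dualMap (-sqrtNeg d.D)) = 2 := by
  obtain ⟨A, hA⟩ := exists_map hp (A := d.model.phi) fun x hx => hp.phi_mem hx
  obtain ⟨τ, h1, h2, h3⟩ := Model.exists_swap hp.ne_zero hp.perp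
  obtain ⟨S, hS⟩ := exists_map hp (A := d.model.clifford τ)
    fun x hx => Model.clifford_mem_ker h2 hx
  have := d.tCoord.symm.finiteDimensional
  have hsurj : ∀ w : d.T p, ∃ x, d.π p (d.tCoord.symm x) = w := fun w => by
    obtain ⟨x, rfl⟩ := Submodule.mkQ_surjective _ w
    exact ⟨d.tCoord x, by simp⟩
  have key := two_mul_finrank_eigenspace (A := A) (S := S) (μ := sqrtNeg d.model.disc)
    (sqrtNeg_ne_zero d.model.disc_pos) ?_ ?_ ?_
  · rw [finrank_T hp] at key
    refine ⟨A, ?_, ?_, ?_⟩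
    · intro x
      have := hA (d.tCoord (latticeMap V x))
      rw [phi_lattice, LinearEquiv.symm_apply_apply, LinearEquiv.symm_apply_apply] at this
      exact this
    · rw [finrank_eigenspace_dualMap, D_eq]
      omega
    · rw [finrank_eigenspace_dualMap, D_eq]
      omega
  · intro w
    obtain ⟨x, rfl⟩ := hsurj w
    rw [hA, hA, Model.phi_phi', map_smul, map_smul]
  · have hSS : ∀ w, S (S w) = (-(d.model.c * d.model.quad τ τ : ℂ)) • w := by
      intro w
      obtain ⟨x, rfl⟩ := hsurj w
      rw [hS, hS, Model.clifford_clifford_self, map_smul, map_smul]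
    have hne : (-(d.model.c * d.model.quad τ τ : ℂ)) ≠ 0 :=
      neg_ne_zero.2 (mul_ne_zero Model.c_ne h3)
    intro x y hxy
    have h4 : S (S x) = S (S y) := by rw [hxy]
    rw [hSS, hSS] at h4
    exact smul_right_injective _ hne h4
  · intro w
    obtain ⟨x, rfl⟩ := hsurj w
    rw [hS, hA, hA, hS, Model.phi_clifford h1, map_neg, map_neg]

theorem isPolarizedWeil (hpol : IsPolarization (d.j p) d.form) :
    IsPolarizedWeil 2 (d.j p) d.form d.phiZ d.D where
  torus := isComplexTorus hp
  polarization := hpol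
  pos := d.D_pos
  sq := d.phiZ_phiZ
  eigenspaces := exists_eigenspaces hp
  preserves := d.form_phiZ

end Period

variable (d)

theorem formL_injective : Function.Injective d.formL := by
  rw [← LinearMap.ker_eq_bot, LinearMap.ker_eq_bot']
  intro v hv
  have hl : (d.lam : ℂ) ≠ 0 := by exact_mod_cast d.lam_pos.ne'
  have h1 : ∀ x, volFormC d.vol ((1 : ℂ) ⊗ₜ d.l) (wedgeC V x ((1 : ℂ) ⊗ₜ v)) = 0 := by
    intro x
    induction x with
    | zero => simp
    | add x y hx hy => rw [map_add, LinearMap.add_apply, map_add, hx, hy, add_zero]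
    | tmul z w =>
      have := congrArg (fun F => F w) hv
      rw [wedgeC_tmul, volFormC_tmul, ← formL_apply, this]
      simp
  have h2 : ∀ i, contract (hodgeStar (d.frame.coords ((1 : ℂ) ⊗ₜ d.l)))
      (fun k => d.frame.e.repr ((1 : ℂ) ⊗ₜ v) k) i = 0 := by
    intro i
    rw [d.frame.contract_hodgeStar, h1]
  have h3 : d.frame.e.repr ((1 : ℂ) ⊗ₜ[ℤ] v) = 0 := by
    rw [coords_l] at h2
    have k0 := h2 0
    have k1 := h2 1
    have k2 := h2 2
    have k3 := h2 3
    simp [contract, hodgeStar, hl] at k0 k1 k2 k3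
    ext i
    fin_cases i <;> simpa
  have h4 : (1 : ℂ) ⊗ₜ[ℤ] v = 0 := by simpa using h3
  have h5 : latticeMap V (v, 0) = latticeMap V 0 := by
    rw [latticeMap_apply]
    simp [h4]
  have := latticeMap_injective (finrank_eq_four d.vol) h5
  simpa using this

/-- On vectors of V the term E(x, φy) is -D times the natural pairing of x and y, which is zero. The
Gram matrix is √(-D)ϑ₁ times the skew matrix Ω of l, with determinant (Dϑ₁²Pf Ω)², the norm of the
rational number Dϑ₁²Pf Ω. -/
theorem hasDet : HasDet 2 d.form d.phiZ d.D 1 := by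
  have hl0 : 0 < volForm d.vol d.l d.l := by
    have h1 := d.volForm_l
    have h2 : (0 : ℝ) < volForm d.vol d.l d.l := by
      rw [h1]
      have := d.lam_pos
      positivity
    exact_mod_cast h2
  obtain ⟨b, hb, -⟩ := exists_basis d.vol (l := d.l) (by intro h; simp [h] at hl0)
  have hpf := volForm_eq_pfaffian b hb d.l
  set Ω : Fin 4 → Fin 4 → ℤ := fun i k => volForm d.vol d.l (wedge V (b i) (b k)) with hΩ
  have hΩself : ∀ i, Ω i i = 0 := fun i => by simp only [hΩ, wedge_self, map_zero]
  have hΩswap : ∀ i k, Ω i k = -Ω k i := fun i k => by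
    simp only [hΩ]
    rw [wedge_swap, map_neg]
  set P : ℤ := Ω 0 1 * Ω 2 3 - Ω 0 2 * Ω 1 3 + Ω 0 3 * Ω 1 2 with hP
  have hP0 : P ≠ 0 := by
    intro h
    have : volForm d.vol d.l d.l = 2 * P := hpf
    omega
  set e : Fin (2 * 2) → V × Module.Dual ℤ V := fun i => (b i, 0) with he
  have hphi : ∀ i, d.phiZ (e i) = ((d.s * d.t₃) • b i, d.t₁ • d.formL (b i)) := by
    intro i
    rw [phiZ_apply]
    simp [he]
  refine ⟨e, ?_, algebraMap ℚ (quadField d.D) (d.D * d.t₁ ^ 2 * P), ?_, ?_⟩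
  · rw [Fintype.linearIndependent_iff]
    intro g hg
    rw [Fintype.sum_sum_type] at hg
    simp only [Sum.elim_inl, Sum.elim_inr, hphi] at hg
    have h2 := congrArg Prod.snd hg
    simp only [Prod.snd_add, Prod.snd_sum, Prod.smul_snd, he, smul_zero, Finset.sum_const_zero,
      zero_add, Prod.snd_zero] at h2
    have h3 : d.t₁ • d.formL (∑ i, g (Sum.inr i) • b i) = 0 := by
      rw [map_sum, Finset.smul_sum, ← h2]
      refine Finset.sum_congr rfl fun i _ => ?_
      rw [map_smul, smul_comm]
    have h4 : ∑ i, g (Sum.inr i) • b i = 0 := by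
      rw [smul_eq_zero, or_iff_right d.t₁_ne] at h3
      exact d.formL_injective (h3.trans (map_zero _).symm)
    have h5 := Fintype.linearIndependent_iff.1 b.linearIndependent _ h4
    have h6 := congrArg Prod.fst hg
    simp only [Prod.fst_add, Prod.fst_sum, Prod.smul_fst, he, Prod.fst_zero] at h6
    have h7 : ∑ i, g (Sum.inl i) • b i = 0 := by
      rw [← h6]
      rw [left_eq_add]
      exact Finset.sum_eq_zero fun i _ => by rw [h5 i, zero_smul]
    have h8 := Fintype.linearIndependent_iff.1 b.linearIndependent _ h7
    rintro (i | i)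
    · exact h8 i
    · exact h5 i
  · rw [Ne, map_eq_zero]
    have : (d.D : ℚ) ≠ 0 := by exact_mod_cast d.D_pos.ne'
    have : (d.t₁ : ℚ) ≠ 0 := by exact_mod_cast d.t₁_ne
    have : (P : ℚ) ≠ 0 := by exact_mod_cast hP0
    positivity
  · have hnorm : ∀ (r : ℝ) (x : ℚ), r = ((d.D : ℚ) : ℝ) →
        Algebra.norm ℚ (algebraMap ℚ (quadField r) x) = x ^ 2 := by
      rintro _ x rfl
      exact (norm_quadField (d := (d.D : ℚ)) (by exact_mod_cast d.D_pos)
        (algebraMap ℚ (quadField ((d.D : ℚ) : ℝ)) x) (p := x) (q := 0) (by simp)).trans (by ring)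
    rw [hnorm _ _ (by simp)]
    have hgram : ∀ i k : Fin 4, hermForm d.form d.phiZ d.D (e i) (e k)
        = sqrtNeg d.D * (d.t₁ * Ω i k) := by
      intro i k
      rw [hermForm, form_eq_pairing, phiZ_phiZ, form_apply]
      simp [he, hΩ]
    have hs : sqrtNeg d.D * sqrtNeg d.D = -(d.D : ℂ) := by
      rw [sqrtNeg_mul_self (Nat.cast_nonneg _)]
      push_cast
      rfl
    have hdet : (Matrix.of fun i k => hermForm d.form d.phiZ d.D (e i) (e k))
        = Matrix.of fun i k : Fin 4 => sqrtNeg d.D * (d.t₁ * Ω i k) := by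
      ext i k
      exact hgram i k
    rw [hdet, Matrix.det_succ_row_zero]
    simp [Fin.sum_univ_succ, Matrix.det_fin_three, Matrix.submatrix, Fin.succAbove, hΩself,
      hΩswap 1 0, hΩswap 2 0, hΩswap 3 0, hΩswap 2 1, hΩswap 3 1, hΩswap 3 2]
    rw [hP]
    push_cast
    linear_combination ((d.t₁ : ℂ) ^ 4 * (Ω 0 1 * Ω 2 3 - Ω 0 2 * Ω 1 3 + Ω 0 3 * Ω 1 2) ^ 2
      * (sqrtNeg d.D * sqrtNeg d.D - d.D)) * hs

end Datum


/-! ### Connected components of the period domain -/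

variable {V : Type*} [AddCommGroup V] [Module.Free ℤ V] [Module.Finite ℤ V]

theorem Model.side_smul (a : ℂ) (σ : KCoord) : Model.side (a • σ) = ‖a‖ ^ 2 * Model.side σ := by
  have : (a • σ).1 2 * star ((a • σ).1 4) = (‖a‖ ^ 2 : ℝ) * (σ.1 2 * star (σ.1 4)) := by
    push_cast
    rw [← Complex.mul_conj' a]
    simp
    ring
  rw [Model.side, this, Complex.im_ofReal_mul, Model.side]

namespace Datum

variable (d : Datum V)

theorem exists_rep_mk (v : K3Space V) (hv : v ≠ 0) :
    ∃ a : ℂ, a ≠ 0 ∧ d.rep (Projectivization.mk ℂ v hv) = a • d.kCoord v := by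
  obtain ⟨a, ha⟩ := Projectivization.exists_smul_eq_mk_rep ℂ v hv
  exact ⟨a, a.ne_zero, by rw [rep, ← ha, Units.smul_def, map_smul]⟩

/-- The part of the period domain where the sign of `side` is prescribed. -/
def half (ε : ℝ) : Set (ℙ ℂ (K3Space V)) :=
  {p | p ∈ periodDomain d.vol d.m d.h ∧ 0 < ε * Model.side (d.rep p)}

theorem exists_ker_ne {σ : KCoord} (h : d.model.IsPeriod σ) : ∃ u ∈ d.model.ker σ, u ≠ 0 := by
  apply (Submodule.ne_bot_iff _).1
  intro hbot
  have := Model.finrank_ker h.ne_zero h.isotropic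
  rw [hbot, finrank_bot] at this
  omega

/-- `side` has no zero on the period domain, because the strict inequality of `Model.posForm_sign`
holds for a nonzero vector of the kernel. -/
theorem mem_half_or {p : ℙ ℂ (K3Space V)} (hp : p ∈ periodDomain d.vol d.m d.h) :
    p ∈ d.half d.t₁ ∨ p ∈ d.half (-d.t₁) := by
  have h := mem_periodDomain.1 hp
  obtain ⟨u, hu, hu0⟩ := d.exists_ker_ne h
  have h1 := Model.posForm_sign h hu hu0
  rcases lt_trichotomy ((d.t₁ : ℝ) * Model.side (d.rep p)) 0 with h2 | h2 | h2
  · exact Or.inr ⟨hp, by linarith⟩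
  · have : d.model.t₁ * Model.side (d.rep p) = 0 := h2
    rw [this, zero_mul] at h1
    exact absurd h1 (lt_irrefl _)
  · exact Or.inl ⟨hp, h2⟩

theorem isPolarization_of_mem {p : ℙ ℂ (K3Space V)} (hp : p ∈ d.half d.t₁) :
    IsPolarization (d.j p) d.form := by
  have h := mem_periodDomain.1 hp.1
  rw [isPolarization_iff h]
  intro u hu hu0
  exact (mul_pos_iff_of_pos_left hp.2).1 (Model.posForm_sign h hu hu0)

theorem mem_half_of_isPolarization {p : ℙ ℂ (K3Space V)} (hp : p ∈ periodDomain d.vol d.m d.h)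
    (hpol : IsPolarization (d.j p) d.form) : p ∈ d.half d.t₁ := by
  have h := mem_periodDomain.1 hp
  rw [isPolarization_iff h] at hpol
  obtain ⟨u, hu, hu0⟩ := d.exists_ker_ne h
  exact ⟨hp, (mul_pos_iff_of_pos_right (hpol u hu hu0)).1 (Model.posForm_sign h hu hu0)⟩

/-- Each half is the continuous image of a real vector space under `Model.tube`. -/
theorem isPreconnected_half {ε : ℝ} (hε : ε ≠ 0) :
    @IsPreconnected _ (projTopology (K3Space V)) (d.half ε) := by
  let _ : TopologicalSpace (K3Space V) := moduleTopology ℂ (K3Space V)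
  let _ : TopologicalSpace (ℙ ℂ (K3Space V)) := projTopology (K3Space V)
  have : IsModuleTopology ℂ (K3Space V) := ⟨rfl⟩
  have hne : ∀ z : Model.TubeParam, d.kCoord.symm (d.model.tube ε z) ≠ 0 := fun z h =>
    (Model.isPeriod_tube hε z).ne_zero (by simpa using h)
  have hcont : Continuous fun z : Model.TubeParam =>
      Projectivization.mk ℂ (d.kCoord.symm (d.model.tube ε z)) (hne z) := by
    have h1 : Continuous (fun v : {v : K3Space V // v ≠ 0} => Projectivization.mk ℂ v.1 v.2) :=
      continuous_coinduced_rng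
    have h2 : Continuous (d.kCoord.symm : KCoord → K3Space V) := by
      have := IsModuleTopology.toContinuousAdd ℂ (K3Space V)
      exact IsModuleTopology.continuous_of_linearMap d.kCoord.symm.toLinearMap
    exact h1.comp ((h2.comp (Model.continuous_tube hε)).subtype_mk hne)
  have himage : d.half ε = Set.range fun z : Model.TubeParam =>
      Projectivization.mk ℂ (d.kCoord.symm (d.model.tube ε z)) (hne z) := by
    ext p
    constructor
    · rintro ⟨hp, hs⟩
      obtain ⟨a, ha, z, hz⟩ := Model.exists_tube (mem_periodDomain.1 hp) hs
      refine ⟨z, ?_⟩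
      conv_rhs => rw [← p.mk_rep]
      rw [Projectivization.mk_eq_mk_iff']
      refine ⟨a⁻¹, ?_⟩
      have : p.rep = d.kCoord.symm (a • d.model.tube ε z) := by
        rw [← hz, LinearEquiv.symm_apply_apply]
      rw [this, map_smul, smul_smul, inv_mul_cancel₀ ha, one_smul]
    · rintro ⟨z, rfl⟩
      obtain ⟨a, ha, h1⟩ := d.exists_rep_mk _ (hne z)
      rw [LinearEquiv.apply_symm_apply] at h1
      refine ⟨mem_periodDomain.2 ?_, ?_⟩
      · rw [h1]
        exact Model.isPeriod_smul ha (Model.isPeriod_tube hε z)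
      · rw [h1, Model.side_smul, Model.side_tube]
        have := norm_pos_iff.2 ha
        have : 0 < ε ^ 2 := by positivity
        calc 0 < ‖a‖ ^ 2 * (ε ^ 2 * Real.exp z.1.1) := by positivity
          _ = _ := by ring
  rw [himage]
  exact isPreconnected_range hcont

theorem isOpen_side (ε : ℝ) : @IsOpen _ (projTopology (K3Space V))
    {p | 0 < ε * Model.side (d.rep p)} := by
  let _ : TopologicalSpace (K3Space V) := moduleTopology ℂ (K3Space V)
  let _ : TopologicalSpace (ℙ ℂ (K3Space V)) := projTopology (K3Space V)
  have : IsModuleTopology ℂ (K3Space V) := ⟨rfl⟩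
  have h2 : Continuous (d.kCoord : K3Space V → KCoord) :=
    IsModuleTopology.continuous_of_linearMap d.kCoord.toLinearMap
  rw [isOpen_coinduced]
  have h3 : (fun v : {v : K3Space V // v ≠ 0} => Projectivization.mk ℂ v.1 v.2) ⁻¹'
      {p | 0 < ε * Model.side (d.rep p)}
      = {v : {v : K3Space V // v ≠ 0} | 0 < ε * Model.side (d.kCoord v.1)} := by
    ext v
    obtain ⟨a, ha, h1⟩ := d.exists_rep_mk v.1 v.2
    simp only [Set.mem_preimage, Set.mem_ofPred_eq, h1, Model.side_smul]
    have : 0 < ‖a‖ ^ 2 := by positivity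
    rw [mul_left_comm, mul_pos_iff_of_pos_left this]
  rw [h3]
  have h4 : Continuous fun v : {v : K3Space V // v ≠ 0} => ε * Model.side (d.kCoord v.1) := by
    have h5 : Continuous Model.side := by
      unfold Model.side
      fun_prop
    exact continuous_const.mul (h5.comp (h2.comp continuous_subtype_val))
  exact isOpen_lt continuous_const h4

/-- The two halves are connected and relatively open, disjoint, and cover the period domain. -/
theorem connectedComponentIn_eq {ε : ℝ} (hε : ε = d.t₁ ∨ ε = -d.t₁) {p : ℙ ℂ (K3Space V)}
    (hp : p ∈ d.half ε) : @connectedComponentIn _ (projTopology (K3Space V))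
      (periodDomain d.vol d.m d.h) p = d.half ε := by
  let _ : TopologicalSpace (ℙ ℂ (K3Space V)) := projTopology (K3Space V)
  have h1 : (d.t₁ : ℝ) ≠ 0 := by exact_mod_cast d.t₁_ne
  have hε0 : ε ≠ 0 := by
    rcases hε with rfl | rfl
    · exact h1
    · exact neg_ne_zero.2 h1
  apply subset_antisymm
  · have hsub := connectedComponentIn_subset (periodDomain d.vol d.m d.h) p
    have h2 : connectedComponentIn (periodDomain d.vol d.m d.h) p
        ⊆ {p | 0 < ε * Model.side (d.rep p)} := by
      refine isPreconnected_connectedComponentIn.subset_left_of_subset_union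
        (d.isOpen_side ε) (d.isOpen_side (-ε)) ?_ ?_ ⟨p, mem_connectedComponentIn hp.1, hp.2⟩
      · rw [Set.disjoint_left]
        intro x hx hx'
        have h3 : 0 < ε * Model.side (d.rep x) := hx
        have h4 : 0 < -ε * Model.side (d.rep x) := hx'
        linarith
      · intro x hx
        rcases d.mem_half_or (hsub hx) with h | h
        · rcases hε with rfl | rfl
          · exact Or.inl h.2
          · exact Or.inr (by rw [neg_neg]; exact h.2)
        · rcases hε with rfl | rfl
          · exact Or.inr h.2
          · exact Or.inl h.2
    exact fun x hx => ⟨hsub hx, h2 hx⟩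
  · exact (d.isPreconnected_half hε0).subset_connectedComponentIn hp fun x hx => hx.1

theorem half_nonempty {ε : ℝ} (hε : ε ≠ 0) : (d.half ε).Nonempty := by
  have hne : d.kCoord.symm (d.model.tube ε 0) ≠ 0 := fun h =>
    (Model.isPeriod_tube hε 0).ne_zero (by simpa using h)
  obtain ⟨a, ha, h1⟩ := d.exists_rep_mk _ hne
  rw [LinearEquiv.apply_symm_apply] at h1
  refine ⟨Projectivization.mk ℂ _ hne, mem_periodDomain.2 ?_, ?_⟩
  · rw [h1]
    exact Model.isPeriod_smul ha (Model.isPeriod_tube hε 0)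
  · rw [h1, Model.side_smul, Model.side_tube]
    have := norm_pos_iff.2 ha
    have : 0 < ε ^ 2 := by positivity
    calc 0 < ‖a‖ ^ 2 * (ε ^ 2 * Real.exp (0 : Model.TubeParam).1.1) := by positivity
      _ = _ := by ring

theorem isPlusComponent_iff (C : Set (ℙ ℂ (K3Space V))) :
    IsPlusComponent d.vol d.t₁ d.t₂ d.t₃ d.m d.h C ↔ C = d.half d.t₁ := by
  constructor
  · rintro ⟨⟨p, hp, rfl⟩, hpol⟩
    let _ : TopologicalSpace (ℙ ℂ (K3Space V)) := projTopology (K3Space V)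
    exact d.connectedComponentIn_eq (Or.inl rfl)
      (d.mem_half_of_isPolarization hp (hpol p (mem_connectedComponentIn hp)))
  · rintro rfl
    obtain ⟨p, hp⟩ := d.half_nonempty (ε := d.t₁) (by exact_mod_cast d.t₁_ne)
    exact ⟨⟨p, hp.1, (d.connectedComponentIn_eq (Or.inl rfl) hp).symm⟩,
      fun q hq => d.isPolarization_of_mem hq⟩

end Datum


/-! ### Completeness of the family -/

theorem finrank_le_finrank_ker_inf_add {X Y : Type*} [AddCommGroup X] [Module ℂ X]
    [FiniteDimensional ℂ X] [AddCommGroup Y] [Module ℂ Y] [FiniteDimensional ℂ Y]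
    (q : X →ₗ[ℂ] Y) {p : Submodule ℂ X} {p' : Submodule ℂ Y} (h : ∀ x ∈ p, q x ∈ p') :
    Module.finrank ℂ p ≤
      Module.finrank ℂ (LinearMap.ker q ⊓ p : Submodule ℂ X) + Module.finrank ℂ p' := by
  have h1 := LinearMap.finrank_range_add_finrank_ker (q.domRestrict p)
  have h2 : Module.finrank ℂ (LinearMap.range (q.domRestrict p)) ≤ Module.finrank ℂ p' := by
    apply Submodule.finrank_mono
    rintro _ ⟨x, rfl⟩
    exact h x x.2
  have h3 : LinearMap.ker q ⊓ p = (LinearMap.ker (q.domRestrict p)).map p.subtype := by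
    ext x
    simp only [Submodule.mem_inf, Submodule.mem_map, LinearMap.mem_ker, Submodule.subtype_apply]
    constructor
    · rintro ⟨h4, hx⟩
      exact ⟨⟨x, hx⟩, h4, rfl⟩
    · rintro ⟨y, hy, rfl⟩
      exact ⟨hy, y.2⟩
  have h4 : Module.finrank ℂ (LinearMap.ker q ⊓ p : Submodule ℂ X)
      = Module.finrank ℂ (LinearMap.ker (q.domRestrict p)) := by
    rw [h3]
    exact (Submodule.equivMapOfInjective p.subtype p.injective_subtype _).finrank_eq.symm
  omega

namespace Model

variable {μ : Model}

/-- A polarized lattice that is isometric, with its endomorphism, to a lattice in the model has a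
period. -/
theorem exists_isPeriod {Λ W : Type*} [AddCommGroup Λ] [AddCommGroup W] [Module ℂ W]
    {j : Λ →ₗ[ℤ] W} {E : Λ →ₗ[ℤ] Λ →ₗ[ℤ] ℚ} {ψ : Module.End ℤ Λ} {D : ℕ}
    (h : IsPolarizedWeil 2 j E ψ D) {F : Λ →ₗ[ℤ] TCoord} (hstar : ∀ x, star (F x) = F x)
    {α β : ℂ} (hα : α ≠ 0) (hβ : β ≠ 0) (hαβ : α * sqrtNeg D = β * sqrtNeg μ.disc)
    (hphi : ∀ x, α • F (ψ x) = β • μ.phi (F x)) {r : ℝ} (hr : 0 < r)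
    (halt : ∀ x y, μ.alt (F x) (F y) = (r : ℂ) * (E x y : ℂ)) :
    ∃ σ, μ.IsPeriod σ ∧ (∀ u ∈ μ.ker σ, u ≠ 0 → 0 < μ.posForm u) ∧
      ∃ q : TCoord →ₗ[ℂ] W, Function.Surjective q ∧ LinearMap.ker q = μ.ker σ ∧
        ∀ x, q (F x) = j x := by
  have hfin : Module.finrank ℂ W = 4 := h.torus.finrank
  have := h.torus.finite
  obtain ⟨b, B, hB⟩ := h.torus
  obtain ⟨ER, hER, hERself, hERI, hERpos⟩ := h.polarization
  -- The form E is nondegenerate because its Hermitian form is positive, and F transports it to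
  -- `alt` up to the factor r.
  have hli : LinearIndependent ℂ fun i => F (b i) := by
    rw [Fintype.linearIndependent_iff]
    intro g hg
    have h1 : ∀ k, ∑ i, g i * (E (b i) (b k) : ℂ) = 0 := by
      intro k
      have h2 : μ.alt (∑ i, g i • F (b i)) (F (b k)) = r * ∑ i, g i * (E (b i) (b k) : ℂ) := by
        rw [alt, map_sum, LinearMap.sum_apply, Finset.mul_sum]
        refine Finset.sum_congr rfl fun i _ => ?_
        rw [← alt, alt_smul_left, halt]
        ring
      rw [hg, alt, map_zero, LinearMap.zero_apply, eq_comm, mul_eq_zero] at h2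
      exact h2.resolve_left (by exact_mod_cast hr.ne')
    have h3 : ∀ c : Fin (2 * (2 * 2)) → ℝ, (∀ k, ∑ i, c i * (E (b i) (b k) : ℝ) = 0) → c = 0 := by
      intro c hc
      have h4 : ER (∑ i, c i • B i) = 0 := by
        apply B.ext
        intro k
        rw [map_sum, LinearMap.sum_apply, LinearMap.zero_apply, ← hc k]
        refine Finset.sum_congr rfl fun i _ => ?_
        rw [map_smul, LinearMap.smul_apply, hB, hB, hER, smul_eq_mul]
      have h5 : ∑ i, c i • B i = 0 := by
        by_contra hne
        have h6 := hERpos _ hne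
        have h7 := hERI (Complex.I • ∑ i, c i • B i) (∑ i, c i • B i)
        have h8 : Complex.I • Complex.I • (∑ i, c i • B i) = -(∑ i, c i • B i) := by
          rw [smul_smul, Complex.I_mul_I, neg_one_smul]
        rw [h8, map_neg, LinearMap.neg_apply, h4, LinearMap.zero_apply] at h7
        linarith
      exact funext (Fintype.linearIndependent_iff.1 B.linearIndependent c h5)
    have h9 := h3 (fun i => (g i).re) fun k => by
      have := congrArg Complex.re (h1 k)
      rw [Complex.re_sum] at this
      rw [← Complex.zero_re, ← this]
      refine Finset.sum_congr rfl fun i _ => ?_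
      rw [← Complex.ofReal_ratCast, Complex.re_mul_ofReal]
    have h10 := h3 (fun i => (g i).im) fun k => by
      have := congrArg Complex.im (h1 k)
      rw [Complex.im_sum] at this
      rw [← Complex.zero_im, ← this]
      refine Finset.sum_congr rfl fun i _ => ?_
      rw [← Complex.ofReal_ratCast, Complex.im_mul_ofReal]
    intro i
    exact Complex.ext (congrFun h9 i) (congrFun h10 i)
  let C := basisOfLinearIndependentOfCardEqFinrank hli (by simp)
  have hC : ∀ i, C i = F (b i) := fun i => by simp [C]
  -- The complex linear extension of j along F. Its kernel is the transported H^{1,0}, the candidate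
  -- for the kernel of a period.
  let q : TCoord →ₗ[ℂ] W := C.constr ℂ fun i => j (b i)
  have hqC : ∀ i, q (C i) = j (b i) := fun i => C.constr_basis ℂ _ i
  have hqF : ∀ x, q (F x) = j x := by
    intro x
    have h1 : q.restrictScalars ℤ ∘ₗ F = j := b.ext fun i => by
      rw [← hqC, hC]
      rfl
    exact congrArg (fun G => G x) h1
  let R : W →ₗ[ℝ] TCoord := B.constr ℝ C
  have hRB : ∀ i, R (B i) = C i := fun i => B.constr_basis ℝ _ i
  have hqR : ∀ w, q (R w) = w := by
    intro w
    have h1 : q.restrictScalars ℝ ∘ₗ R = LinearMap.id := B.ext fun i => by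
      rw [LinearMap.comp_apply, hRB, LinearMap.id_apply, hB]
      exact hqC i
    exact congrArg (fun G => G w) h1
  have hRsum : ∀ w, R w = ∑ i, (B.repr w i : ℂ) • C i := by
    intro w
    conv_lhs => rw [← B.sum_repr w]
    rw [map_sum]
    refine Finset.sum_congr rfl fun i _ => ?_
    rw [map_smul, hRB, Complex.coe_smul]
  have hRstar : ∀ w, star (R w) = R w := by
    intro w
    rw [hRsum, star_sum]
    refine Finset.sum_congr rfl fun i _ => ?_
    rw [star_smul, hC, hstar, RCLike.star_def, Complex.conj_ofReal]
  have hRalt : ∀ v w, μ.alt (R v) (R w) = (r * ER v w : ℝ) := by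
    intro v w
    conv_rhs => rw [← B.sum_repr v, ← B.sum_repr w]
    rw [hRsum v, hRsum w, alt]
    simp only [map_sum, LinearMap.sum_apply, map_smul, LinearMap.smul_apply, smul_eq_mul,
      Complex.ofReal_mul, Finset.mul_sum, Complex.ofReal_sum]
    refine Finset.sum_congr rfl fun i _ => Finset.sum_congr rfl fun k _ => ?_
    rw [← alt, hC, hC, halt, hB, hB, hER]
    push_cast
    ring
  have hdec : ∀ t, ∃ v w, t = R v + Complex.I • R w := by
    intro t
    refine ⟨∑ i, (C.repr t i).re • B i, ∑ i, (C.repr t i).im • B i, ?_⟩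
    conv_lhs => rw [← C.sum_repr t]
    simp only [map_sum, map_smul, hRB, Finset.smul_sum]
    rw [← Finset.sum_add_distrib]
    refine Finset.sum_congr rfl fun i _ => ?_
    rw [← Complex.coe_smul, ← Complex.coe_smul, smul_smul, ← add_smul, mul_comm Complex.I,
      Complex.re_add_im]
  -- Writing u = Rv + iRw with real parts Rv and Rw, the equation q u = 0 says v = -iw in W.
  have hker : ∀ u ∈ LinearMap.ker q, ∃ w, u = Complex.I • R w - R (Complex.I • w) := by
    intro u hu
    obtain ⟨v, w, rfl⟩ := hdec u
    refine ⟨w, ?_⟩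
    rw [LinearMap.mem_ker, map_add, map_smul, hqR, hqR] at hu
    rw [eq_neg_of_add_eq_zero_left hu, map_neg]
    abel
  have hII : ∀ w : W, Complex.I • Complex.I • w = -w := fun w => by
    rw [smul_smul, Complex.I_mul_I, neg_one_smul]
  have hERI' : ∀ v w, ER v (Complex.I • w) = -ER (Complex.I • v) w := by
    intro v w
    rw [← hERI v, hII, map_neg]
  obtain ⟨A, hA, hA1, hA2⟩ := h.eigenspaces
  rw [finrank_eigenspace_dualMap] at hA1 hA2
  have hqphi : ∀ t, α • A (q t) = β • q (μ.phi t) := by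
    intro t
    have h1 : α • (A ∘ₗ q) = β • (q ∘ₗ μ.phi) := C.ext fun i => by
      simp only [LinearMap.smul_apply, LinearMap.comp_apply]
      rw [hqC, hA, ← hqF, ← map_smul q, ← map_smul q, hphi, hC]
    exact congrArg (fun G => G t) h1
  have hqsurj : Function.Surjective q := fun w => ⟨R w, hqR w⟩
  have hdim : Module.finrank ℂ (LinearMap.ker q) = 4 := by
    have h1 := LinearMap.finrank_range_add_finrank_ker q
    rw [LinearMap.range_eq_top.2 hqsurj, finrank_top, hfin, finrank_tCoord] at h1
    omega
  have hpos : ∀ u ∈ LinearMap.ker q, u ≠ 0 → 0 < μ.posForm u := by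
    intro u hu hu0
    obtain ⟨w, rfl⟩ := hker u hu
    have hw : w ≠ 0 := by
      rintro rfl
      simp at hu0
    have h1 : μ.posForm (Complex.I • R w - R (Complex.I • w)) = 2 * (r * ER (Complex.I • w) w) := by
      have h2 : μ.alt (Complex.I • R w - R (Complex.I • w))
          (star (Complex.I • R w - R (Complex.I • w)))
          = (2 * (r * ER (Complex.I • w) w) : ℝ) * Complex.I := by
        rw [star_sub, star_smul, hRstar, hRstar, sub_eq_add_neg, sub_eq_add_neg, ← neg_one_smul ℂ,
          ← neg_one_smul ℂ, alt_add_left, alt_add_right, alt_add_right]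
        simp only [alt_smul_left, alt_smul_right, hRalt, hERself, hERI']
        simp
        ring
      rw [posForm, h2]
      simp
    rw [h1]
    have := mul_pos hr (hERpos w hw)
    linarith
  have heig : ∀ ε : ℂ, ∀ t ∈ Module.End.eigenspace μ.phi (ε * sqrtNeg μ.disc),
      q t ∈ Module.End.eigenspace A (ε * sqrtNeg D) := by
    intro ε t ht
    rw [Module.End.mem_eigenspace_iff] at ht ⊢
    apply smul_right_injective _ hα
    have h1 := hqphi t
    rw [ht, map_smul, smul_smul, mul_left_comm, ← hαβ] at h1
    change α • A (q t) = α • _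
    rw [h1, smul_smul]
    congr 1
    ring
  -- Each four-dimensional eigenspace of φ is mapped into a two-dimensional eigenspace of A, so it
  -- meets the kernel in dimension at least two. The kernel has dimension four, so both dimensions
  -- are two.
  have hplus : Module.finrank ℂ
      (LinearMap.ker q ⊓ Module.End.eigenspace μ.phi (sqrtNeg μ.disc) : Submodule ℂ TCoord) = 2 := by
    have h1 := finrank_le_finrank_ker_inf_add q (heig 1)
    have h2 := finrank_le_finrank_ker_inf_add q (heig (-1))
    rw [one_mul, one_mul, hA1, (finrank_eigenspace_phi (μ := μ)).1] at h1
    rw [neg_one_mul, neg_one_mul, hA2, (finrank_eigenspace_phi (μ := μ)).2] at h2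
    have h3 := Submodule.finrank_sup_add_finrank_inf_eq
      (LinearMap.ker q ⊓ Module.End.eigenspace μ.phi (sqrtNeg μ.disc))
      (LinearMap.ker q ⊓ Module.End.eigenspace μ.phi (-sqrtNeg μ.disc))
    have h4 : (LinearMap.ker q ⊓ Module.End.eigenspace μ.phi (sqrtNeg μ.disc)) ⊓
        (LinearMap.ker q ⊓ Module.End.eigenspace μ.phi (-sqrtNeg μ.disc)) = ⊥ := by
      rw [eq_bot_iff]
      rintro x ⟨⟨-, h5⟩, ⟨-, h6⟩⟩
      rw [SetLike.mem_coe, Module.End.mem_eigenspace_iff] at h5 h6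
      rw [h5, neg_smul, eq_neg_iff_add_eq_zero, ← two_smul ℂ, smul_eq_zero, smul_eq_zero] at h6
      exact (h6.resolve_left two_ne_zero).resolve_left (sqrtNeg_ne_zero μ.disc_pos)
    have h5 : Module.finrank ℂ ((LinearMap.ker q ⊓ Module.End.eigenspace μ.phi (sqrtNeg μ.disc)) ⊔
        (LinearMap.ker q ⊓ Module.End.eigenspace μ.phi (-sqrtNeg μ.disc)) : Submodule ℂ TCoord)
        ≤ 4 :=
      (Submodule.finrank_mono (sup_le inf_le_left inf_le_left)).trans hdim.le
    rw [h4, finrank_bot] at h3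
    omega
  obtain ⟨σ, hσ, hH⟩ := exists_ker_eq hdim (fun u hu => by
      have h1 := hqphi u
      rw [LinearMap.mem_ker.1 hu, map_zero, smul_zero, eq_comm, smul_eq_zero] at h1
      exact h1.resolve_left hβ) (fun x hx y hy => by
      obtain ⟨v, rfl⟩ := hker x hx
      obtain ⟨w, rfl⟩ := hker y hy
      rw [sub_eq_add_neg, sub_eq_add_neg, ← neg_one_smul ℂ,
          ← neg_one_smul ℂ (R (Complex.I • w)), alt_add_left, alt_add_right, alt_add_right]
      simp only [alt_smul_left, alt_smul_right, hRalt, hERI', hII, map_neg, LinearMap.neg_apply]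
      push_cast
      linear_combination (r * ER v w : ℂ) * Complex.I_mul_I) hpos hplus
  exact ⟨σ, hσ, hH ▸ hpos, q, hqsurj, hH, hqF⟩

end Model

namespace Datum

variable {V : Type*} [AddCommGroup V] [Module.Free ℤ V] [Module.Finite ℤ V] (d : Datum V)

/-- The lattice, its form and φ are the same at all points of the family, so the lattice map can be
built with an arbitrary base point p₀. The complex structure of the given variety, carried over by
this map, then determines the point p. -/
theorem exists_weilIsogenous {Λ W : Type*} [AddCommGroup Λ] [AddCommGroup W] [Module ℂ W]
    {j : Λ →ₗ[ℤ] W} {E : Λ →ₗ[ℤ] Λ →ₗ[ℤ] ℚ} {ψ : Module.End ℤ Λ} {D : ℕ}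
    (h : IsPolarizedWeil 2 j E ψ D) (hK : quadField D = quadField d.D) (hdet : HasDet 2 E ψ D 1) :
    ∃ p ∈ d.half d.t₁, WeilIsogenous j E ψ D (d.j p) d.form d.phiZ d.D := by
  obtain ⟨p₀, hp₀⟩ := d.half_nonempty (ε := d.t₁) (by exact_mod_cast d.t₁_ne)
  obtain ⟨f, ⟨a, b, ha, hb, hab, hf⟩, n, hn, hfn⟩ := h.exists_lattice_map hdet
    (isPolarizedWeil (mem_periodDomain.1 hp₀.1) (d.isPolarization_of_mem hp₀)) d.hasDet hK
  let F : Λ →ₗ[ℤ] TCoord :=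
    d.tCoord.toLinearMap.restrictScalars ℤ ∘ₗ latticeMap V ∘ₗ f
  have hF : ∀ x, F x = d.tCoord (latticeMap V (f x)) := fun x => rfl
  have hsqrt : (a : ℂ) * sqrtNeg D = b * sqrtNeg d.model.disc := by
    have h1 : (a : ℝ) * √(D : ℝ) = b * √d.model.disc := by
      rw [← D_eq, ← Real.sqrt_sq (Nat.cast_nonneg a), ← Real.sqrt_sq (Nat.cast_nonneg b),
        ← Real.sqrt_mul (by positivity), ← Real.sqrt_mul (by positivity)]
      congr 1
      exact_mod_cast hab
    have h2 := congrArg (fun x : ℝ => Complex.I * (x : ℂ)) h1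
    push_cast at h2
    rw [sqrtNeg, sqrtNeg]
    linear_combination h2
  obtain ⟨σ, hσ, hpos, q, hq, hker, hqF⟩ := Model.exists_isPeriod (μ := d.model) h (F := F)
    (fun x => d.frame.star_tCoord (f x)) (α := a) (β := b) (by exact_mod_cast ha.ne')
    (by exact_mod_cast hb.ne') hsqrt (fun x => by
      rw [hF, hF, phi_lattice, Nat.cast_smul_eq_nsmul, Nat.cast_smul_eq_nsmul,
        ← map_nsmul d.tCoord, ← map_nsmul d.tCoord, ← map_nsmul (latticeMap V),
        ← map_nsmul (latticeMap V), hf]) (r := (n : ℝ) ^ 2) (by positivity) (fun x y => by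
      rw [hF, hF, alt_lattice, hfn]
      push_cast
      ring)
  have hne : d.kCoord.symm σ ≠ 0 := fun h0 => hσ.ne_zero (by simpa using h0)
  obtain ⟨c, hc, hrep⟩ := d.exists_rep_mk _ hne
  set p := Projectivization.mk ℂ (d.kCoord.symm σ) hne with hp
  rw [LinearEquiv.apply_symm_apply] at hrep
  have hkp : d.model.ker (d.rep p) = d.model.ker σ := by rw [hrep, Model.ker_smul hc]
  have hper : d.model.IsPeriod (d.rep p) := by
    rw [hrep]
    exact Model.isPeriod_smul hc hσ
  refine ⟨p, d.mem_half_of_isPolarization (mem_periodDomain.2 hper) ?_, f, ?_⟩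
  · rw [isPolarization_iff hper, hkp]
    exact hpos
  · have hle : LinearMap.ker (q ∘ₗ d.tCoord.toLinearMap) = hodge10 d.vol d.t₂ d.t₃ p.rep := by
      rw [hodge_eq hper, LinearMap.ker_comp, hker, hkp]
    let B : d.T p ≃ₗ[ℂ] W := (Submodule.quotEquivOfEq _ _ hle.symm).trans
      ((q ∘ₗ d.tCoord.toLinearMap).quotKerEquivOfSurjective (hq.comp d.tCoord.surjective))
    refine ⟨B.symm, fun x => ?_, ⟨a, b, ha, hb, hab, hf⟩, n, hn, hfn⟩
    rw [LinearEquiv.symm_apply_eq, ← hqF]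
    rfl

end Datum

end WeilTori

end

theorem theorem4p1
    {V : Type*} [AddCommGroup V] [Module.Free ℤ V] [Module.Finite ℤ V]
    (hV : Module.finrank ℤ V = 4) (vol : ⋀[ℤ]^4 V ≃ₗ[ℤ] ℤ)
    (ϑ₁ ϑ₂ ϑ₃ : ℤ) (hϑ₁ : ϑ₁ ≠ 0) (hϑ₂ : ϑ₂ ≠ 0) (hϑ₃ : ϑ₃ ≠ 0)
    (m : ℚ) (hm : 0 < m) (hϑm : (ϑ₁ : ℚ) * ϑ₂ = 2 * m * (ϑ₃ : ℚ) ^ 2)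
    (h : Module.Dual ℤ (⋀[ℤ]^2 V × ℤ)) (hh : 0 < WeilTori.dualSq vol m h) :
    (∃! C, WeilTori.IsPlusComponent vol ϑ₁ ϑ₂ ϑ₃ m h C) ∧
    ∀ C, WeilTori.IsPlusComponent vol ϑ₁ ϑ₂ ϑ₃ m h C →
      ∃ (φ : Module.End ℤ (V × Module.Dual ℤ V)) (D : ℕ),
        WeilTori.quadField D = WeilTori.quadField ((m * WeilTori.dualSq vol m h : ℚ) : ℝ) ∧
        (∀ p ∈ C,
          WeilTori.IsPolarizedWeil 2 (WeilTori.JLattice vol ϑ₂ ϑ₃ p)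
            (WeilTori.polForm vol ϑ₁ ϑ₂ ϑ₃ h) φ D ∧
          WeilTori.HasDet 2 (WeilTori.polForm vol ϑ₁ ϑ₂ ϑ₃ h) φ D 1) ∧
        ∀ (Λ W : Type*) [AddCommGroup Λ] [AddCommGroup W] [Module ℂ W]
          (j : Λ →ₗ[ℤ] W) (E : Λ →ₗ[ℤ] Λ →ₗ[ℤ] ℚ) (ψ : Module.End ℤ Λ) (D' : ℕ),
          WeilTori.IsPolarizedWeil 2 j E ψ D' →
          WeilTori.quadField D' = WeilTori.quadField ((m * WeilTori.dualSq vol m h : ℚ) : ℝ) →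
          WeilTori.HasDet 2 E ψ D' 1 →
          ∃ p ∈ C, WeilTori.WeilIsogenous j E ψ D' (WeilTori.JLattice vol ϑ₂ ϑ₃ p)
            (WeilTori.polForm vol ϑ₁ ϑ₂ ϑ₃ h) φ D := by
  obtain ⟨d, rfl, rfl, rfl, rfl, rfl, rfl⟩ :=
    WeilTori.exists_datum vol ϑ₁ ϑ₂ ϑ₃ hϑ₁ hϑ₃ m hm hϑm h hh
  refine ⟨⟨d.half d.t₁, (d.isPlusComponent_iff _).2 rfl, fun C hC => (d.isPlusComponent_iff C).1 hC⟩,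
    fun C hC => ?_⟩
  rw [d.isPlusComponent_iff] at hC
  subst hC
  refine ⟨d.phiZ, d.D, d.quadField_D, fun p hp => ⟨WeilTori.Datum.isPolarizedWeil
    (WeilTori.Datum.mem_periodDomain.1 hp.1) (d.isPolarization_of_mem hp), d.hasDet⟩, ?_⟩
  intro Λ W _ _ _ j E ψ D' hE hK hdet
  exact d.exists_weilIsogenous hE (hK.trans d.quadField_D.symm) hdet
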